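/- **Setting.** Let $V=\mathbb C^3$ carry the Hermitian form $\langle x,y\rangle=x_1\bar y_1+x_2\bar y_2-x_3\bar y_3$; a point of $\mathbb PV$ represented by $p$ is negative, isotropic or positive according to the sign $\sigma p\in\{-,0,+\}$ of $\langle p,p\rangle$. Let $\mathrm{SU}(2,1)$ be the group of determinant $1$ linear maps preserving the form, and $\mathrm{PU}(2,1)$ its quotient by the scalars $\Omega=\{\delta:\delta^3=1\}$. A nonidentical isometry in $\mathrm{PU}(2,1)$ is *elliptic* if it fixes a negative point and *parabolic* if it fixes exactly one isotropic point. An elliptic isometry is *regular* if its eigenvalues are pairwise distinct and *special* otherwise. A parabolic isometry is *ellipto-parabolic* if it has no unipotent lift; an isometry with a unipotent lift $F$ is *$3$-step unipotent* if $(F-1)^2\ne0$. Special elliptic isometries are those of the form $$R^p_\alpha x=(\alpha^{-2}-\alpha)\frac{\langle x,p\rangle}{\langle p,p\rangle}p+\alpha x,\qquad \sigma p\neq0,\ |\alpha|=1,\ \alpha^3\ne1,$$ with center $p$ and parameter $\alpha$. Let $\mathcal G$ be the space of $\mathrm{PU}(2,1)$-conjugacy classes (quotient topology) and $\rho:\mathcal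 G\to c(\mathcal G)$ its maximal Hausdorff quotient. Let $\mathsf T=\{(\theta_1,\theta_2)\in\mathbb R^2: 0\le\theta_2\le\theta_1\le2\pi\}$. A point $(\theta_1,\theta_2)\in\mathsf T$ is regarded as a point of $c(\mathcal G)$, namely the image under $\rho$ of the class of $\mathrm{diag}\big(e^{\frac{2\theta_1-\theta_2}3i},e^{\frac{2\theta_2-\theta_1}3i},e^{-\frac{\theta_1+\theta_2}3i}\big)$, the isometry with angle pair $\{\theta_1,\theta_2\}$ (so $(\theta,0)$ and $(2\pi,\theta)$ give the same point); a segment $[P,Q]\subset\mathsf T$ is regarded as a subset of $c(\mathcal G)$ in the same way. For unit complex numbers $\alpha_1,\alpha_2\notin\Omega$, let $\mathcal D^{\sigma_1\sigma_2}\subset\mathcal G$ be the set of identical, elliptic or parabolic classes of isometries having a lift $F=R_{\alpha_2}^{p_2}R_{\alpha_1}^{p_1}$ with $\sigma p_j=\sigma_j$, $j=1,2$, and put $\mathsf E^{\sigma_1\sigma_2}_{\alpha_1,\alpha_2}=\rho(\mathcal D^{\sigma_1\sigma_2})$. Let $\mathsf E_{\alpha_1,\alpha_2}$ be defined likewise with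 no condition on the signs of the nonisotropic points $p_1,p_2$. The classes of $\mathcal D^{\sigma_1\sigma_2}$ *over* a point are those mapped to it by $\rho$. **Proposition.** Let $\alpha_1=e^{a_1i}$, $\alpha_2=e^{a_2i}$ with $0<a_1,a_2<2\pi/3$, and put $s=a_1+a_2$. Then $\mathsf E_{\alpha_1,\alpha_2}=\mathsf E^{--}_{\alpha_1,\alpha_2}\cup\mathsf E^{++}_{\alpha_1,\alpha_2}\cup\mathsf E^{+-}_{\alpha_1,\alpha_2}\cup\mathsf E^{-+}_{\alpha_1,\alpha_2}$, where all segments below lie in $\mathsf T$ and: 1. $\mathsf E^{--}_{\alpha_1,\alpha_2}=[P,Q]$ with $P=(3s,3s)$, $Q=(2\pi,\pi+\tfrac{3s}2)$ if $s\le 2\pi/3$, and $P=(3s-2\pi,3s-2\pi)$, $Q=(\tfrac{3s}2-\pi,0)$ if $s>2\pi/3$. If $\mathsf E^{--}_{\alpha_1,\alpha_2}$ is a single point, then $\mathcal D^{--}$ consists of the identical class only. Otherwise exactly one class of $\mathcal D^{--}$ lies over $P$, and it is special elliptic with negative center, and exactly one lies over $Q$, and it is ellipto-parabolic. 2. $\mathsf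 E^{++}_{\alpha_1,\alpha_2}=[P,Q]\cup[Q,S]$, where $P=(2\pi-3a_1,2\pi-3a_2)$ if $a_1\le a_2$ and $P=(2\pi-3a_2,2\pi-3a_1)$ if $a_1\ge a_2$; and $Q=(2\pi,2\pi-3s)$, $S=(\pi+\tfrac{3s}2,0)$ if $s\le2\pi/3$, while $Q=(4\pi-3s,0)$, $S=(2\pi,\tfrac{3s}2-\pi)$ if $s>2\pi/3$. The first segment is nondegenerate of slope $-1$; the second has slope $\frac12$ or $2$ or is a single point. Exactly one class of $\mathcal D^{++}$ lies over $P$, and it is (possibly special) elliptic. If $[Q,S]$ is a single point, the classes of $\mathcal D^{++}$ over $Q$ are exactly the identical class and a $3$-step unipotent class. Otherwise there are a special elliptic class $c$ with positive center and ellipto-parabolic classes $d,e$, with $c,d$ over $Q$ and $e$ over $S$, such that the classes of $\mathcal D^{++}$ over $Q$ or $S$ are exactly $c,d,e$. (So if $Q$ and $S$ are different points of $c(\mathcal G)$, those over $Q$ are $c,d$ and the one over $S$ is $e$.) 3. $\mathsf E^{+-}_{\alpha_1,\alpha_2}=[P,Q]$ with $P=(3a_2,3a_2-3a_1)$, $Q=(\tfrac{3s}2,0)$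 if $a_1\le a_2$, and $P=(2\pi+3a_2-3a_1,3a_2)$, $Q=(2\pi,\tfrac{3s}2)$ if $a_1\ge a_2$. It is a single point if and only if $\alpha_1=\alpha_2$, in which case $\mathcal D^{+-}$ consists of a single class, special elliptic with positive center. If $\alpha_1\ne\alpha_2$, exactly one class of $\mathcal D^{+-}$ lies over $P$, and it is regular elliptic, and exactly one lies over $Q$, and it is ellipto-parabolic. 4. $\mathsf E^{-+}_{\alpha_1,\alpha_2}=[P,Q]$ with $P=(2\pi+3a_1-3a_2,3a_1)$, $Q=(2\pi,\tfrac{3s}2)$ if $a_1\le a_2$, and $P=(3a_1,3a_1-3a_2)$, $Q=(\tfrac{3s}2,0)$ if $a_1\ge a_2$. It is a single point if and only if $\alpha_1=\alpha_2$, in which case $\mathcal D^{-+}$ consists of a single class, special elliptic with positive center. If $\alpha_1\ne\alpha_2$, exactly one class of $\mathcal D^{-+}$ lies over $P$, and it is regular elliptic, and exactly one lies over $Q$, and it is ellipto-parabolic. -/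

import Mathlib

open scoped Matrix

noncomputable section

namespace ComplexHyperbolic

/-- The three-dimensional complex vector space on which `SU(2,1)` acts. -/
abbrev V : Type := Fin 3 → ℂ

/-- The standard Hermitian form of signature `(+,+,-)` on `V`, linear in the first argument. -/
def herm (x y : V) : ℂ := x 0 * star (y 0) + x 1 * star (y 1) - x 2 * star (y 2)

/-- The signature of the point of the projective plane represented by `p`: it is `-1`, `0`, `1`
when `p` is negative, isotropic, positive. (The number `herm p p` is always real.) -/
def sgn (p : V) : SignType := SignType.sign (herm p p).re

/-- The group `SU(2,1)`: the determinant one matrices that preserve the Hermitian form. -/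
def SU21 : Subgroup (Matrix.SpecialLinearGroup (Fin 3) ℂ) where
  carrier := {A | ∀ x y : V, herm (A.1 *ᵥ x) (A.1 *ᵥ y) = herm x y}
  mul_mem' := by
    intro A B hA hB x y
    have h : ∀ z : V, (A * B).1 *ᵥ z = A.1 *ᵥ (B.1 *ᵥ z) := by
      intro z
      rw [Matrix.mulVec_mulVec]
      rfl
    rw [h, h, hA, hB]
  one_mem' := by
    intro x y
    simp
  inv_mem' := by
    intro A hA x y
    have h : ∀ z : V, A.1 *ᵥ ((A⁻¹).1 *ᵥ z) = z := by
      intro z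
      rw [Matrix.mulVec_mulVec]
      have h1 : A.1 * (A⁻¹).1 = (A * A⁻¹).1 := rfl
      rw [h1, mul_inv_cancel]
      simp
    rw [← hA, h, h]

/-- The underlying matrix of an element of `SU(2,1)`. -/
def mat (F : SU21) : Matrix (Fin 3) (Fin 3) ℂ := F.1.1

/-- The subgroup of scalar matrices of `SU(2,1)`; the scalars are the cube roots of unity,
since the determinant is one. -/
def scalars : Subgroup SU21 where
  carrier := {F | ∃ δ : ℂ, mat F = δ • (1 : Matrix (Fin 3) (Fin 3) ℂ)}
  mul_mem' := by
    rintro F F' ⟨δ, h⟩ ⟨ε, h'⟩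
    refine ⟨δ * ε, ?_⟩
    have h1 : mat (F * F') = mat F * mat F' := rfl
    rw [h1, h, h']
    simp [smul_smul, mul_comm]
  one_mem' := ⟨1, by rw [one_smul]; rfl⟩
  inv_mem' := by
    rintro F ⟨δ, h⟩
    have h1 : mat F * mat F⁻¹ = 1 := by
      have h2 : mat F * mat F⁻¹ = mat (F * F⁻¹) := rfl
      rw [h2, mul_inv_cancel]
      rfl
    have hδ : δ ≠ 0 := by
      rintro rfl
      rw [h, zero_smul, zero_mul] at h1
      exact zero_ne_one h1
    refine ⟨δ⁻¹, ?_⟩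
    rw [h, smul_mul_assoc, one_mul] at h1
    rw [← h1, smul_smul, inv_mul_cancel₀ hδ, one_smul]

instance scalars_normal : scalars.Normal where
  conj_mem := by
    rintro F ⟨δ, h⟩ I
    refine ⟨δ, ?_⟩
    have h1 : mat (I * F * I⁻¹) = mat I * mat F * mat I⁻¹ := rfl
    have h2 : mat I * mat I⁻¹ = 1 := by
      have h3 : mat I * mat I⁻¹ = mat (I * I⁻¹) := rfl
      rw [h3, mul_inv_cancel]
      rfl
    rw [h1, h, mul_smul_comm, mul_one, smul_mul_assoc, h2]

/-- The group `PU(2,1)`, with the quotient topology. -/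
abbrev PU21 : Type := SU21 ⧸ scalars

/-- The space of all `PU(2,1)`-conjugacy classes. -/
def ClassSpace : Type := ConjClasses PU21

/-- The `PU(2,1)`-conjugacy class of an element of `PU(2,1)`. -/
def toClass (g : PU21) : ClassSpace := ConjClasses.mk g

/-- The space of classes carries the quotient topology. -/
instance instTopologicalSpaceClassSpace : TopologicalSpace ClassSpace :=
  TopologicalSpace.coinduced toClass inferInstance

/-- The maximal Hausdorff quotient of the space of classes. -/
abbrev HausdorffClassSpace : Type := T2Quotient ClassSpace

/-- The natural projection onto the maximal Hausdorff quotient. -/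
def rho : ClassSpace → HausdorffClassSpace := T2Quotient.mk

/-- The `PU(2,1)`-conjugacy class of the isometry with lift `F`. -/
def cls (F : SU21) : ClassSpace := toClass (QuotientGroup.mk F)

/-- The classes of the isometries that have a lift satisfying `P`. -/
def classesOf (P : SU21 → Prop) : Set ClassSpace := {c | ∃ F : SU21, cls F = c ∧ P F}

/-- `F` is trivial as an isometry. -/
def IsTrivial (F : SU21) : Prop := F ∈ scalars

/-- The point represented by `v` is fixed by `F`. -/
def Fixes (F : SU21) (v : V) : Prop := v ≠ 0 ∧ ∃ μ : ℂ, mat F *ᵥ v = μ • v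

/-- A nonidentical isometry that fixes a negative point. -/
def IsElliptic (F : SU21) : Prop :=
  ¬ IsTrivial F ∧ ∃ v : V, sgn v = -1 ∧ Fixes F v

/-- A nonidentical isometry that fixes exactly one isotropic point. -/
def IsParabolic (F : SU21) : Prop :=
  ¬ IsTrivial F ∧ ∃ v : V, sgn v = 0 ∧ Fixes F v ∧
    ∀ w : V, sgn w = 0 → Fixes F w → ∃ δ : ℂ, w = δ • v

/-- An elliptic isometry with pairwise distinct eigenvalues. -/
def IsRegularElliptic (F : SU21) : Prop :=
  IsElliptic F ∧ (mat F).charpoly.roots.Nodup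

/-- The map `x ↦ (α⁻² - α) (⟨x,p⟩ / ⟨p,p⟩) p + α x`. -/
def R (α : ℂ) (p : V) (x : V) : V :=
  (((α ^ 2)⁻¹ - α) * (herm x p / herm p p)) • p + α • x

/-- `F` is a special elliptic isometry whose center has signature `σ`. -/
def IsSpecialElliptic (σ : SignType) (F : SU21) : Prop :=
  ∃ (α : ℂ) (p : V), ‖α‖ = 1 ∧ α ^ 3 ≠ 1 ∧ sgn p ≠ 0 ∧ sgn p = σ ∧ ∀ x : V, mat F *ᵥ x = R α p x

/-- A parabolic isometry none of whose lifts is unipotent. (A matrix `δF` with `δ³ = 1` is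
unipotent exactly when `F - δ⁻¹` is nilpotent, and `F - c` nilpotent forces `c³ = det F = 1`.) -/
def IsElliptoParabolic (F : SU21) : Prop :=
  IsParabolic F ∧ ¬ ∃ c : ℂ, (mat F - c • (1 : Matrix (Fin 3) (Fin 3) ℂ)) ^ 3 = 0

/-- `F` is unipotent of nilpotency order exactly three. -/
def IsThreeStepUnipotent (F : SU21) : Prop :=
  (mat F - 1) ^ 3 = 0 ∧ (mat F - 1) ^ 2 ≠ 0

/-- The union of the elliptic classes (with the identical one) and of the boundary classes:
classes of isometries that are identical, elliptic or parabolic. -/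
def IsEllipticOrParabolic (F : SU21) : Prop := IsTrivial F ∨ IsElliptic F ∨ IsParabolic F

/-- `F` is the product of special elliptic isometries with parameters `α₁`, `α₂` and
centers `p₁`, `p₂`. -/
def IsProduct (α₁ α₂ : ℂ) (p₁ p₂ : V) (F : SU21) : Prop :=
  ∀ x : V, mat F *ᵥ x = R α₂ p₂ (R α₁ p₁ x)

/-- Identical, elliptic and parabolic classes that admit a decomposition with parameters
`α₁`, `α₂`. -/
def decompClasses (α₁ α₂ : ℂ) : Set ClassSpace :=
  classesOf fun F => IsEllipticOrParabolic F ∧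
    ∃ p₁ p₂ : V, sgn p₁ ≠ 0 ∧ sgn p₂ ≠ 0 ∧ IsProduct α₁ α₂ p₁ p₂ F

/-- Identical, elliptic and parabolic classes that admit a decomposition with parameters
`α₁`, `α₂` and centers of signatures `σ₁`, `σ₂`. -/
def signedClasses (α₁ α₂ : ℂ) (σ₁ σ₂ : SignType) : Set ClassSpace :=
  classesOf fun F => IsEllipticOrParabolic F ∧
    ∃ p₁ p₂ : V, sgn p₁ ≠ 0 ∧ sgn p₂ ≠ 0 ∧ sgn p₁ = σ₁ ∧ sgn p₂ = σ₂ ∧ IsProduct α₁ α₂ p₁ p₂ F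

/-- The set `E_{α₁,α₂}` in the maximal Hausdorff quotient. -/
def decompSet (α₁ α₂ : ℂ) : Set HausdorffClassSpace := rho '' decompClasses α₁ α₂

/-- The set `E_{α₁,α₂}^{σ₁σ₂}` in the maximal Hausdorff quotient. -/
def signedSet (α₁ α₂ : ℂ) (σ₁ σ₂ : SignType) : Set HausdorffClassSpace :=
  rho '' signedClasses α₁ α₂ σ₁ σ₂

/-- The diagonal entries of the elliptic isometry with angle pair `θ`. -/
def angleEntries (θ : ℝ × ℝ) : V :=
  ![Complex.exp (((2 * θ.1 - θ.2) / 3 : ℝ) * Complex.I),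
    Complex.exp (((2 * θ.2 - θ.1) / 3 : ℝ) * Complex.I),
    Complex.exp ((-(θ.1 + θ.2) / 3 : ℝ) * Complex.I)]

theorem det_angle (θ : ℝ × ℝ) : (Matrix.diagonal (angleEntries θ)).det = 1 := by
  rw [Matrix.det_diagonal, Fin.prod_univ_three]
  simp only [angleEntries, Matrix.cons_val_zero, Matrix.cons_val_one, Matrix.cons_val]
  rw [← Complex.exp_add, ← Complex.exp_add, ← Complex.exp_zero]
  congr 1
  push_cast
  ring

theorem exp_mul_star (t : ℝ) :
    Complex.exp ((t : ℂ) * Complex.I) * star (Complex.exp ((t : ℂ) * Complex.I)) = 1 := by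
  have h := Complex.mul_conj (Complex.exp ((t : ℂ) * Complex.I))
  rw [Complex.normSq_eq_norm_sq, Complex.norm_exp_ofReal_mul_I] at h
  simpa using h

/-- The isometry with angle pair `θ = (θ₁, θ₂)`: the negative point spanned by the last basis
vector is fixed, and the two orthogonal complex geodesics through it that are spanned with
the other basis vectors are rotated by `θ₁` and `θ₂`. -/
def angleElement (θ : ℝ × ℝ) : SU21 :=
  ⟨⟨Matrix.diagonal (angleEntries θ), det_angle θ⟩, by
    intro x y
    simp only [herm, Matrix.mulVec_diagonal, angleEntries, Matrix.cons_val_zero,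
      Matrix.cons_val_one, Matrix.cons_val, star_mul']
    have h0 := exp_mul_star ((2 * θ.1 - θ.2) / 3)
    have h1 := exp_mul_star ((2 * θ.2 - θ.1) / 3)
    have h2 := exp_mul_star (-(θ.1 + θ.2) / 3)
    linear_combination (x 0 * star (y 0)) * h0 + (x 1 * star (y 1)) * h1
      - (x 2 * star (y 2)) * h2⟩

/-- The point of the maximal Hausdorff quotient determined by an angle pair. -/
def point (θ : ℝ × ℝ) : HausdorffClassSpace := rho (cls (angleElement θ))

/-- The triangle of angle pairs. -/
def triangle : Set (ℝ × ℝ) := {θ | 0 ≤ θ.2 ∧ θ.2 ≤ θ.1 ∧ θ.1 ≤ 2 * Real.pi}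

/-- The image in the maximal Hausdorff quotient of the segment with end points `P`, `Q`. -/
def seg (P Q : ℝ × ℝ) : Set HausdorffClassSpace := point '' segment ℝ P Q

/-- The classes of a set `C` that lie over the angle pair `θ`. -/
def lyingOver (C : Set ClassSpace) (θ : ℝ × ℝ) : Set ClassSpace := {c | c ∈ C ∧ rho c = point θ}

/-- The vector from `P` to `Q` is proportional to `(1, m)`. -/
def HasSlope (m : ℝ) (P Q : ℝ × ℝ) : Prop := Q.2 - P.2 = m * (Q.1 - P.1)

end ComplexHyperbolic

end

open ComplexHyperbolic

noncomputable section

namespace ComplexHyperbolic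

/-! ### The Hermitian form -/

/-! Scale the centers so that `⟨p₁,p₁⟩ = s₁`, `⟨p₂,p₂⟩ = s₂` are signs and `⟨p₁,p₂⟩ = g ≥ 0`, and
put `τ = s₁s₂g²`. Unless `τ = 1`, Witt's theorem makes the class of the product depend only on the
signs and `τ`. For `τ = 1` negative centers coincide, while positive centers either coincide or span
a line tangent to the absolute; the tangent pair yields one extra class.

Write `h = e^{-i(a₁+a₂)/2}`, `D = 3(a₂-a₁)/2`, `Σ = 3(a₁+a₂)/2`. On the span of the centers the
product has determinant `h²` and trace `2h Re z`, where `z` is the point of the line through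
`e^{iD}` and `e^{-iΣ}` with parameter `τ` (`chord`); on the orthogonal complement of the span the
eigenvalue is `he^{iΣ}`. The product fails to be identical, elliptic or parabolic as soon as `|Re z|
> 1` (`abs_chord_re_le`), so `Re z = cos φ` with `0 ≤ φ ≤ π`, and the eigenvalues on the span are
`he^{±iφ}`. As `Re z` is strictly decreasing in `τ`, the number `φ` replaces `τ` as parameter. All
eigenvalues have arguments affine in `φ`, hence so have the angle pairs: this is why segments
appear.

It remains to know which eigenvector is negative. The eigenvector for `he^{iφ}` has square `2s₁ sin
φ (sin φ + Im z)` (`herm_eigv_eigv`), and `1-|z|²` has the sign of `τ(1-τ)`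
(`one_sub_normSq_chord`). For `0 < τ < 1` the span is positive and its complement carries the
negative eigenvector. Outside `[0,1]` the sign of `Im z` decides; it is constant because the line
lies outside the unit disc there and would have to cross the real axis with `|Re z| > 1`
(`im_sign_of_one_lt`, `im_sign_of_neg`).

The signs of the centers select the interval of `φ`: `τ ≥ 1` for two negative centers, `τ ≥ 0` for
two positive ones, with a fold of the path at `τ = 1`, and `τ ≤ 0` for mixed signs. At `τ = 0` the
centers are orthogonal, at `τ = 1` they coincide or are tangent, and at a double eigenvalue `±h`
with `τ ≠ 1` the product is ellipto-parabolic.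

In the Hausdorff quotient two facts are needed. Identifications come from continuity: families of
products that agree with angle pairs inside an interval agree at its ends, and the tangent class
cannot be separated from that of equal centers. Distinctness comes from the continuous invariant
`inv`, built from the trace and from the direction `λ/|λ|` of an eigenvalue with nonpositive
eigenvector; it recovers the unordered pair `e^{iθ₁}, e^{iθ₂}`. Hence only points on the sides `θ₂ =
0` and `θ₁ = 2π` of the triangle can be glued, which makes the fibres over the ends computable. -/

theorem herm_add_left (x y z : V) : herm (x + y) z = herm x z + herm y z := by
  simp only [herm, Pi.add_apply]; ring

theorem herm_sub_left (x y z : V) : herm (x - y) z = herm x z - herm y z := by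
  simp only [herm, Pi.sub_apply]; ring

theorem herm_smul_left (k : ℂ) (x y : V) : herm (k • x) y = k * herm x y := by
  simp only [herm, Pi.smul_apply, smul_eq_mul]; ring

theorem herm_add_right (x y z : V) : herm x (y + z) = herm x y + herm x z := by
  simp only [herm, Pi.add_apply, star_add]; ring

theorem herm_sub_right (x y z : V) : herm x (y - z) = herm x y - herm x z := by
  simp only [herm, Pi.sub_apply, star_sub]; ring

theorem herm_smul_right (k : ℂ) (x y : V) : herm x (k • y) = star k * herm x y := by
  simp only [herm, Pi.smul_apply, smul_eq_mul, star_mul']; ring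

theorem herm_zero_left (x : V) : herm 0 x = 0 := by simp [herm]

theorem star_herm (x y : V) : star (herm x y) = herm y x := by
  simp only [herm, star_add, star_sub, star_mul', star_star]; ring

theorem herm_self_eq_re (x : V) : herm x x = ((herm x x).re : ℂ) :=
  (Complex.conj_eq_iff_re.1 (star_herm x x)).symm

theorem herm_self_re (x : V) : (herm x x).re = ‖x 0‖ ^ 2 + ‖x 1‖ ^ 2 - ‖x 2‖ ^ 2 := by
  simp only [herm, Complex.star_def, Complex.mul_conj, Complex.normSq_eq_norm_sq]
  norm_cast

theorem herm_eq_zero_comm {x y : V} : herm x y = 0 ↔ herm y x = 0 := by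
  rw [← star_herm y x, star_eq_zero]

theorem herm_self_ne_zero_of_sgn {p : V} (h : sgn p ≠ 0) : herm p p ≠ 0 := by
  intro h0; apply h; simp [sgn, h0]

theorem sgn_eq_one_iff {p : V} : sgn p = 1 ↔ 0 < (herm p p).re := sign_eq_one_iff
theorem sgn_eq_neg_one_iff {p : V} : sgn p = -1 ↔ (herm p p).re < 0 := sign_eq_neg_one_iff
theorem sgn_eq_zero_iff {p : V} : sgn p = 0 ↔ herm p p = 0 := by
  rw [sgn, sign_eq_zero_iff, herm_self_eq_re p]; norm_cast

/-- A nonzero vector of nonpositive square has a nonzero last coordinate. -/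
theorem last_ne_zero {v : V} (hv : v ≠ 0) (h : (herm v v).re ≤ 0) : v 2 ≠ 0 := by
  intro h2
  rw [herm_self_re, h2] at h
  have h0 : ‖v 0‖ = 0 := by
    have := sq_nonneg ‖v 0‖; have := sq_nonneg ‖v 1‖
    simp only [norm_zero] at h; nlinarith [norm_nonneg (v 0)]
  have h1 : ‖v 1‖ = 0 := by
    simp only [norm_zero] at h; nlinarith [norm_nonneg (v 1), sq_nonneg ‖v 0‖]
  apply hv; funext i; fin_cases i
  · simpa using h0
  · simpa using h1
  · simpa using h2

/-- A vector whose last coordinate vanishes has nonnegative square. -/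
theorem eq_zero_of_last {v : V} (h2 : v 2 = 0) (h : (herm v v).re ≤ 0) : v = 0 := by
  by_contra hv; exact last_ne_zero hv h h2

/-- Reverse Cauchy-Schwarz: two orthogonal vectors of nonpositive square are proportional. -/
theorem proportional_of_orthogonal {v w : V} (hv : v ≠ 0) (hvn : (herm v v).re ≤ 0)
    (hwn : (herm w w).re ≤ 0) (h : herm w v = 0) : ∃ δ : ℂ, w = δ • v := by
  have hv2 := last_ne_zero hv hvn
  -- This factor kills the last coordinate of `w - k • v`. By orthogonality the square of the
  -- difference is `⟨w,w⟩ + |k|²⟨v,v⟩ ≤ 0`, so the difference vanishes.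
  refine ⟨w 2 / v 2, ?_⟩
  have h' : herm v w = 0 := herm_eq_zero_comm.1 h
  rw [← sub_eq_zero]
  apply eq_zero_of_last
  · simp [div_mul_cancel₀ _ hv2]
  · set k := w 2 / v 2
    have : herm (w - k • v) (w - k • v) = herm w w + k * star k * herm v v := by
      rw [herm_sub_left, herm_sub_right, herm_sub_right, herm_smul_left, herm_smul_left,
        herm_smul_right, herm_smul_right, h, h']
      ring
    rw [this, Complex.star_def, Complex.mul_conj, Complex.add_re, Complex.re_ofReal_mul]
    have := Complex.normSq_nonneg k
    nlinarith

/-- A vector orthogonal to a negative one is zero or positive. -/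
theorem eq_zero_of_orthogonal_neg {v w : V} (hv : (herm v v).re < 0)
    (hwn : (herm w w).re ≤ 0) (h : herm w v = 0) : w = 0 := by
  have hv0 : v ≠ 0 := by rintro rfl; simp [herm_zero_left] at hv
  obtain ⟨δ, rfl⟩ := proportional_of_orthogonal hv0 hv.le hwn h
  rw [herm_smul_left] at h
  have : herm v v ≠ 0 := by intro h0; simp [h0] at hv
  rcases mul_eq_zero.1 h with h | h
  · simp [h]
  · exact absurd h this

/-! ### Isometries as matrices -/

/-- The matrix of the form. -/
def J : Matrix (Fin 3) (Fin 3) ℂ := Matrix.diagonal ![1, 1, -1]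

theorem herm_eq_dotProduct (x y : V) : herm x y = star y ⬝ᵥ (J *ᵥ x) := by
  simp [herm, J, dotProduct, Fin.sum_univ_three, Matrix.mulVec_diagonal]
  ring

theorem det_J : J.det = -1 := by
  simp [J, Matrix.det_diagonal, Fin.prod_univ_three]

/-- The matrix preserves the form. -/
def IsIsom (A : Matrix (Fin 3) (Fin 3) ℂ) : Prop := ∀ x y : V, herm (A *ᵥ x) (A *ᵥ y) = herm x y

theorem isIsom_mat (F : SU21) : IsIsom (mat F) := F.2

theorem det_mat (F : SU21) : (mat F).det = 1 := F.1.2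

theorem isIsom_iff {A : Matrix (Fin 3) (Fin 3) ℂ} : IsIsom A ↔ Aᴴ * J * A = J := by
  have key : ∀ x y : V, herm (A *ᵥ x) (A *ᵥ y) = star y ⬝ᵥ ((Aᴴ * J * A) *ᵥ x) := by
    intro x y
    rw [herm_eq_dotProduct, Matrix.star_mulVec, ← Matrix.dotProduct_mulVec,
      Matrix.mulVec_mulVec, Matrix.mulVec_mulVec, Matrix.mul_assoc]
  constructor
  · intro h
    ext i j
    have := h (Pi.single j 1) (Pi.single i 1)
    rw [key, herm_eq_dotProduct] at this
    simpa using this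
  · intro h x y
    rw [key, h, herm_eq_dotProduct]

theorem IsIsom.norm_det {A : Matrix (Fin 3) (Fin 3) ℂ} (h : IsIsom A) : ‖A.det‖ = 1 := by
  have := congrArg Matrix.det (isIsom_iff.1 h)
  rw [Matrix.det_mul, Matrix.det_mul, Matrix.det_conjTranspose, det_J] at this
  have h2 : star A.det * A.det = 1 := by linear_combination -this
  have h3 := congrArg norm h2
  rw [norm_mul, norm_star, norm_one] at h3
  nlinarith [norm_nonneg A.det]

theorem mat_mul (F G : SU21) : mat (F * G) = mat F * mat G := rfl

theorem mat_one : mat 1 = 1 := rfl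

theorem mat_injective : Function.Injective mat := fun _ _ h => Subtype.ext (Subtype.ext h)

theorem mat_mul_inv (F : SU21) : mat F * mat F⁻¹ = 1 := by
  rw [← mat_mul, mul_inv_cancel, mat_one]

theorem mat_inv_mul (F : SU21) : mat F⁻¹ * mat F = 1 := by
  rw [← mat_mul, inv_mul_cancel, mat_one]

/-- An isometry with a suitable multiple in the special unitary group. -/
theorem IsIsom.exists_lift {A : Matrix (Fin 3) (Fin 3) ℂ} (h : IsIsom A) :
    ∃ (B : SU21) (k : ℂ), k ≠ 0 ∧ mat B = k • A := by
  have hd : A.det ≠ 0 := by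
    intro h0; have := h.norm_det; simp [h0] at this
  obtain ⟨k, hk⟩ := IsAlgClosed.exists_pow_nat_eq (A.det)⁻¹ (n := 3) (by norm_num)
  have hk0 : k ≠ 0 := by
    rintro rfl; exact inv_ne_zero hd (by rw [← hk]; simp)
  have hkn : ‖k‖ = 1 := by
    have := congrArg norm hk
    rw [norm_pow, norm_inv, h.norm_det, inv_one] at this
    exact (pow_eq_one_iff_of_nonneg (norm_nonneg k) (by norm_num)).1 this
  refine ⟨⟨⟨k • A, ?_⟩, ?_⟩, k, hk0, rfl⟩
  · rw [Matrix.det_smul, Fintype.card_fin, hk, inv_mul_cancel₀ hd]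
  · intro x y
    change herm ((k • A) *ᵥ x) ((k • A) *ᵥ y) = _
    rw [Matrix.smul_mulVec, Matrix.smul_mulVec, herm_smul_left, herm_smul_right, h,
      ← mul_assoc, Complex.star_def, Complex.mul_conj, Complex.normSq_eq_norm_sq, hkn]
    simp

/-- Modulo scalars, conjugacy becomes intertwining up to a factor. No condition on `δ` is required,
since determinants force `δ³ = 1`, and the form without inverses suits matrix computations. -/
theorem cls_eq_iff {F G : SU21} :
    cls F = cls G ↔ ∃ (B : SU21) (δ : ℂ), mat B * mat F = δ • (mat G * mat B) := by
  have h0 : cls F = cls G ↔ IsConj (QuotientGroup.mk F : PU21) (QuotientGroup.mk G) :=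
    ConjClasses.mk_eq_mk_iff_isConj
  rw [h0, isConj_iff]
  constructor
  · rintro ⟨b, hb⟩
    obtain ⟨B, rfl⟩ := QuotientGroup.mk_surjective b
    rw [← QuotientGroup.mk_mul, ← QuotientGroup.mk_inv, ← QuotientGroup.mk_mul, eq_comm,
      QuotientGroup.eq] at hb
    obtain ⟨δ, hδ⟩ := hb
    refine ⟨B, δ, ?_⟩
    have h1 : B * F = G * (G⁻¹ * (B * F * B⁻¹)) * B := by group
    rw [← mat_mul, h1, mat_mul, mat_mul, hδ]
    simp
  · rintro ⟨B, δ, h⟩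
    refine ⟨(B : PU21), ?_⟩
    rw [← QuotientGroup.mk_mul, ← QuotientGroup.mk_inv, ← QuotientGroup.mk_mul, eq_comm,
      QuotientGroup.eq]
    refine ⟨δ, ?_⟩
    rw [mat_mul, mat_mul, mat_mul, h, smul_mul_assoc, mul_smul_comm, Matrix.mul_assoc (mat G),
      mat_mul_inv, mul_one, mat_inv_mul]

/-- A cube root of the inverse determinant brings any isometry into `SU(2,1)`, and this factor
cancels in the intertwining relation. Isometries produced by Witt's theorem can therefore serve as
conjugators. -/
theorem cls_eq_of_intertwine {A : Matrix (Fin 3) (Fin 3) ℂ} (hA : IsIsom A) {F G : SU21} {δ : ℂ}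
    (h : A * mat F = δ • (mat G * A)) : cls F = cls G := by
  obtain ⟨B, k, -, hB⟩ := hA.exists_lift
  rw [cls_eq_iff]
  refine ⟨B, δ, ?_⟩
  rw [hB, smul_mul_assoc, h, mul_smul_comm, smul_comm]

theorem cls_eq_of_smul {F G : SU21} {δ : ℂ} (h : mat F = δ • mat G) : cls F = cls G := by
  rw [cls_eq_iff]
  exact ⟨1, δ, by rw [mat_one, h]; simp⟩

theorem cls_mul_comm (F G : SU21) : cls (F * G) = cls (G * F) := by
  rw [cls_eq_iff]
  exact ⟨G, 1, by simp only [mat_mul, one_smul, Matrix.mul_assoc]⟩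

/-- The matrix with the given columns. -/
def cols (p : Fin 3 → V) : Matrix (Fin 3) (Fin 3) ℂ := Matrix.of fun i j => p j i

theorem cols_mulVec_single (p : Fin 3 → V) (j : Fin 3) : cols p *ᵥ Pi.single j 1 = p j := by
  ext i; simp [cols]

theorem gram_eq (p : Fin 3 → V) : (cols p)ᴴ * J * cols p = Matrix.of fun i j => herm (p j) (p i) := by
  ext i j
  have h1 := cols_mulVec_single p
  rw [Matrix.of_apply, ← h1 j, ← h1 i, herm_eq_dotProduct, Matrix.star_mulVec,
    ← Matrix.dotProduct_mulVec, Matrix.mulVec_mulVec, Matrix.mulVec_mulVec]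
  simp [Matrix.mul_assoc]

/-- Witt: two frames with the same nondegenerate Gram matrix are related by an isometry. -/
theorem exists_isom_of_gram {p q : Fin 3 → V} (h : ∀ i j, herm (p i) (p j) = herm (q i) (q j))
    (hd : (Matrix.of fun i j => herm (p j) (p i)).det ≠ 0) :
    ∃ A, IsIsom A ∧ ∀ i, A *ᵥ p i = q i := by
  have hg : (cols p)ᴴ * J * cols p = (cols q)ᴴ * J * cols q := by
    rw [gram_eq, gram_eq]; ext i j; exact h j i
  have hdp : (cols p).det ≠ 0 := by
    intro h0; apply hd; rw [← gram_eq, Matrix.det_mul, h0, mul_zero]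
  have hu : IsUnit (cols p).det := isUnit_iff_ne_zero.2 hdp
  have h1 : cols p * (cols p)⁻¹ = 1 := Matrix.mul_nonsing_inv _ hu
  have h1' : (cols p)⁻¹ * cols p = 1 := Matrix.nonsing_inv_mul _ hu
  have h2 : ((cols p)⁻¹)ᴴ * (cols p)ᴴ = 1 := by
    rw [← Matrix.conjTranspose_mul, h1, Matrix.conjTranspose_one]
  refine ⟨cols q * (cols p)⁻¹, ?_, ?_⟩
  · rw [isIsom_iff, Matrix.conjTranspose_mul]
    calc _ = ((cols p)⁻¹)ᴴ * ((cols q)ᴴ * J * cols q) * (cols p)⁻¹ := by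
            simp only [Matrix.mul_assoc]
      _ = (((cols p)⁻¹)ᴴ * (cols p)ᴴ) * J * (cols p * (cols p)⁻¹) := by
            rw [← hg]; simp only [Matrix.mul_assoc]
      _ = J := by rw [h1, h2, one_mul, mul_one]
  · intro i
    rw [← cols_mulVec_single p i, Matrix.mulVec_mulVec, Matrix.mul_assoc, h1', mul_one,
      cols_mulVec_single]

/-- A frame with nondegenerate Gram matrix spans. -/
theorem eq_of_frame {p : Fin 3 → V} (hd : (Matrix.of fun i j => herm (p j) (p i)).det ≠ 0)
    {A B : Matrix (Fin 3) (Fin 3) ℂ} (h : ∀ i, A *ᵥ p i = B *ᵥ p i) : A = B := by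
  have hdp : (cols p).det ≠ 0 := by
    intro h0; apply hd; rw [← gram_eq, Matrix.det_mul, h0, mul_zero]
  have hu : IsUnit (cols p).det := isUnit_iff_ne_zero.2 hdp
  have h1 : cols p * (cols p)⁻¹ = 1 := Matrix.mul_nonsing_inv _ hu
  have h2 : A * cols p = B * cols p := by
    ext i j
    have := congrFun (h j) i
    rw [← cols_mulVec_single p j, Matrix.mulVec_mulVec, Matrix.mulVec_mulVec] at this
    simpa using this
  calc A = A * cols p * (cols p)⁻¹ := by rw [Matrix.mul_assoc, h1, mul_one]
    _ = B * cols p * (cols p)⁻¹ := by rw [h2]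
    _ = B := by rw [Matrix.mul_assoc, h1, mul_one]

theorem diagonal_mulVec_single_smul (d : V) (i : Fin 3) (r : ℂ) :
    Matrix.diagonal d *ᵥ Pi.single i r = d i • (Pi.single i r : V) := by
  ext j
  rw [Matrix.mulVec_diagonal, Pi.smul_apply, smul_eq_mul]
  by_cases h : j = i
  · subst h; rfl
  · simp [h]

/-- An isometry with an orthogonal frame of eigenvectors. -/
theorem cls_eq_angleElement {F : SU21} {v₁ v₂ v₃ : V} {μ₁ μ₂ μ₃ : ℂ}
    (h1 : 0 < (herm v₁ v₁).re) (h2 : 0 < (herm v₂ v₂).re) (h3 : (herm v₃ v₃).re < 0)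
    (h12 : herm v₁ v₂ = 0) (h13 : herm v₁ v₃ = 0) (h23 : herm v₂ v₃ = 0)
    (e1 : mat F *ᵥ v₁ = μ₁ • v₁) (e2 : mat F *ᵥ v₂ = μ₂ • v₂) (e3 : mat F *ᵥ v₃ = μ₃ • v₃)
    {θ : ℝ × ℝ} (hθ1 : μ₁ = μ₃ * Complex.exp (θ.1 * Complex.I))
    (hθ2 : μ₂ = μ₃ * Complex.exp (θ.2 * Complex.I)) : cls F = cls (angleElement θ) := by
  set r₁ : ℝ := Real.sqrt (herm v₁ v₁).re
  set r₂ : ℝ := Real.sqrt (herm v₂ v₂).re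
  set r₃ : ℝ := Real.sqrt (-(herm v₃ v₃).re)
  have hr1 : (r₁ : ℂ) ^ 2 = herm v₁ v₁ := by
    rw [herm_self_eq_re v₁]; exact_mod_cast Real.sq_sqrt h1.le
  have hr2 : (r₂ : ℂ) ^ 2 = herm v₂ v₂ := by
    rw [herm_self_eq_re v₂]; exact_mod_cast Real.sq_sqrt h2.le
  have hr3 : (r₃ : ℂ) ^ 2 = -herm v₃ v₃ := by
    rw [herm_self_eq_re v₃]; exact_mod_cast Real.sq_sqrt (neg_nonneg.2 h3.le)
  have n1 : herm v₁ v₁ ≠ 0 := by intro h; simp [h] at h1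
  have n2 : herm v₂ v₂ ≠ 0 := by intro h; simp [h] at h2
  have n3 : herm v₃ v₃ ≠ 0 := by intro h; simp [h] at h3
  have h21 := herm_eq_zero_comm.1 h12
  have h31 := herm_eq_zero_comm.1 h13
  have h32 := herm_eq_zero_comm.1 h23
  have hd : (Matrix.of fun i j => herm ((![v₁, v₂, v₃] : Fin 3 → V) j) ((![v₁, v₂, v₃] : Fin 3 → V) i)).det ≠ 0 := by
    rw [Matrix.det_fin_three]
    simp [h12, h13, h23, h21, h31, h32, n1, n2, n3]
  -- The lengths `r₁, r₂, r₃` make the Gram matrix of the rescaled standard basis equal to that of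
  -- the eigenvectors.
  obtain ⟨A, hA, hAp⟩ := exists_isom_of_gram (p := ![v₁, v₂, v₃])
    (q := ![Pi.single 0 (r₁ : ℂ), Pi.single 1 (r₂ : ℂ), Pi.single 2 (r₃ : ℂ)]) (by
      have s1 : herm (Pi.single 0 (r₁ : ℂ)) (Pi.single 0 (r₁ : ℂ)) = herm v₁ v₁ := by
        rw [← hr1]; simp [herm, sq]
      have s2 : herm (Pi.single 1 (r₂ : ℂ)) (Pi.single 1 (r₂ : ℂ)) = herm v₂ v₂ := by
        rw [← hr2]; simp [herm, sq]
      have s3 : herm (Pi.single 2 (r₃ : ℂ)) (Pi.single 2 (r₃ : ℂ)) = herm v₃ v₃ := by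
        rw [← neg_neg (herm v₃ v₃), ← hr3]; simp [herm, sq]
      intro i j
      fin_cases i <;> fin_cases j <;> simp [h12, h13, h23, h21, h31, h32, s1, s2, s3] <;>
        simp [herm]) hd
  have hA1 := hAp 0
  have hA2 := hAp 1
  have hA3 := hAp 2
  simp only [Matrix.cons_val_zero, Matrix.cons_val_one, Matrix.cons_val] at hA1 hA2 hA3
  -- The third diagonal entry of `angleElement θ` is `e^{-i(θ₁+θ₂)/3}`, so this is the scalar that
  -- turns it into `μ₃`; the other two entries then become `μ₁` and `μ₂`.
  set c : ℂ := μ₃ * Complex.exp (((θ.1 + θ.2) / 3 : ℝ) * Complex.I) with hc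
  have hm : A * mat F = c • (mat (angleElement θ) * A) := by
    apply eq_of_frame hd
    have c1 : c * angleEntries θ 0 = μ₁ := by
      rw [hc, hθ1, angleEntries, Matrix.cons_val_zero, mul_assoc, ← Complex.exp_add]
      congr 2; push_cast; ring
    have c2 : c * angleEntries θ 1 = μ₂ := by
      rw [hc, hθ2, angleEntries, Matrix.cons_val_one, Matrix.cons_val_zero, mul_assoc,
        ← Complex.exp_add]
      congr 2; push_cast; ring
    have c3 : c * angleEntries θ 2 = μ₃ := by
      simp only [hc, angleEntries, Matrix.cons_val, mul_assoc, ← Complex.exp_add]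
      rw [show ((((θ.1 + θ.2) / 3 : ℝ) : ℂ) * Complex.I + ((-(θ.1 + θ.2) / 3 : ℝ) : ℂ) * Complex.I) = 0 by push_cast; ring]
      simp
    have hdiag : mat (angleElement θ) = Matrix.diagonal (angleEntries θ) := rfl
    intro i
    rw [Matrix.smul_mulVec, ← Matrix.mulVec_mulVec, ← Matrix.mulVec_mulVec, hdiag]
    fin_cases i
    · change A *ᵥ (mat F *ᵥ v₁) = c • (_ *ᵥ (A *ᵥ v₁))
      rw [e1, Matrix.mulVec_smul, hA1]
      rw [diagonal_mulVec_single_smul, smul_smul, c1]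
    · change A *ᵥ (mat F *ᵥ v₂) = c • (_ *ᵥ (A *ᵥ v₂))
      rw [e2, Matrix.mulVec_smul, hA2]
      rw [diagonal_mulVec_single_smul, smul_smul, c2]
    · change A *ᵥ (mat F *ᵥ v₃) = c • (_ *ᵥ (A *ᵥ v₃))
      rw [e3, Matrix.mulVec_smul, hA3]
      rw [diagonal_mulVec_single_smul, smul_smul, c3]
  exact cls_eq_of_intertwine hA hm

/-! ### The continuous invariant separating angle pairs -/

theorem eigen_ne_zero {F : SU21} {v : V} {μ : ℂ} (hv : v ≠ 0) (h : mat F *ᵥ v = μ • v) :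
    μ ≠ 0 := by
  rintro rfl
  rw [zero_smul] at h
  have : mat F⁻¹ *ᵥ (mat F *ᵥ v) = v := by
    rw [Matrix.mulVec_mulVec, mat_inv_mul, Matrix.one_mulVec]
  rw [h, Matrix.mulVec_zero] at this
  exact hv this.symm

/-- Invariance of the form reads `⟨v,w⟩ = μν̄⟨v,w⟩`. Unit norm of eigenvalues and orthogonality of
eigenvectors both come from this. -/
theorem eigen_herm {F : SU21} {v w : V} {μ ν : ℂ} (h : mat F *ᵥ v = μ • v)
    (h' : mat F *ᵥ w = ν • w) : (1 - μ * star ν) * herm v w = 0 := by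
  have := isIsom_mat F v w
  rw [h, h', herm_smul_left, herm_smul_right] at this
  linear_combination -this

theorem norm_eq_one_of_mul_star {μ : ℂ} (h : μ * star μ = 1) : ‖μ‖ = 1 := by
  rw [Complex.star_def, Complex.mul_conj, Complex.normSq_eq_norm_sq] at h
  have : ‖μ‖ ^ 2 = 1 := by exact_mod_cast h
  nlinarith [norm_nonneg μ]

theorem mul_star_of_norm {μ : ℂ} (h : ‖μ‖ = 1) : μ * star μ = 1 := by
  rw [Complex.star_def, Complex.mul_conj, Complex.normSq_eq_norm_sq, h]; simp

theorem eigen_norm {F : SU21} {v : V} {μ : ℂ} (h : mat F *ᵥ v = μ • v) (hv : herm v v ≠ 0) :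
    ‖μ‖ = 1 := by
  have := (mul_eq_zero.1 (eigen_herm h h)).resolve_right hv
  exact norm_eq_one_of_mul_star (by linear_combination -this)

/-- Eigenvectors whose eigenvalues are distinct unit numbers are orthogonal. -/
theorem eigen_orthogonal {F : SU21} {v w : V} {μ ν : ℂ} (h : mat F *ᵥ v = μ • v)
    (h' : mat F *ᵥ w = ν • w) (hν : ‖ν‖ = 1) (hne : μ ≠ ν) : herm v w = 0 := by
  refine (mul_eq_zero.1 (eigen_herm h h')).resolve_left fun h0 => hne ?_
  have := mul_star_of_norm hν
  linear_combination (-ν) * h0 - μ * this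

/-- `λ / |λ|` is the same for all eigenvalues with a nonpositive eigenvector. -/
theorem direction_unique {F : SU21} {v w : V} {μ ν : ℂ} (hv : v ≠ 0) (hw : w ≠ 0)
    (hvn : (herm v v).re ≤ 0) (hwn : (herm w w).re ≤ 0) (h : mat F *ᵥ v = μ • v)
    (h' : mat F *ᵥ w = ν • w) : μ / ‖μ‖ = ν / ‖ν‖ := by
  by_cases h0 : herm w v = 0
  · obtain ⟨δ, rfl⟩ := proportional_of_orthogonal hv hvn hwn h0
    have hδ : δ ≠ 0 := by rintro rfl; simp at hw
    rw [Matrix.mulVec_smul, h, smul_comm] at h'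
    have := smul_left_injective ℂ hw h'
    rw [this]
  -- Nonorthogonal eigenvectors satisfy `νμ̄ = 1`, so `ν = μ/|μ|²` points in the direction of `μ`;
  -- this covers the two isotropic fixed points of a loxodromic isometry.
  · have h1 := (mul_eq_zero.1 (eigen_herm h' h)).resolve_right h0
    have hμ := eigen_ne_zero hv h
    have hn : ‖ν‖ * ‖μ‖ = 1 := by
      rw [← norm_star μ, ← norm_mul, show ν * star μ = 1 by linear_combination -h1, norm_one]
    have hn' : (‖ν‖ : ℂ) * ‖μ‖ = 1 := by exact_mod_cast hn
    have hμn : (‖μ‖ : ℂ) ≠ 0 := by simpa using hμ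
    have hνn : (‖ν‖ : ℂ) ≠ 0 := left_ne_zero_of_mul_eq_one hn'
    have h2 : μ * star μ = (‖μ‖ : ℂ) ^ 2 := by
      rw [Complex.star_def, Complex.mul_conj, Complex.normSq_eq_norm_sq]; norm_cast
    rw [div_eq_div_iff hμn hνn]
    have h3 : ν * (μ * star μ) = μ := by linear_combination (-μ) * h1
    rw [h2] at h3
    linear_combination (-(‖ν‖ : ℂ)) * h3 + (ν * ‖μ‖) * hn'

/-! ### Existence of a fixed point in the closed ball -/

theorem exists_eigenvector_of_invariant {F : SU21} (W : Submodule ℂ V) (hW : W ≠ ⊥)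
    (h : ∀ x ∈ W, mat F *ᵥ x ∈ W) : ∃ x ∈ W, x ≠ 0 ∧ ∃ μ : ℂ, mat F *ᵥ x = μ • x := by
  let f : W →ₗ[ℂ] W := (Matrix.toLin' (mat F)).restrict (by simpa using h)
  have : Nontrivial W := Submodule.nontrivial_iff_ne_bot.2 hW
  obtain ⟨μ, hμ⟩ := Module.End.exists_eigenvalue f
  obtain ⟨x, hx⟩ := hμ.exists_hasEigenvector
  refine ⟨x, x.2, by simpa using hx.2, μ, ?_⟩
  have := congrArg Subtype.val hx.apply_eq_smul
  simpa [f, LinearMap.restrict_apply] using this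

/-- The orthogonal complement. -/
def perp (v : V) : Submodule ℂ V where
  carrier := {x | herm x v = 0}
  zero_mem' := herm_zero_left v
  add_mem' := by
    intro a b ha hb
    change herm (a + b) v = 0
    rw [herm_add_left, show herm a v = 0 from ha, show herm b v = 0 from hb, add_zero]
  smul_mem' := by
    intro c x hx
    change herm (c • x) v = 0
    rw [herm_smul_left, show herm x v = 0 from hx, mul_zero]

theorem mem_perp {v x : V} : x ∈ perp v ↔ herm x v = 0 := Iff.rfl

theorem perp_invariant {F : SU21} {v : V} {μ : ℂ} (hv : v ≠ 0) (h : mat F *ᵥ v = μ • v) {x : V}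
    (hx : x ∈ perp v) : mat F *ᵥ x ∈ perp v := by
  rw [mem_perp] at *
  have h1 := isIsom_mat F x v
  rw [h, hx, herm_smul_right] at h1
  have : star μ ≠ 0 := star_ne_zero.2 (eigen_ne_zero hv h)
  exact (mul_eq_zero.1 h1).resolve_left this

/-- The vector product adapted to the form. -/
def cross (p q : V) : V :=
  ![star (p 1 * q 2 - p 2 * q 1), star (p 2 * q 0 - p 0 * q 2), -star (p 0 * q 1 - p 1 * q 0)]

theorem herm_cross_left (p q : V) : herm p (cross p q) = 0 := by
  simp [herm, cross]; ring

theorem herm_cross_right (p q : V) : herm q (cross p q) = 0 := by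
  simp [herm, cross]; ring

/-- The form has determinant `-1`, whence the minus sign: the orthogonal complement of a definite
line is negative, and that of a hyperbolic line is positive. -/
theorem herm_cross_cross (p q : V) :
    herm (cross p q) (cross p q) = -(herm p p * herm q q - herm p q * herm q p) := by
  simp [herm, cross]; ring

/-- If all eigenvectors were positive, passing repeatedly to invariant orthogonal complements would
give three orthogonal positive ones. They would span the space and leave no room for a negative
vector. This takes the place of Brouwer's theorem on the closed ball. -/
theorem exists_nonpos_eigenvector (F : SU21) :
    ∃ (v : V) (μ : ℂ), v ≠ 0 ∧ (herm v v).re ≤ 0 ∧ mat F *ᵥ v = μ • v := by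
  by_contra! hcon
  obtain ⟨v, -, hv, μ, hμ⟩ := exists_eigenvector_of_invariant (F := F) ⊤ (by simp) (by simp)
  have hv1 : 0 < (herm v v).re := lt_of_not_ge fun h => hcon v μ hv h hμ
  have hvv : herm v v ≠ 0 := by intro h; simp [h] at hv1
  -- With trivial complement every vector would be a multiple of the positive `v`, including the
  -- negative last basis vector.
  have hne : perp v ≠ ⊥ := by
    intro hb
    have h1 : ∀ x, x - (herm x v / herm v v) • v ∈ perp v := by
      intro x; rw [mem_perp, herm_sub_left, herm_smul_left, div_mul_cancel₀ _ hvv, sub_self]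
    rw [hb] at h1
    have e2 := h1 (Pi.single 2 1)
    rw [Submodule.mem_bot, sub_eq_zero] at e2
    have : (herm (Pi.single 2 1) (Pi.single 2 (1 : ℂ))).re < 0 := by simp [herm]
    rw [e2, herm_smul_left, herm_smul_right, ← mul_assoc, Complex.star_def, Complex.mul_conj,
      Complex.re_ofReal_mul] at this
    nlinarith [Complex.normSq_nonneg (herm (Pi.single 2 1) v / herm v v)]
  obtain ⟨w, hwv, hw, ν, hν⟩ := exists_eigenvector_of_invariant (F := F) (perp v) hne
    fun x hx => perp_invariant hv hμ hx
  have hw1 : 0 < (herm w w).re := lt_of_not_ge fun h => hcon w ν hw h hν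
  rw [mem_perp] at hwv
  have hvw := herm_eq_zero_comm.1 hwv
  set u := cross v w
  have hu : (herm u u).re < 0 := by
    rw [herm_cross_cross, hwv, herm_self_eq_re v, herm_self_eq_re w]
    simp only [mul_zero, sub_zero, Complex.neg_re, Complex.re_ofReal_mul, Complex.ofReal_re]
    nlinarith [mul_pos hv1 hw1]
  have hu0 : u ≠ 0 := by intro h; simp [h, herm_zero_left] at hu
  obtain ⟨x, hx, hx0, κ, hκ⟩ := exists_eigenvector_of_invariant (F := F) (perp v ⊓ perp w)
    (by
      intro hb
      have : u ∈ perp v ⊓ perp w :=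
        ⟨herm_eq_zero_comm.1 (herm_cross_left v w), herm_eq_zero_comm.1 (herm_cross_right v w)⟩
      rw [hb] at this
      exact hu0 ((Submodule.mem_bot ℂ).1 this))
    fun x hx => ⟨perp_invariant hv hμ hx.1, perp_invariant hw hν hx.2⟩
  have hx1 : 0 < (herm x x).re := lt_of_not_ge fun h => hcon x κ hx0 h hκ
  have hxv : herm x v = 0 := hx.1
  have hxw : herm x w = 0 := hx.2
  have hww : herm w w ≠ 0 := by intro h; simp [h] at hw1
  have hxx : herm x x ≠ 0 := by intro h; simp [h] at hx1
  have hvx := herm_eq_zero_comm.1 hxv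
  have hwx := herm_eq_zero_comm.1 hxw
  -- a negative vector decomposes into three positive orthogonal ones
  set y : V := u - (herm u x / herm x x) • x with hy
  have hyv : herm y v = 0 := by
    rw [hy, herm_sub_left, herm_smul_left, hxv,
      herm_eq_zero_comm.1 (herm_cross_left v w)]; ring
  have hyw : herm y w = 0 := by
    rw [hy, herm_sub_left, herm_smul_left, hxw,
      herm_eq_zero_comm.1 (herm_cross_right v w)]; ring
  have hyx : herm y x = 0 := by
    rw [hy, herm_sub_left, herm_smul_left, div_mul_cancel₀ _ hxx, sub_self]
  have hxy := herm_eq_zero_comm.1 hyx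
  have hyy : (herm y y).re ≤ 0 := by
    have h1 : herm u u = herm y y +
        (herm u x / herm x x) * star (herm u x / herm x x) * herm x x := by
      have : u = y + (herm u x / herm x x) • x := by rw [hy]; abel
      conv_lhs => rw [this]
      simp only [herm_add_left, herm_add_right, herm_smul_left, herm_smul_right, hxy, hyx]
      ring
    rw [h1, Complex.star_def, Complex.mul_conj, Complex.add_re, Complex.re_ofReal_mul] at hu
    nlinarith [mul_nonneg (Complex.normSq_nonneg (herm u x / herm x x)) hx1.le]
  have hy0 : y = 0 := by
    have hd : (Matrix.of fun i j => herm ((![v, w, x] : Fin 3 → V) j)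
        ((![v, w, x] : Fin 3 → V) i)).det ≠ 0 := by
      rw [Matrix.det_fin_three]
      simp [hvw, hwv, hxv, hxw, hvx, hwx, hvv, hww, hxx]
    by_contra hy0
    -- The functional `⟨·,y⟩`, placed in the last row of a matrix, vanishes on the frame `v, w, x`;
    -- hence it is zero, and `y = 0` as the form is nondegenerate.
    have : (Matrix.of ![0, 0, (fun i => star (y i) * J i i)] : Matrix (Fin 3) (Fin 3) ℂ) = 0 := by
      apply eq_of_frame hd
      have key : ∀ z, herm z y = 0 →
          (Matrix.of ![0, 0, (fun i => star (y i) * J i i)] : Matrix (Fin 3) (Fin 3) ℂ) *ᵥ z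
            = (0 : Matrix (Fin 3) (Fin 3) ℂ) *ᵥ z := by
        intro z hz
        have : (Matrix.of ![0, 0, (fun i => star (y i) * J i i)] :
          Matrix (Fin 3) (Fin 3) ℂ) *ᵥ z = ![0, 0, herm z y] := by
          ext i
          fin_cases i <;> simp [Matrix.mulVec, dotProduct, Fin.sum_univ_three, herm, J]
          ring
        rw [this, hz]; ext i; fin_cases i <;> simp
      intro i
      fin_cases i
      · exact key v (herm_eq_zero_comm.1 hyv)
      · exact key w (herm_eq_zero_comm.1 hyw)
      · exact key x hxy
    apply hy0
    funext i
    have := congrFun (congrFun this 2) i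
    fin_cases i <;> simpa [J] using this
  rw [hy, sub_eq_zero] at hy0
  rw [hy0, herm_smul_left, herm_smul_right, ← mul_assoc, Complex.star_def, Complex.mul_conj,
      Complex.re_ofReal_mul] at hu
  nlinarith [Complex.normSq_nonneg (herm u x / herm x x)]

/-- The closed unit ball of `ℂ²`, which parametrizes the nonpositive points. -/
abbrev Chart : Type := {v : V // v 2 = 1 ∧ ‖v 0‖ ≤ 1 ∧ ‖v 1‖ ≤ 1 ∧ (herm v v).re ≤ 0}

theorem continuous_herm : Continuous fun v : V => herm v v := by
  unfold herm; fun_prop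

instance : CompactSpace Chart := by
  apply isCompact_iff_compactSpace.1
  apply Metric.isCompact_of_isClosed_isBounded
  · have h0 : IsClosed {v : V | v 2 = 1} := isClosed_eq (by fun_prop) continuous_const
    have h1 : IsClosed {v : V | ‖v 0‖ ≤ 1} := isClosed_le (by fun_prop) continuous_const
    have h2 : IsClosed {v : V | ‖v 1‖ ≤ 1} := isClosed_le (by fun_prop) continuous_const
    have h3 : IsClosed {v : V | (herm v v).re ≤ 0} :=
      isClosed_le (Complex.continuous_re.comp continuous_herm) continuous_const
    exact h0.inter (h1.inter (h2.inter h3))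
  · apply (Metric.isBounded_closedBall (x := (0 : V)) (r := 1)).subset
    rintro v ⟨h0, h1, h2, -⟩
    rw [mem_closedBall_zero_iff, pi_norm_le_iff_of_nonneg zero_le_one]
    intro i
    fin_cases i
    · exact h1
    · exact h2
    · change ‖v 2‖ ≤ 1
      rw [h0, norm_one]

/-- For a vector with last coordinate `1` the eigenvalue is the last coordinate of its image.
Written this way, being fixed is a closed condition on the pair of isometry and point. -/
theorem exists_chart_eigenvector (F : SU21) :
    ∃ v : Chart, mat F *ᵥ v.1 = (mat F *ᵥ v.1) 2 • v.1 := by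
  obtain ⟨v, μ, hv, hvn, h⟩ := exists_nonpos_eigenvector F
  have h2 := last_ne_zero hv hvn
  set w : V := (v 2)⁻¹ • v with hw
  have hw2 : w 2 = 1 := by simp [hw, h2]
  have hwn : (herm w w).re ≤ 0 := by
    rw [hw, herm_smul_left, herm_smul_right, ← mul_assoc, Complex.star_def, Complex.mul_conj,
      Complex.re_ofReal_mul]
    nlinarith [Complex.normSq_nonneg (v 2)⁻¹]
  have hwμ : mat F *ᵥ w = μ • w := by rw [hw, Matrix.mulVec_smul, h, smul_comm]
  have hb : ‖w 0‖ ^ 2 + ‖w 1‖ ^ 2 ≤ 1 := by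
    have := hwn
    rw [herm_self_re, hw2, norm_one] at this; linarith
  refine ⟨⟨w, hw2, ?_, ?_, hwn⟩, ?_⟩
  · nlinarith [norm_nonneg (w 0), sq_nonneg ‖w 1‖]
  · nlinarith [norm_nonneg (w 1), sq_nonneg ‖w 0‖]
  · change mat F *ᵥ w = (mat F *ᵥ w) 2 • w
    rw [hwμ]; simp [hw2]

theorem Chart.ne_zero (v : Chart) : v.1 ≠ 0 := by
  intro h; have := v.2.1; simp [h] at this

/-- The direction `λ / |λ|` of an eigenvalue `λ` with a nonpositive eigenvector. -/
def dir (F : SU21) : ℂ :=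
  (mat F *ᵥ (exists_chart_eigenvector F).choose.1) 2 /
    ‖(mat F *ᵥ (exists_chart_eigenvector F).choose.1) 2‖

theorem dir_eq {F : SU21} {v : V} {μ : ℂ} (hv : v ≠ 0) (hvn : (herm v v).re ≤ 0)
    (h : mat F *ᵥ v = μ • v) : dir F = μ / ‖μ‖ :=
  direction_unique (exists_chart_eigenvector F).choose.ne_zero hv
    (exists_chart_eigenvector F).choose.2.2.2.2 hvn (exists_chart_eigenvector F).choose_spec h

theorem dir_ne_zero (F : SU21) : dir F ≠ 0 := by
  obtain ⟨v, hv⟩ := exists_chart_eigenvector F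
  rw [dir_eq v.ne_zero v.2.2.2.2 hv]
  have := eigen_ne_zero v.ne_zero hv
  simpa using this

/-! ### Continuity and descent of the invariant -/

theorem continuous_mat : Continuous mat :=
  continuous_subtype_val.comp continuous_subtype_val

/-- The pairs consisting of an isometry and a fixed point in the closed ball form a closed set.
Compactness of the ball makes its projection to the group a closed surjection, hence a quotient map.
Upstairs the direction is an explicit continuous function, and `direction_unique` says that it is
constant on fibres. -/
theorem continuous_dir : Continuous dir := by
  have hmv : Continuous fun x : SU21 × Chart => mat x.1 *ᵥ x.2.1 :=
    (continuous_mat.comp continuous_fst).matrix_mulVec (continuous_subtype_val.comp continuous_snd)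
  have hmv2 : Continuous fun x : SU21 × Chart => (mat x.1 *ᵥ x.2.1) 2 :=
    (continuous_apply 2).comp hmv
  set S : Set (SU21 × Chart) := {x | mat x.1 *ᵥ x.2.1 = (mat x.1 *ᵥ x.2.1) 2 • x.2.1}
  have hS : IsClosed S :=
    isClosed_eq hmv (hmv2.smul (continuous_subtype_val.comp continuous_snd))
  have hcl : IsClosedMap fun x : S => x.1.1 :=
    isClosedMap_fst_of_compactSpace.comp hS.isClosedEmbedding_subtypeVal.isClosedMap
  have hq : Topology.IsQuotientMap fun x : S => x.1.1 := by
    refine hcl.isQuotientMap (continuous_fst.comp continuous_subtype_val) ?_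
    intro F
    obtain ⟨v, hv⟩ := exists_chart_eigenvector F
    exact ⟨⟨(F, v), hv⟩, rfl⟩
  rw [hq.continuous_iff]
  have : dir ∘ (fun x : S => x.1.1) = fun x : S =>
      (mat x.1.1 *ᵥ x.1.2.1) 2 / (‖(mat x.1.1 *ᵥ x.1.2.1) 2‖ : ℂ) := by
    funext x
    exact dir_eq x.1.2.ne_zero x.1.2.2.2.2.2 x.2
  rw [this]
  have h2 : Continuous fun x : S => (mat x.1.1 *ᵥ x.1.2.1) 2 := hmv2.comp continuous_subtype_val
  refine h2.div (Complex.continuous_ofReal.comp h2.norm) ?_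
  intro x
  have := eigen_ne_zero x.1.2.ne_zero x.2
  simpa using this

/-- The invariant of an isometry. -/
def inv (F : SU21) : ℂ × ℂ := (dir F ^ 3, (mat F).trace / dir F)

theorem continuous_inv : Continuous inv :=
  (continuous_dir.pow 3).prodMk (continuous_mat.matrix_trace.div continuous_dir dir_ne_zero)

/-- Conjugation up to a scalar `δ` multiplies both the trace and the direction by `δ`, where `δ³ =
1`. The cube of the direction and the quotient of the trace by it do not notice `δ`. -/
theorem inv_eq_of_cls_eq {F G : SU21} (h : cls F = cls G) : inv F = inv G := by
  obtain ⟨B, δ, h⟩ := cls_eq_iff.1 h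
  have hδ3 : δ ^ 3 = 1 := by
    have := congrArg Matrix.det h
    rw [Matrix.det_smul, Matrix.det_mul, Matrix.det_mul, det_mat, det_mat, det_mat] at this
    simpa using this.symm
  have hδ0 : δ ≠ 0 := by rintro rfl; simp at hδ3
  have hδn : ‖δ‖ = 1 := by
    have := congrArg norm hδ3
    rw [norm_pow, norm_one] at this
    exact (pow_eq_one_iff_of_nonneg (norm_nonneg δ) (by norm_num)).1 this
  have htr : (mat F).trace = δ * (mat G).trace := by
    have h1 : mat F = δ • (mat B⁻¹ * (mat G * mat B)) := by
      rw [← mul_smul_comm, ← h, ← Matrix.mul_assoc, mat_inv_mul, one_mul]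
    rw [h1, Matrix.trace_smul, Matrix.trace_mul_comm, Matrix.mul_assoc, mat_mul_inv, mul_one,
      smul_eq_mul]
  have hdir : dir F = δ * dir G := by
    obtain ⟨v, μ, hv, hvn, hμ⟩ := exists_nonpos_eigenvector F
    have hB : mat B *ᵥ v ≠ 0 := by
      intro h0
      have : mat B⁻¹ *ᵥ (mat B *ᵥ v) = v := by
        rw [Matrix.mulVec_mulVec, mat_inv_mul, Matrix.one_mulVec]
      rw [h0, Matrix.mulVec_zero] at this
      exact hv this.symm
    have hG : mat G *ᵥ (mat B *ᵥ v) = (δ⁻¹ * μ) • (mat B *ᵥ v) := by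
      have h1 : mat G * mat B = δ⁻¹ • (mat B * mat F) := by
        rw [h, smul_smul, inv_mul_cancel₀ hδ0, one_smul]
      rw [Matrix.mulVec_mulVec, h1, Matrix.smul_mulVec, ← Matrix.mulVec_mulVec, hμ,
        Matrix.mulVec_smul, smul_smul]
    rw [dir_eq hv hvn hμ, dir_eq hB (by rw [isIsom_mat B]; exact hvn) hG, norm_mul, norm_inv, hδn]
    field_simp
  ext
  · simp only [inv, hdir]; rw [mul_pow, hδ3, one_mul]
  · simp only [inv, hdir, htr]; rw [mul_div_mul_left _ _ hδ0]

theorem cls_surjective : Function.Surjective cls := by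
  intro c
  obtain ⟨g, rfl⟩ := ConjClasses.mk_surjective c
  obtain ⟨F, rfl⟩ := QuotientGroup.mk_surjective g
  exact ⟨F, rfl⟩

/-- The invariant of a class. -/
def clsInv (c : ClassSpace) : ℂ × ℂ := inv (cls_surjective c).choose

theorem clsInv_cls (F : SU21) : clsInv (cls F) = inv F :=
  inv_eq_of_cls_eq (cls_surjective (cls F)).choose_spec

theorem continuous_toClass : Continuous toClass := continuous_coinduced_rng

theorem continuous_cls : Continuous cls := continuous_toClass.comp QuotientGroup.continuous_mk

theorem continuous_rho : Continuous rho := T2Quotient.continuous_mk _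

theorem continuous_rho_cls : Continuous fun F => rho (cls F) := continuous_rho.comp continuous_cls

theorem continuous_clsInv : Continuous clsInv := by
  have h1 : Topology.IsQuotientMap toClass :=
    ⟨⟨rfl⟩, ConjClasses.mk_surjective⟩
  have h2 : Topology.IsQuotientMap (QuotientGroup.mk : SU21 → PU21) :=
    QuotientGroup.isQuotientMap_mk _
  rw [(h1.comp h2).continuous_iff]
  have : clsInv ∘ (toClass ∘ (QuotientGroup.mk : SU21 → PU21)) = inv := funext clsInv_cls
  rw [this]
  exact continuous_inv

/-- The target `ℂ × ℂ` is Hausdorff, so the invariant factors through the maximal Hausdorff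
quotient. Every proof below that two points of the quotient differ rests on this. -/
theorem inv_eq_of_rho_eq {F G : SU21} (h : rho (cls F) = rho (cls G)) : inv F = inv G := by
  rw [← clsInv_cls, ← clsInv_cls, ← T2Quotient.lift_mk continuous_clsInv (cls F),
    ← T2Quotient.lift_mk continuous_clsInv (cls G)]
  exact congrArg _ h

/-! ### Angle pairs -/

theorem mat_angleElement (θ : ℝ × ℝ) :
    mat (angleElement θ) = Matrix.diagonal (angleEntries θ) := rfl

theorem angleElement_mulVec_single (θ : ℝ × ℝ) (i : Fin 3) (r : ℂ) :
    mat (angleElement θ) *ᵥ Pi.single i r = angleEntries θ i • (Pi.single i r : V) :=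
  diagonal_mulVec_single_smul _ _ _

theorem angleEntries_two (θ : ℝ × ℝ) :
    angleEntries θ 2 = Complex.exp ((-(θ.1 + θ.2) / 3 : ℝ) * Complex.I) := rfl

theorem angleEntries_zero (θ : ℝ × ℝ) :
    angleEntries θ 0 = angleEntries θ 2 * Complex.exp (θ.1 * Complex.I) := by
  rw [angleEntries_two, ← Complex.exp_add, angleEntries, Matrix.cons_val_zero]
  congr 1; push_cast; ring

theorem angleEntries_one (θ : ℝ × ℝ) :
    angleEntries θ 1 = angleEntries θ 2 * Complex.exp (θ.2 * Complex.I) := by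
  rw [angleEntries_two, ← Complex.exp_add, angleEntries, Matrix.cons_val_one,
    Matrix.cons_val_zero]
  congr 1; push_cast; ring

theorem dir_angleElement (θ : ℝ × ℝ) : dir (angleElement θ) = angleEntries θ 2 := by
  rw [dir_eq (v := Pi.single 2 1) (by simp) (by simp [herm]) (angleElement_mulVec_single θ 2 1),
    angleEntries_two, Complex.norm_exp_ofReal_mul_I]
  simp

/-- The invariant contains the sum and the product of `e^{iθ₁}` and `e^{iθ₂}`, so it determines them
up to order. -/
theorem inv_angleElement (θ : ℝ × ℝ) : inv (angleElement θ) =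
    ((Complex.exp (θ.1 * Complex.I) * Complex.exp (θ.2 * Complex.I))⁻¹,
      Complex.exp (θ.1 * Complex.I) + Complex.exp (θ.2 * Complex.I) + 1) := by
  have h0 : angleEntries θ 2 ≠ 0 := Complex.exp_ne_zero _
  ext
  · simp only [inv, dir_angleElement, angleEntries_two]
    rw [← Complex.exp_nat_mul, ← Complex.exp_add, ← Complex.exp_neg]
    congr 1; push_cast; ring
  · simp only [inv, dir_angleElement, mat_angleElement, Matrix.trace_diagonal,
      Fin.sum_univ_three]
    rw [angleEntries_zero, angleEntries_one]
    field_simp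

/-- Angle pairs that give the same point agree modulo `2π` and up to order. -/
theorem exp_eq_of_point_eq {θ θ' : ℝ × ℝ} (h : point θ = point θ') :
    (Complex.exp (θ.1 * Complex.I) = Complex.exp (θ'.1 * Complex.I) ∧
      Complex.exp (θ.2 * Complex.I) = Complex.exp (θ'.2 * Complex.I)) ∨
    (Complex.exp (θ.1 * Complex.I) = Complex.exp (θ'.2 * Complex.I) ∧
      Complex.exp (θ.2 * Complex.I) = Complex.exp (θ'.1 * Complex.I)) := by
  have := inv_eq_of_rho_eq h
  rw [inv_angleElement, inv_angleElement, Prod.mk.injEq] at this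
  obtain ⟨h1, h2⟩ := this
  have h1 := inv_injective h1
  -- Equal sums and products mean that both pairs are the roots of one quadratic polynomial; this is
  -- its value at `e^{iθ₁}`.
  have h3 : (Complex.exp (θ.1 * Complex.I) - Complex.exp (θ'.1 * Complex.I)) *
      (Complex.exp (θ.1 * Complex.I) - Complex.exp (θ'.2 * Complex.I)) = 0 := by
    linear_combination Complex.exp (θ.1 * Complex.I) * h2 - h1
  rcases mul_eq_zero.1 h3 with h | h
  · left; exact ⟨sub_eq_zero.1 h, by linear_combination h2 - h⟩
  · right; exact ⟨sub_eq_zero.1 h, by linear_combination h2 - h⟩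

theorem eq_of_exp_eq {a b : ℝ} (h : Complex.exp (a * Complex.I) = Complex.exp (b * Complex.I))
    (h1 : a - b < 2 * Real.pi) (h2 : -(2 * Real.pi) < a - b) : a = b := by
  obtain ⟨n, hn⟩ := Complex.exp_eq_exp_iff_exists_int.1 h
  have h3 : a = b + n * (2 * Real.pi) := by
    have : ((a : ℂ) - (b + n * (2 * Real.pi))) * Complex.I = 0 := by linear_combination hn
    have := (mul_eq_zero.1 this).resolve_right Complex.I_ne_zero
    exact_mod_cast sub_eq_zero.1 this
  have hpi := Real.pi_pos
  have hn1 : (n : ℝ) < 1 := by nlinarith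
  have hn2 : (-1 : ℝ) < n := by nlinarith
  have : n = 0 := by
    have a1 : n < 1 := by exact_mod_cast hn1
    have a2 : -1 < n := by exact_mod_cast hn2
    omega
  rw [h3, this]; simp

/-- Points of the triangle off the glued sides are determined by their image. -/
theorem eq_of_point_eq {θ θ' : ℝ × ℝ} (hθ : θ ∈ triangle) (hθ' : θ' ∈ triangle)
    (h0 : 0 < θ'.2) (h1 : θ'.1 < 2 * Real.pi) (h : point θ = point θ') : θ = θ' := by
  obtain ⟨a0, a1, a2⟩ := hθ
  obtain ⟨b0, b1, b2⟩ := hθ'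
  rcases exp_eq_of_point_eq h with ⟨e1, e2⟩ | ⟨e1, e2⟩
  · ext
    · exact eq_of_exp_eq e1 (by linarith) (by linarith)
    · exact eq_of_exp_eq e2 (by linarith) (by linarith)
  -- In the crossed case `θ₁ = θ'₂ ≤ θ'₁ = θ₂ ≤ θ₁`, so all four angles coincide.
  · have c1 := eq_of_exp_eq e1 (by linarith) (by linarith)
    have c2 := eq_of_exp_eq e2 (by linarith) (by linarith)
    ext <;> linarith

/-! ### Unit complex numbers -/

/-- The unit complex number of argument `t`. -/
def cis (t : ℝ) : ℂ := Complex.exp (t * Complex.I)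

theorem cis_zero : cis 0 = 1 := by simp [cis]

theorem cis_add (s t : ℝ) : cis (s + t) = cis s * cis t := by
  rw [cis, cis, cis, ← Complex.exp_add]; congr 1; push_cast; ring

theorem cis_ne_zero (t : ℝ) : cis t ≠ 0 := Complex.exp_ne_zero _

theorem cis_neg (t : ℝ) : cis (-t) = (cis t)⁻¹ := by
  rw [cis, cis, ← Complex.exp_neg]; congr 1; push_cast; ring

theorem cis_sub (s t : ℝ) : cis (s - t) = cis s / cis t := by
  rw [sub_eq_add_neg, cis_add, cis_neg, div_eq_mul_inv]

theorem cis_nat_mul (n : ℕ) (t : ℝ) : cis (n * t) = cis t ^ n := by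
  rw [cis, cis, ← Complex.exp_nat_mul]; congr 1; push_cast; ring

theorem norm_cis (t : ℝ) : ‖cis t‖ = 1 := Complex.norm_exp_ofReal_mul_I t

theorem cis_mul_star (t : ℝ) : cis t * star (cis t) = 1 := mul_star_of_norm (norm_cis t)

theorem star_cis (t : ℝ) : star (cis t) = cis (-t) := by
  rw [cis_neg]; exact eq_inv_of_mul_eq_one_right (cis_mul_star t)

theorem cis_re (t : ℝ) : (cis t).re = Real.cos t := Complex.exp_ofReal_mul_I_re t

theorem cis_im (t : ℝ) : (cis t).im = Real.sin t := Complex.exp_ofReal_mul_I_im t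

theorem cis_two_pi : cis (2 * Real.pi) = 1 := by
  rw [cis]; push_cast; exact Complex.exp_two_pi_mul_I

theorem cis_add_two_pi (t : ℝ) : cis (t + 2 * Real.pi) = cis t := by
  rw [cis_add, cis_two_pi, mul_one]

theorem cis_sub_two_pi (t : ℝ) : cis (t - 2 * Real.pi) = cis t := by
  rw [cis_sub, cis_two_pi, div_one]

theorem cis_two_pi_sub (t : ℝ) : cis (2 * Real.pi - t) = cis (-t) := by
  rw [← cis_add_two_pi (-t)]; congr 1; ring

theorem cis_ne_one {t : ℝ} (h0 : 0 < t) (h1 : t < 2 * Real.pi) : cis t ≠ 1 := by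
  intro h
  have := eq_of_exp_eq (a := t) (b := 0) (by simpa [cis] using h) (by linarith) (by linarith)
  linarith

theorem continuous_cis : Continuous cis := by unfold cis; fun_prop

/-! ### Special elliptic isometries -/

theorem R_smul_center {k : ℂ} (hk : k ≠ 0) (α : ℂ) (p x : V) : R α (k • p) x = R α p x := by
  have hk' : star k ≠ 0 := star_ne_zero.2 hk
  unfold R
  rw [smul_smul, herm_smul_left, herm_smul_right, herm_smul_right]
  congr 2
  by_cases hp : herm p p = 0
  · simp [hp]
  · field_simp

theorem R_self (α : ℂ) {p : V} (hp : herm p p ≠ 0) : R α p p = (α ^ 2)⁻¹ • p := by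
  rw [R, div_self hp, mul_one, ← add_smul, sub_add_cancel]

theorem R_orthogonal (α : ℂ) {p x : V} (h : herm x p = 0) : R α p x = α • x := by
  simp [R, h]

theorem R_add (α : ℂ) (p x y : V) : R α p (x + y) = R α p x + R α p y := by
  simp only [R, herm_add_left, add_div, mul_add, add_smul, smul_add]; abel

theorem R_smul (α k : ℂ) (p x : V) : R α p (k • x) = k • R α p x := by
  simp only [R, herm_smul_left, mul_div_assoc]; module

theorem IsIsom.map_R {A : Matrix (Fin 3) (Fin 3) ℂ} (hA : IsIsom A) (α : ℂ) (p x : V) :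
    A *ᵥ R α p x = R α (A *ᵥ p) (A *ᵥ x) := by
  simp only [R, Matrix.mulVec_add, Matrix.mulVec_smul, hA x p, hA p p]

theorem herm_R_R {α : ℂ} (hα : ‖α‖ = 1) {p : V} (hp : herm p p ≠ 0) (x y : V) :
    herm (R α p x) (R α p y) = herm x y := by
  have h0 : α ≠ 0 := by rintro rfl; simp at hα
  have h1 : star α = α⁻¹ := eq_inv_of_mul_eq_one_right (mul_star_of_norm hα)
  simp only [R, herm_add_left, herm_add_right, herm_smul_left, herm_smul_right, star_mul',
    star_sub, star_inv₀, star_pow, star_div₀, star_herm, h1]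
  field_simp
  ring

/-- The matrix of `R α p`. -/
def reflMatrix (α : ℂ) (p : V) : Matrix (Fin 3) (Fin 3) ℂ :=
  (((α ^ 2)⁻¹ - α) / herm p p) • Matrix.vecMulVec p ![star (p 0), star (p 1), -star (p 2)] + α • 1

theorem reflMatrix_mulVec (α : ℂ) (p x : V) : reflMatrix α p *ᵥ x = R α p x := by
  rw [reflMatrix, Matrix.add_mulVec, Matrix.smul_mulVec, Matrix.smul_mulVec, Matrix.one_mulVec,
    R, Matrix.vecMulVec_mulVec]
  congr 1
  have : (![star (p 0), star (p 1), -star (p 2)] : V) ⬝ᵥ x = herm x p := by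
    simp [dotProduct, Fin.sum_univ_three, herm]; ring
  rw [this]
  ext i
  simp
  ring

/-- A rank one perturbation of the scalar `α` by a matrix of trace `α⁻² - α` has determinant `α³ +
α²(α⁻² - α)`. -/
theorem det_reflMatrix {α : ℂ} (hα : α ≠ 0) {p : V} (hp : herm p p ≠ 0) :
    (reflMatrix α p).det = 1 := by
  have : (reflMatrix α p).det =
      α ^ 3 + α ^ 2 * (((α ^ 2)⁻¹ - α) / herm p p * herm p p) := by
    rw [Matrix.det_fin_three]
    simp [reflMatrix]
    generalize ((α ^ 2)⁻¹ - α) / herm p p = k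
    simp [herm]
    ring
  rw [this]
  field_simp
  ring

/-- The special elliptic isometry `R α p`. -/
def refl (α : ℂ) (hα : ‖α‖ = 1) (p : V) (hp : herm p p ≠ 0) : SU21 :=
  ⟨⟨reflMatrix α p, det_reflMatrix (by rintro rfl; simp at hα) hp⟩, by
    intro x y
    change herm (reflMatrix α p *ᵥ x) (reflMatrix α p *ᵥ y) = _
    rw [reflMatrix_mulVec, reflMatrix_mulVec, herm_R_R hα hp]⟩

theorem mat_refl_mulVec {α : ℂ} (hα : ‖α‖ = 1) {p : V} (hp : herm p p ≠ 0) (x : V) :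
    mat (refl α hα p hp) *ᵥ x = R α p x := reflMatrix_mulVec α p x

theorem continuous_refl {X : Type*} [TopologicalSpace X] {α : ℂ} (hα : ‖α‖ = 1) {p : X → V}
    (hp : ∀ t, herm (p t) (p t) ≠ 0) (hc : Continuous p) :
    Continuous fun t => refl α hα (p t) (hp t) := by
  have h1 : Continuous fun t => herm (p t) (p t) := continuous_herm.comp hc
  have hci : ∀ i, Continuous fun t => p t i := fun i => (continuous_apply i).comp hc
  refine Continuous.subtype_mk (Continuous.subtype_mk ?_ _) _
  refine (Continuous.smul (continuous_const.div h1 hp) ?_).add continuous_const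
  refine continuous_matrix fun i j => ?_
  simp only [Matrix.vecMulVec_apply]
  refine (hci i).mul ?_
  fin_cases j
  · exact (hci 0).star
  · exact (hci 1).star
  · exact (hci 2).star.neg

theorem eq_of_mulVec {A B : Matrix (Fin 3) (Fin 3) ℂ} (h : ∀ x : V, A *ᵥ x = B *ᵥ x) : A = B :=
  Matrix.toLin'.injective (LinearMap.ext fun x => by simpa using h x)

/-- The product of two special elliptic isometries. -/
def prodRefl (α₁ α₂ : ℂ) (h₁ : ‖α₁‖ = 1) (h₂ : ‖α₂‖ = 1) (p₁ p₂ : V) (hp₁ : herm p₁ p₁ ≠ 0)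
    (hp₂ : herm p₂ p₂ ≠ 0) : SU21 := refl α₂ h₂ p₂ hp₂ * refl α₁ h₁ p₁ hp₁

theorem isProduct_prodRefl {α₁ α₂ : ℂ} (h₁ : ‖α₁‖ = 1) (h₂ : ‖α₂‖ = 1) {p₁ p₂ : V}
    (hp₁ : herm p₁ p₁ ≠ 0) (hp₂ : herm p₂ p₂ ≠ 0) :
    IsProduct α₁ α₂ p₁ p₂ (prodRefl α₁ α₂ h₁ h₂ p₁ p₂ hp₁ hp₂) := by
  intro x
  rw [prodRefl, mat_mul, ← Matrix.mulVec_mulVec, mat_refl_mulVec, mat_refl_mulVec]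

theorem IsProduct.eq_prodRefl {α₁ α₂ : ℂ} (h₁ : ‖α₁‖ = 1) (h₂ : ‖α₂‖ = 1) {p₁ p₂ : V}
    (hp₁ : herm p₁ p₁ ≠ 0) (hp₂ : herm p₂ p₂ ≠ 0) {F : SU21} (hF : IsProduct α₁ α₂ p₁ p₂ F) :
    F = prodRefl α₁ α₂ h₁ h₂ p₁ p₂ hp₁ hp₂ :=
  mat_injective (eq_of_mulVec fun x => by
    rw [hF x, isProduct_prodRefl h₁ h₂ hp₁ hp₂ x])

theorem IsProduct.smul_centers {α₁ α₂ k₁ k₂ : ℂ} (hk₁ : k₁ ≠ 0) (hk₂ : k₂ ≠ 0) {p₁ p₂ : V}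
    {F : SU21} (hF : IsProduct α₁ α₂ p₁ p₂ F) : IsProduct α₁ α₂ (k₁ • p₁) (k₂ • p₂) F := by
  intro x
  rw [R_smul_center hk₁, R_smul_center hk₂, hF x]

/-- An isometry conjugates a special elliptic isometry to the one with the transported center, and
the representative of a center is irrelevant. So congruent pairs of points give conjugate products.
-/
theorem IsProduct.cls_eq {α₁ α₂ k₁ k₂ : ℂ} (hk₁ : k₁ ≠ 0) (hk₂ : k₂ ≠ 0) {p₁ p₂ q₁ q₂ : V}
    {F G : SU21} (hF : IsProduct α₁ α₂ p₁ p₂ F) (hG : IsProduct α₁ α₂ q₁ q₂ G)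
    {A : Matrix (Fin 3) (Fin 3) ℂ} (hA : IsIsom A) (h1 : A *ᵥ p₁ = k₁ • q₁)
    (h2 : A *ᵥ p₂ = k₂ • q₂) : cls F = cls G := by
  refine cls_eq_of_intertwine hA (δ := 1) ?_
  rw [one_smul]
  refine eq_of_mulVec fun x => ?_
  rw [← Matrix.mulVec_mulVec, ← Matrix.mulVec_mulVec, hF x, hG, hA.map_R, hA.map_R, h1, h2,
    R_smul_center hk₁, R_smul_center hk₂]

/-! ### Normalized pairs of centers -/

/-- Representatives of two centers with a normalized Gram matrix. -/
structure NormalPair (p₁ p₂ : V) (s₁ s₂ g : ℝ) : Prop where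
  h11 : herm p₁ p₁ = s₁
  h22 : herm p₂ p₂ = s₂
  h12 : herm p₁ p₂ = g
  sq1 : s₁ ^ 2 = 1
  sq2 : s₂ ^ 2 = 1

namespace NormalPair

variable {p₁ p₂ : V} {s₁ s₂ g : ℝ}

theorem h21 (h : NormalPair p₁ p₂ s₁ s₂ g) : herm p₂ p₁ = g := by
  rw [← star_herm, h.h12]; exact Complex.conj_ofReal g

theorem sq1' (h : NormalPair p₁ p₂ s₁ s₂ g) : (s₁ : ℂ) ^ 2 = 1 := by exact_mod_cast h.sq1

theorem sq2' (h : NormalPair p₁ p₂ s₁ s₂ g) : (s₂ : ℂ) ^ 2 = 1 := by exact_mod_cast h.sq2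

theorem s1_ne (h : NormalPair p₁ p₂ s₁ s₂ g) : (s₁ : ℂ) ≠ 0 := by
  intro h0; have := h.sq1'; simp [h0] at this

theorem s2_ne (h : NormalPair p₁ p₂ s₁ s₂ g) : (s₂ : ℂ) ≠ 0 := by
  intro h0; have := h.sq2'; simp [h0] at this

theorem ne1 (h : NormalPair p₁ p₂ s₁ s₂ g) : herm p₁ p₁ ≠ 0 := by rw [h.h11]; exact h.s1_ne

theorem ne2 (h : NormalPair p₁ p₂ s₁ s₂ g) : herm p₂ p₂ ≠ 0 := by rw [h.h22]; exact h.s2_ne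

theorem herm_cross (h : NormalPair p₁ p₂ s₁ s₂ g) :
    herm (cross p₁ p₂) (cross p₁ p₂) = ((-(s₁ * s₂ - g ^ 2) : ℝ) : ℂ) := by
  rw [herm_cross_cross, h.h11, h.h22, h.h12, h.h21]; push_cast; ring

end NormalPair

theorem exists_normalize {p : V} {σ : SignType} (h0 : sgn p ≠ 0) (hσ : sgn p = σ) :
    ∃ k : ℂ, k ≠ 0 ∧ herm (k • p) (k • p) = ((σ : ℝ) : ℂ) ∧ (σ : ℝ) ^ 2 = 1 := by
  set r : ℝ := (herm p p).re with hr
  have hr0 : r ≠ 0 := by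
    intro h; apply h0; rw [sgn, ← hr, h]; simp
  have hs : (σ : ℝ) * |r| = r := by rw [← hσ, sgn]; exact sign_mul_abs r
  have hσ2 : (σ : ℝ) ^ 2 = 1 := by
    have := congrArg (fun x => x ^ 2) hs
    simp only [mul_pow, sq_abs] at this
    exact mul_right_cancel₀ (pow_ne_zero 2 hr0) (by linarith)
  have ha : 0 < |r| := abs_pos.2 hr0
  refine ⟨((Real.sqrt |r|)⁻¹ : ℝ), ?_, ?_, hσ2⟩
  · simpa using (Real.sqrt_pos.2 ha).ne'
  · rw [herm_smul_left, herm_smul_right, herm_self_eq_re p, ← hr, Complex.star_def,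
      Complex.conj_ofReal]
    have h2 : (Real.sqrt |r|)⁻¹ * ((Real.sqrt |r|)⁻¹ * r) = σ := by
      rw [← mul_assoc, ← mul_inv, Real.mul_self_sqrt ha.le, ← hs, inv_mul_eq_div,
        mul_div_assoc, abs_mul, abs_abs]
      have : |(σ : ℝ)| = 1 := by
        rw [← sq_eq_sq₀ (abs_nonneg _) zero_le_one, sq_abs, hσ2]; norm_num
      rw [this, one_mul, div_self ha.ne', mul_one]
    exact_mod_cast h2

/-- Positive scaling makes the squares `±1`; a phase on the first representative then makes the
mixed product nonnegative. Only the number `g` remains free. -/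
theorem exists_normalPair {p₁ p₂ : V} {σ₁ σ₂ : SignType} (h1 : sgn p₁ ≠ 0) (h2 : sgn p₂ ≠ 0)
    (h1' : sgn p₁ = σ₁) (h2' : sgn p₂ = σ₂) :
    ∃ (k₁ k₂ : ℂ) (g : ℝ), k₁ ≠ 0 ∧ k₂ ≠ 0 ∧ 0 ≤ g ∧
      NormalPair (k₁ • p₁) (k₂ • p₂) (σ₁ : ℝ) (σ₂ : ℝ) g := by
  obtain ⟨k₁, hk₁, e1, q1⟩ := exists_normalize h1 h1'
  obtain ⟨k₂, hk₂, e2, q2⟩ := exists_normalize h2 h2'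
  set z := herm (k₁ • p₁) (k₂ • p₂) with hz
  obtain ⟨u, hu, huz⟩ : ∃ u : ℂ, ‖u‖ = 1 ∧ u * z = ‖z‖ := by
    by_cases h : z = 0
    · exact ⟨1, by simp, by simp [h]⟩
    · have hzn : (‖z‖ : ℂ) ≠ 0 := by simpa using h
      refine ⟨‖z‖ / z, ?_, div_mul_cancel₀ _ h⟩
      rw [norm_div, Complex.norm_real, norm_norm, div_self (by simpa using h)]
  have hu0 : u ≠ 0 := by rintro rfl; simp at hu
  refine ⟨u * k₁, k₂, ‖z‖, mul_ne_zero hu0 hk₁, hk₂, norm_nonneg _, ⟨?_, e2, ?_, q1, q2⟩⟩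
  · rw [mul_smul, herm_smul_left, herm_smul_right, e1, ← mul_assoc, mul_star_of_norm hu, one_mul]
  · rw [mul_smul, herm_smul_left, ← hz, huz]

/-- Nondegenerate normalized pairs with the same Gram matrix yield the same class. -/
theorem NormalPair.cls_eq {p₁ p₂ q₁ q₂ : V} {s₁ s₂ g : ℝ} (hp : NormalPair p₁ p₂ s₁ s₂ g)
    (hq : NormalPair q₁ q₂ s₁ s₂ g) (hg : s₁ * s₂ - g ^ 2 ≠ 0) {α₁ α₂ : ℂ} {F G : SU21}
    (hF : IsProduct α₁ α₂ p₁ p₂ F) (hG : IsProduct α₁ α₂ q₁ q₂ G) : cls F = cls G := by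
  have hd : (Matrix.of fun i j => herm ((![p₁, p₂, cross p₁ p₂] : Fin 3 → V) j)
      ((![p₁, p₂, cross p₁ p₂] : Fin 3 → V) i)).det ≠ 0 := by
    rw [Matrix.det_fin_three]
    simp only [Matrix.of_apply, Matrix.cons_val_zero, Matrix.cons_val_one, Matrix.cons_val,
      hp.h11, hp.h22, hp.h12, hp.h21, herm_cross_left, herm_cross_right, hp.herm_cross,
      herm_eq_zero_comm.1 (herm_cross_left p₁ p₂), herm_eq_zero_comm.1 (herm_cross_right p₁ p₂)]
    norm_cast
    -- The Gram determinant of `p₁, p₂, cross p₁ p₂` is minus the square of that of `p₁, p₂`.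
    have : -(s₁ * s₂ - g ^ 2) ^ 2 ≠ 0 := neg_ne_zero.2 (pow_ne_zero 2 hg)
    intro h
    exact this (by linear_combination h)
  obtain ⟨A, hA, hAp⟩ := exists_isom_of_gram (p := ![p₁, p₂, cross p₁ p₂])
    (q := ![q₁, q₂, cross q₁ q₂]) (by
      intro i j
      fin_cases i <;> fin_cases j <;>
      simp [hp.h11, hp.h22, hp.h12, hp.h21, herm_cross_left, herm_cross_right, hp.herm_cross,
        herm_eq_zero_comm.1 (herm_cross_left p₁ p₂), herm_eq_zero_comm.1 (herm_cross_right p₁ p₂),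
        hq.h11, hq.h22, hq.h12, hq.h21, hq.herm_cross,
        herm_eq_zero_comm.1 (herm_cross_left q₁ q₂),
        herm_eq_zero_comm.1 (herm_cross_right q₁ q₂)]) hd
  refine hF.cls_eq (k₁ := 1) (k₂ := 1) one_ne_zero one_ne_zero hG hA ?_ ?_
  · rw [one_smul]; exact hAp 0
  · rw [one_smul]; exact hAp 1

/-- Two vectors of the same square are related by an isometry, up to a scalar. -/
theorem exists_isom_map_smul {p q : V} {s : ℝ} (hs : s ^ 2 = 1) (hp : herm p p = s)
    (hq : herm q q = s) : ∃ A, IsIsom A ∧ ∃ k : ℂ, k ≠ 0 ∧ A *ᵥ p = k • q := by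
  have hs0 : (s : ℂ) ≠ 0 := by
    norm_cast; rintro rfl; norm_num at hs
  obtain ⟨u, hu, r, hr⟩ : ∃ u : ℂ, ‖u‖ = 1 ∧ ∃ r : ℝ, herm p (u • q) = r := by
    set z := herm p q
    by_cases h : z = 0
    · exact ⟨1, by simp, 0, by rw [one_smul]; exact h⟩
    · have hzn : (‖z‖ : ℂ) ≠ 0 := by simpa using h
      refine ⟨z / ‖z‖, ?_, ‖z‖, ?_⟩
      · rw [norm_div, Complex.norm_real, norm_norm, div_self (by simpa using h)]
      · rw [herm_smul_right, star_div₀, Complex.star_def, Complex.conj_ofReal, div_mul_eq_mul_div,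
          mul_comm, Complex.mul_conj, Complex.normSq_eq_norm_sq]
        change ((‖z‖ ^ 2 : ℝ) : ℂ) / _ = _
        push_cast
        field_simp
  -- One of the two phases `±u` gives a real product other than `s`, which makes the difference `p -
  -- w` nonisotropic.
  obtain ⟨u', hu', r', hr', hrs⟩ : ∃ u : ℂ, ‖u‖ = 1 ∧ ∃ r : ℝ, herm p (u • q) = r ∧ r ≠ s := by
    by_cases h : r = s
    · refine ⟨-u, by simpa using hu, -r, ?_, ?_⟩
      · rw [neg_smul, ← neg_one_smul ℂ (u • q), herm_smul_right, hr]; simp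
      · rw [h]; intro h'
        have : s = 0 := by linarith
        rw [this] at hs; norm_num at hs
    · exact ⟨u, hu, r, hr, h⟩
  set w := u' • q with hw
  have hww : herm w w = s := by
    rw [hw, herm_smul_left, herm_smul_right, ← mul_assoc, mul_star_of_norm hu', one_mul, hq]
  have hwp : herm w p = r' := by rw [← star_herm, hr']; exact Complex.conj_ofReal r'
  have hd : herm (p - w) (p - w) = 2 * (s - r') := by
    rw [herm_sub_left, herm_sub_right, herm_sub_right, hp, hww, hr', hwp]; ring
  have hd0 : herm (p - w) (p - w) ≠ 0 := by
    rw [hd]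
    refine mul_ne_zero two_ne_zero (sub_ne_zero.2 ?_)
    exact_mod_cast hrs.symm
  have hn : ‖(-1 : ℂ)‖ = 1 := by simp
  have hu0 : u' ≠ 0 := by rintro rfl; simp at hu'
  -- With parameter `-1` the map is an involution, the negative of the reflection in the hyperplane
  -- orthogonal to `p - w`; it sends `p` to `-w`.
  refine ⟨mat (refl (-1) hn (p - w) hd0), isIsom_mat _, -u', neg_ne_zero.2 hu0, ?_⟩
  rw [mat_refl_mulVec, R, hd, herm_sub_right, hp, hr']
  have h1 : (s : ℂ) - r' ≠ 0 := sub_ne_zero.2 (by exact_mod_cast hrs.symm)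
  have : (((-1 : ℂ) ^ 2)⁻¹ - -1) * ((s - r') / (2 * (s - r'))) = 1 := by field_simp; norm_num
  rw [this, one_smul, hw]
  module

/-! ### The product on the span of the centers -/

/-- The number `e^{-i(a₁+a₂)/2}`. -/
def hlf (a₁ a₂ : ℝ) : ℂ := cis (-((a₁ + a₂) / 2))

/-- The point dividing the chord from `e^{iD}` to `e^{-iΣ}` in the ratio `τ`, where
`D = 3(a₂-a₁)/2` and `Σ = 3(a₁+a₂)/2`. -/
def chord (a₁ a₂ τ : ℝ) : ℂ :=
  (1 - τ) * cis (3 * (a₂ - a₁) / 2) + τ * cis (-(3 * (a₁ + a₂) / 2))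

theorem chord_re (a₁ a₂ τ : ℝ) : (chord a₁ a₂ τ).re =
    (1 - τ) * Real.cos (3 * (a₂ - a₁) / 2) + τ * Real.cos (3 * (a₁ + a₂) / 2) := by
  rw [chord, ← Complex.ofReal_one, ← Complex.ofReal_sub, Complex.add_re, Complex.re_ofReal_mul,
    Complex.re_ofReal_mul, cis_re, cis_re, Real.cos_neg]

theorem chord_im (a₁ a₂ τ : ℝ) : (chord a₁ a₂ τ).im =
    (1 - τ) * Real.sin (3 * (a₂ - a₁) / 2) - τ * Real.sin (3 * (a₁ + a₂) / 2) := by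
  rw [chord, ← Complex.ofReal_one, ← Complex.ofReal_sub, Complex.add_im, Complex.im_ofReal_mul,
    Complex.im_ofReal_mul, cis_im, cis_im, Real.sin_neg]
  ring

theorem star_chord (a₁ a₂ τ : ℝ) : star (chord a₁ a₂ τ) =
    (1 - τ) * cis (-(3 * (a₂ - a₁) / 2)) + τ * cis (3 * (a₁ + a₂) / 2) := by
  rw [chord, star_add, star_mul', star_mul', star_cis, star_cis, neg_neg, star_sub, star_one]
  simp only [Complex.star_def, Complex.conj_ofReal]

/-- This is the power of a point: both ends of the chord lie on the unit circle at angular distance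
`3a₂`, so `1-|z|²` is `τ(1-τ)` times the squared length `2 - 2 cos 3a₂` of the chord. -/
theorem one_sub_normSq_chord (a₁ a₂ τ : ℝ) :
    1 - (chord a₁ a₂ τ).re ^ 2 - (chord a₁ a₂ τ).im ^ 2 =
      2 * τ * (1 - τ) * (1 - Real.cos (3 * a₂)) := by
  rw [chord_re, chord_im]
  have h : Real.cos (3 * a₂) = Real.cos (3 * (a₂ - a₁) / 2) * Real.cos (3 * (a₁ + a₂) / 2) -
      Real.sin (3 * (a₂ - a₁) / 2) * Real.sin (3 * (a₁ + a₂) / 2) := by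
    rw [← Real.cos_add]; congr 1; ring
  rw [h]
  have h1 := Real.sin_sq_add_cos_sq (3 * (a₂ - a₁) / 2)
  have h2 := Real.sin_sq_add_cos_sq (3 * (a₁ + a₂) / 2)
  linear_combination (-(1 - τ) ^ 2) * h1 - τ ^ 2 * h2

/-- The factor `α⁻² - α`. -/
def bet (α : ℂ) : ℂ := (α ^ 2)⁻¹ - α

/-- Half angle coordinates. -/
theorem half_angles (a₁ a₂ : ℝ) : ∃ u v : ℂ, u ≠ 0 ∧ v ≠ 0 ∧ cis a₁ = u ^ 2 ∧ cis a₂ = v ^ 2 ∧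
    hlf a₁ a₂ = (u * v)⁻¹ ∧ cis (3 * (a₂ - a₁) / 2) = (v / u) ^ 3 ∧
    cis (3 * (a₁ + a₂) / 2) = (u * v) ^ 3 := by
  refine ⟨cis (a₁ / 2), cis (a₂ / 2), cis_ne_zero _, cis_ne_zero _, ?_, ?_, ?_, ?_, ?_⟩
  · rw [← cis_nat_mul]; congr 1; push_cast; ring
  · rw [← cis_nat_mul]; congr 1; push_cast; ring
  · rw [← cis_add, ← cis_neg, hlf]; congr 1; ring
  · rw [← cis_sub, ← cis_nat_mul]; congr 1; push_cast; ring
  · rw [← cis_add, ← cis_nat_mul]; congr 1; push_cast; ring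

/-- The left side is `⟨Fp₁,p₁⟩/⟨p₁,p₁⟩` for the product `F`. Together with `chord_identity'`, which
gives the rest of the trace of `F` on the span of the centers, it shows that this trace is `h(z +
z̄)`. -/
theorem chord_identity (a₁ a₂ τ : ℝ) :
    ((cis a₁) ^ 2)⁻¹ * cis a₂ + ((cis a₁) ^ 2)⁻¹ * bet (cis a₂) * τ =
      hlf a₁ a₂ * chord a₁ a₂ τ := by
  obtain ⟨u, v, hu, hv, h1, h2, h3, h4, h5⟩ := half_angles a₁ a₂
  rw [chord, cis_neg, h4, h5, h3, bet, h1, h2]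
  field_simp
  ring

theorem chord_identity' (a₁ a₂ τ : ℝ) :
    cis a₁ * ((cis a₂) ^ 2)⁻¹ + bet (cis a₁) * bet (cis a₂) * τ
      - ((cis a₁) ^ 2)⁻¹ * bet (cis a₂) * τ = hlf a₁ a₂ * star (chord a₁ a₂ τ) := by
  obtain ⟨u, v, hu, hv, h1, h2, h3, h4, h5⟩ := half_angles a₁ a₂
  rw [star_chord, cis_neg, h4, h5, h3, bet, bet, h1, h2]
  field_simp
  ring

theorem hlf_sq (a₁ a₂ : ℝ) : hlf a₁ a₂ ^ 2 = (cis a₁ * cis a₂)⁻¹ := by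
  obtain ⟨u, v, hu, hv, h1, h2, h3, -, -⟩ := half_angles a₁ a₂
  rw [h1, h2, h3]; field_simp

theorem norm_hlf (a₁ a₂ : ℝ) : ‖hlf a₁ a₂‖ = 1 := norm_cis _

theorem hlf_ne_zero (a₁ a₂ : ℝ) : hlf a₁ a₂ ≠ 0 := cis_ne_zero _

theorem bet_ne_zero {a : ℝ} (h0 : 0 < a) (h1 : a < 2 * Real.pi / 3) : bet (cis a) ≠ 0 := by
  intro h
  have h3 : cis (((3 : ℕ) : ℝ) * a) = 1 := by
    rw [cis_nat_mul]
    have := cis_ne_zero a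
    rw [bet] at h
    field_simp at h
    linear_combination -h
  exact cis_ne_one (by push_cast; linarith) (by push_cast; linarith) h3

section product

variable {p₁ p₂ : V} {s₁ s₂ g a₁ a₂ : ℝ} {F : SU21}

/-- The vector `(F - h w') p₁`. -/
def eigv (a₁ a₂ : ℝ) (p₁ p₂ : V) (s₂ g : ℝ) (w' : ℂ) : V :=
  (((cis a₁) ^ 2)⁻¹ * cis a₂ - hlf a₁ a₂ * w') • p₁ +
    (((cis a₁) ^ 2)⁻¹ * bet (cis a₂) * g * s₂) • p₂

theorem product_first (hN : NormalPair p₁ p₂ s₁ s₂ g) (hF : IsProduct (cis a₁) (cis a₂) p₁ p₂ F) :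
    mat F *ᵥ p₁ = (((cis a₁) ^ 2)⁻¹ * cis a₂) • p₁ +
      (((cis a₁) ^ 2)⁻¹ * bet (cis a₂) * g * s₂) • p₂ := by
  have hs : ((s₂ : ℂ))⁻¹ = s₂ := by
    have := hN.sq2'; have := hN.s2_ne; field_simp; linear_combination -hN.sq2'
  rw [hF, R_self _ hN.ne1, R_smul, R, hN.h12, hN.h22, div_eq_mul_inv, hs, bet]
  module

theorem product_second (hN : NormalPair p₁ p₂ s₁ s₂ g)
    (hF : IsProduct (cis a₁) (cis a₂) p₁ p₂ F) :
    mat F *ᵥ p₂ = (cis a₂ * bet (cis a₁) * g * s₁) • p₁ +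
      (cis a₁ * ((cis a₂) ^ 2)⁻¹ + bet (cis a₁) * bet (cis a₂) * (s₁ * s₂ * g ^ 2)) • p₂ := by
  have hs : ((s₂ : ℂ))⁻¹ = s₂ := by
    have := hN.s2_ne; field_simp; linear_combination -hN.sq2'
  have hs1 : ((s₁ : ℂ))⁻¹ = s₁ := by
    have := hN.s1_ne; field_simp; linear_combination -hN.sq1'
  have e1 : R (cis a₁) p₁ p₂ = (bet (cis a₁) * (g * s₁)) • p₁ + cis a₁ • p₂ := by
    rw [R, hN.h21, hN.h11, div_eq_mul_inv, hs1, bet]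
  have e2 : R (cis a₂) p₂ p₁ = (bet (cis a₂) * (g * s₂)) • p₂ + cis a₂ • p₁ := by
    rw [R, hN.h12, hN.h22, div_eq_mul_inv, hs, bet]
  rw [hF, e1, R_add, R_smul, R_smul, R_self _ hN.ne2, e2]
  module

theorem eigv_eq (hN : NormalPair p₁ p₂ s₁ s₂ g) (hF : IsProduct (cis a₁) (cis a₂) p₁ p₂ F)
    (w' : ℂ) : eigv a₁ a₂ p₁ p₂ s₂ g w' = mat F *ᵥ p₁ - (hlf a₁ a₂ * w') • p₁ := by
  rw [product_first hN hF, eigv]; module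

/-- On the span of the centers `F` has trace `h(w+w')` and determinant `h²`, so `(F-hw)(F-hw') = 0`
there by Cayley-Hamilton. The vector `(F-hw')p₁` is thus mapped to `hw` times itself. -/
theorem eigv_eigen (hN : NormalPair p₁ p₂ s₁ s₂ g) (hF : IsProduct (cis a₁) (cis a₂) p₁ p₂ F)
    {τ : ℝ} (hτ : τ = s₁ * s₂ * g ^ 2) {w w' : ℂ} (hw : w * w' = 1)
    (hsum : w + w' = chord a₁ a₂ τ + star (chord a₁ a₂ τ)) :
    mat F *ᵥ eigv a₁ a₂ p₁ p₂ s₂ g w' = (hlf a₁ a₂ * w) • eigv a₁ a₂ p₁ p₂ s₂ g w' := by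
  have h1 := chord_identity a₁ a₂ τ
  have h2 := chord_identity' a₁ a₂ τ
  have h3 := hlf_sq a₁ a₂
  have hτ' : (s₁ * s₂ * g ^ 2 : ℂ) = τ := by rw [hτ]; push_cast; ring
  rw [eigv, Matrix.mulVec_add, Matrix.mulVec_smul, Matrix.mulVec_smul, product_first hN hF,
    product_second hN hF, hτ']
  have e1 := cis_ne_zero a₁
  have e2 := cis_ne_zero a₂
  set A := ((cis a₁) ^ 2)⁻¹ * cis a₂ with hA
  set E := cis a₁ * ((cis a₂) ^ 2)⁻¹ + bet (cis a₁) * bet (cis a₂) * τ with hE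
  set B := ((cis a₁) ^ 2)⁻¹ * bet (cis a₂) * g * s₂ with hB
  set C := cis a₂ * bet (cis a₁) * g * s₁ with hC
  set h := hlf a₁ a₂
  have htr : A + E = h * w + h * w' := by
    linear_combination h1 + h2 - h * hsum
  have hdet : A * E - B * C = h ^ 2 := by
    have hBC : B * C = ((cis a₁) ^ 2)⁻¹ * bet (cis a₂) * cis a₂ * bet (cis a₁) * τ := by
      rw [hB, hC, ← hτ']; ring
    rw [hBC, h3, hA, hE]
    field_simp
    ring
  have k1 : (A - h * w') * A + B * C = h * w * (A - h * w') := by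
    linear_combination A * htr - hdet + h ^ 2 * hw
  have k2 : (A - h * w') * B + B * E = h * w * B := by
    linear_combination B * htr
  calc _ = ((A - h * w') * A + B * C) • p₁ + ((A - h * w') * B + B * E) • p₂ := by module
    _ = _ := by rw [k1, k2]; module

/-- Besides entering the square of the eigenvector, this shows that the eigenvector is nonzero
whenever `w'` differs from `z`. -/
theorem herm_eigv_first (hN : NormalPair p₁ p₂ s₁ s₂ g) {τ : ℝ} (hτ : τ = s₁ * s₂ * g ^ 2)
    (w' : ℂ) : herm (eigv a₁ a₂ p₁ p₂ s₂ g w') p₁ =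
      s₁ * (hlf a₁ a₂ * (chord a₁ a₂ τ - w')) := by
  rw [eigv, herm_add_left, herm_smul_left, herm_smul_left, hN.h11, hN.h21, mul_sub,
    ← chord_identity, hτ]
  push_cast
  linear_combination (-((cis a₁) ^ 2)⁻¹ * bet (cis a₂) * s₂ * g ^ 2) * hN.sq1'

/-- For any eigenvector `z` of eigenvalue `μ`, the vector `(F-μ)x` is orthogonal to `z`. -/
theorem herm_sub_eigen {z x : V} {μ : ℂ} (hμ : ‖μ‖ = 1) (hz : mat F *ᵥ z = μ • z) :
    herm (mat F *ᵥ x) z = μ * herm x z := by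
  have h1 := isIsom_mat F x z
  rw [hz, herm_smul_right] at h1
  rw [← h1, ← mul_assoc, mul_star_of_norm hμ, one_mul]

/-- For `v = (F-he^{-iφ})p₁` invariance gives `⟨Fp₁,v⟩ = he^{iφ}⟨p₁,v⟩`, hence `⟨v,v⟩ = 2ih sin φ ·
⟨p₁,v⟩`, and the last product is known. Used with `φ` and with `-φ`, the formula gives the
signatures of both eigenvectors in the span. -/
theorem herm_eigv_eigv (hN : NormalPair p₁ p₂ s₁ s₂ g)
    (hF : IsProduct (cis a₁) (cis a₂) p₁ p₂ F) {τ : ℝ} (hτ : τ = s₁ * s₂ * g ^ 2) {φ : ℝ}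
    (hφ : Real.cos φ = (chord a₁ a₂ τ).re) :
    herm (eigv a₁ a₂ p₁ p₂ s₂ g (cis (-φ))) (eigv a₁ a₂ p₁ p₂ s₂ g (cis (-φ))) =
      ((2 * s₁ * Real.sin φ * (Real.sin φ + (chord a₁ a₂ τ).im) : ℝ) : ℂ) := by
  have hsum : cis φ + cis (-φ) = chord a₁ a₂ τ + star (chord a₁ a₂ τ) := by
    rw [← star_cis, Complex.star_def, Complex.add_conj, Complex.add_conj, cis_re, hφ]
  have hprod : cis φ * cis (-φ) = 1 := by rw [← star_cis, cis_mul_star]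
  have he := eigv_eigen hN hF hτ hprod hsum
  have hn : ‖hlf a₁ a₂ * cis φ‖ = 1 := by rw [norm_mul, norm_hlf, norm_cis, one_mul]
  set v := eigv a₁ a₂ p₁ p₂ s₂ g (cis (-φ)) with hv
  have h1 : herm v v = hlf a₁ a₂ * (cis φ - cis (-φ)) * star (herm v p₁) := by
    have h0 : herm v v = herm (mat F *ᵥ p₁ - (hlf a₁ a₂ * cis (-φ)) • p₁) v := by
      rw [← eigv_eq hN hF]
    rw [h0, herm_sub_left, herm_sub_eigen hn he, herm_smul_left, star_herm]
    ring
  rw [h1, herm_eigv_first hN hτ, star_mul', star_mul', star_sub, star_cis, neg_neg,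
    Complex.star_def, Complex.conj_ofReal]
  have h2 := mul_star_of_norm (norm_hlf a₁ a₂)
  have h3 : (cis φ - cis (-φ)) * (star (chord a₁ a₂ τ) - cis φ) =
      ((2 * Real.sin φ * (Real.sin φ + (chord a₁ a₂ τ).im) : ℝ) : ℂ) := by
    rw [← star_cis]
    apply Complex.ext
    · simp only [Complex.star_def, Complex.mul_re, Complex.sub_re, Complex.sub_im,
        Complex.conj_re, Complex.conj_im, cis_re, cis_im, Complex.ofReal_re, hφ]
      ring
    · simp only [Complex.star_def, Complex.mul_im, Complex.sub_re, Complex.sub_im,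
        Complex.conj_re, Complex.conj_im, cis_re, cis_im, Complex.ofReal_im, hφ]
      ring
  rw [Complex.star_def] at h2 h3
  have h4 : ((2 * s₁ * Real.sin φ * (Real.sin φ + (chord a₁ a₂ τ).im) : ℝ) : ℂ) =
      s₁ * ((2 * Real.sin φ * (Real.sin φ + (chord a₁ a₂ τ).im) : ℝ) : ℂ) := by
    push_cast; ring
  rw [h4, ← h3]
  linear_combination (s₁ * (cis φ - cis (-φ)) * ((starRingEnd ℂ) (chord a₁ a₂ τ) - cis φ)) * h2

theorem product_cross (hF : IsProduct (cis a₁) (cis a₂) p₁ p₂ F) :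
    mat F *ᵥ cross p₁ p₂ = (cis a₁ * cis a₂) • cross p₁ p₂ := by
  have h1 := herm_eq_zero_comm.1 (herm_cross_left p₁ p₂)
  have h2 := herm_eq_zero_comm.1 (herm_cross_right p₁ p₂)
  rw [hF, R_orthogonal _ h1, R_smul, R_orthogonal _ h2, smul_smul]

theorem herm_eigv_cross (w' : ℂ) :
    herm (eigv a₁ a₂ p₁ p₂ s₂ g w') (cross p₁ p₂) = 0 := by
  rw [eigv, herm_add_left, herm_smul_left, herm_smul_left, herm_cross_left, herm_cross_right]
  ring

/-- A product that is identical, elliptic or parabolic has trace in the deltoid. -/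
theorem abs_chord_re_le (hN : NormalPair p₁ p₂ s₁ s₂ g)
    (hF : IsProduct (cis a₁) (cis a₂) p₁ p₂ F) {τ : ℝ} (hτ : τ = s₁ * s₂ * g ^ 2)
    (hE : IsEllipticOrParabolic F) : |(chord a₁ a₂ τ).re| ≤ 1 := by
  by_contra! hx
  set x := (chord a₁ a₂ τ).re with hx'
  have hx2 : 1 < x ^ 2 := by rw [← sq_abs]; nlinarith
  set q := Real.sqrt (x ^ 2 - 1) with hq
  have hq0 : 0 < q := Real.sqrt_pos.2 (by linarith)
  have hqq : q ^ 2 = x ^ 2 - 1 := Real.sq_sqrt (by linarith)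
  -- For `|Re z| > 1` the eigenvalues on the span are `h(x ± q)`, neither of unit norm, so their
  -- eigenvectors are isotropic. This loxodromic picture is incompatible with each of the three
  -- admissible types.
  have key : ∀ r : ℝ, r ≠ 0 → r ^ 2 = q ^ 2 → ∃ (v : V) (μ : ℂ), v ≠ 0 ∧ herm v v = 0 ∧
      mat F *ᵥ v = μ • v ∧ μ = hlf a₁ a₂ * (x + r : ℝ) ∧ ‖μ‖ ≠ 1 := by
    intro r hr0 hr
    have hprod : ((x + r : ℝ) : ℂ) * ((x - r : ℝ) : ℂ) = 1 := by
      rw [← Complex.ofReal_mul, ← Complex.ofReal_one]; congr 1; nlinarith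
    have hsum : ((x + r : ℝ) : ℂ) + ((x - r : ℝ) : ℂ) =
        chord a₁ a₂ τ + star (chord a₁ a₂ τ) := by
      rw [Complex.star_def, Complex.add_conj, ← hx']; push_cast; ring
    have he := eigv_eigen hN hF hτ hprod hsum
    have hnorm : ‖hlf a₁ a₂ * ((x + r : ℝ) : ℂ)‖ ≠ 1 := by
      rw [norm_mul, norm_hlf, one_mul, Complex.norm_real, Real.norm_eq_abs]
      intro h
      have h1 : (x + r) ^ 2 = 1 := by rw [← sq_abs, h]; norm_num
      have h2 : (x + r) * (x - r) = 1 := by nlinarith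
      have h3 : (x + r) * (2 * r) = 0 := by linear_combination h1 - h2
      rcases mul_eq_zero.1 h3 with h4 | h4
      · rw [h4] at h1; norm_num at h1
      · exact hr0 (by linarith)
    refine ⟨_, _, ?_, ?_, he, rfl, hnorm⟩
    · intro h0
      have h1 := herm_eigv_first (a₁ := a₁) (a₂ := a₂) hN hτ ((x - r : ℝ) : ℂ)
      rw [h0, herm_zero_left] at h1
      have h2 : chord a₁ a₂ τ - ((x - r : ℝ) : ℂ) = 0 := by
        rcases mul_eq_zero.1 h1.symm with h | h
        · exact absurd h hN.s1_ne
        · exact (mul_eq_zero.1 h).resolve_left (hlf_ne_zero _ _)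
      have h3 := congrArg Complex.re h2
      simp [← hx'] at h3
      exact hr0 h3
    · by_contra h0
      exact hnorm (eigen_norm he h0)
  obtain ⟨v, μ, hv, hvv, hvμ, hμ, hμn⟩ := key q hq0.ne' rfl
  obtain ⟨w, ν, hw, hww, hwν, hν, -⟩ := key (-q) (neg_ne_zero.2 hq0.ne') (by ring)
  rcases hE with ⟨δ, hδ⟩ | ⟨-, z, hz, hz0, κ, hκ⟩ | ⟨-, z, hz, -, huniq⟩
  · rw [hδ, Matrix.smul_mulVec, Matrix.one_mulVec] at hvμ
    have h1 : δ = μ := smul_left_injective ℂ hv hvμ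
    apply hμn
    rw [← h1]
    have h2 : herm (mat F *ᵥ (Pi.single 2 1)) (mat F *ᵥ (Pi.single 2 1)) =
        herm (Pi.single 2 1) (Pi.single 2 1) := isIsom_mat F _ _
    rw [hδ, Matrix.smul_mulVec, Matrix.one_mulVec, herm_smul_left, herm_smul_right] at h2
    apply norm_eq_one_of_mul_star
    have h3 : herm (Pi.single 2 1) (Pi.single 2 (1 : ℂ)) = -1 := by simp [herm]
    rw [h3] at h2
    linear_combination -h2
  · rw [sgn_eq_neg_one_iff] at hz
    have hzz : herm z z ≠ 0 := by intro h; simp [h] at hz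
    have h1 : herm v z = 0 := by
      apply eigen_orthogonal hvμ hκ (eigen_norm hκ hzz)
      rintro rfl
      exact hμn (eigen_norm hκ hzz)
    exact hv (eq_zero_of_orthogonal_neg hz (by rw [hvv]; simp) h1)
  · obtain ⟨d, rfl⟩ := huniq v (sgn_eq_zero_iff.2 hvv) ⟨hv, μ, hvμ⟩
    obtain ⟨e, rfl⟩ := huniq w (sgn_eq_zero_iff.2 hww) ⟨hw, ν, hwν⟩
    have hd : d ≠ 0 := by rintro rfl; simp at hv
    have he : e ≠ 0 := by rintro rfl; simp at hw
    have h1 : mat F *ᵥ z = μ • z := by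
      rw [Matrix.mulVec_smul, smul_comm] at hvμ
      exact smul_right_injective V hd hvμ
    have h2 : mat F *ᵥ z = ν • z := by
      rw [Matrix.mulVec_smul, smul_comm] at hwν
      exact smul_right_injective V he hwν
    have hz0 : z ≠ 0 := by rintro rfl; simp at hv
    have h3 : μ = ν := smul_left_injective ℂ hz0 (h1.symm.trans h2)
    rw [hμ, hν] at h3
    have h4 := mul_left_cancel₀ (hlf_ne_zero a₁ a₂) h3
    have h5 : x + q = x + -q := by exact_mod_cast h4
    linarith

theorem isEllipticOrParabolic_of_neg {F : SU21} {v : V} {μ : ℂ} (hv : (herm v v).re < 0)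
    (h : mat F *ᵥ v = μ • v) : IsEllipticOrParabolic F := by
  by_cases ht : IsTrivial F
  · exact Or.inl ht
  · refine Or.inr (Or.inl ⟨ht, v, sgn_eq_neg_one_iff.2 hv, ?_, μ, h⟩)
    rintro rfl; simp [herm_zero_left] at hv

end product

/-! ### Classes of angle pairs -/

theorem cls_angleElement_eq {θ θ' : ℝ × ℝ} (h1 : cis θ.1 = cis θ'.1) (h2 : cis θ.2 = cis θ'.2) :
    cls (angleElement θ) = cls (angleElement θ') := by
  refine cls_eq_angleElement (v₁ := Pi.single 0 1) (v₂ := Pi.single 1 1) (v₃ := Pi.single 2 1)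
    (by simp [herm]) (by simp [herm]) (by simp [herm]) (by simp [herm]) (by simp [herm])
    (by simp [herm]) (angleElement_mulVec_single θ 0 1) (angleElement_mulVec_single θ 1 1)
    (angleElement_mulVec_single θ 2 1) ?_ ?_
  · rw [angleEntries_zero]; exact congrArg _ h1
  · rw [angleEntries_one]; exact congrArg _ h2

theorem cls_angleElement_swap {θ θ' : ℝ × ℝ} (h1 : cis θ.1 = cis θ'.2) (h2 : cis θ.2 = cis θ'.1) :
    cls (angleElement θ) = cls (angleElement θ') := by
  refine cls_eq_angleElement (v₁ := Pi.single 1 1) (v₂ := Pi.single 0 1) (v₃ := Pi.single 2 1)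
    (by simp [herm]) (by simp [herm]) (by simp [herm]) (by simp [herm]) (by simp [herm])
    (by simp [herm]) (angleElement_mulVec_single θ 1 1) (angleElement_mulVec_single θ 0 1)
    (angleElement_mulVec_single θ 2 1) ?_ ?_
  · rw [angleEntries_one]; exact congrArg _ h2
  · rw [angleEntries_zero]; exact congrArg _ h1

theorem isElliptic_angleElement {θ : ℝ × ℝ} (h : cis θ.1 ≠ 1 ∨ cis θ.2 ≠ 1) :
    IsElliptic (angleElement θ) := by
  refine ⟨?_, Pi.single 2 1, by rw [sgn_eq_neg_one_iff]; simp [herm], by simp, _,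
    angleElement_mulVec_single θ 2 1⟩
  rintro ⟨δ, hδ⟩
  have h0 : angleEntries θ 2 ≠ 0 := Complex.exp_ne_zero _
  have e : ∀ i, angleEntries θ i = δ := by
    intro i
    have := congrFun (congrFun hδ i) i
    simpa [mat_angleElement] using this
  rcases h with h | h
  · apply h
    have := angleEntries_zero θ
    rw [e 0, ← e 2] at this
    exact (mul_left_cancel₀ h0 (this.symm.trans (mul_one _).symm))
  · apply h
    have := angleEntries_one θ
    rw [e 1, ← e 2] at this
    exact (mul_left_cancel₀ h0 (this.symm.trans (mul_one _).symm))

theorem isRegularElliptic_angleElement {θ : ℝ × ℝ} (h1 : cis θ.1 ≠ 1) (h2 : cis θ.2 ≠ 1)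
    (h12 : cis θ.1 ≠ cis θ.2) : IsRegularElliptic (angleElement θ) := by
  refine ⟨isElliptic_angleElement (Or.inl h1), ?_⟩
  have h0 : angleEntries θ 2 ≠ 0 := Complex.exp_ne_zero _
  have hr : (mat (angleElement θ)).charpoly.roots =
      {angleEntries θ 0, angleEntries θ 1, angleEntries θ 2} := by
    rw [mat_angleElement, Matrix.charpoly_diagonal,
      ← Polynomial.roots_multiset_prod_X_sub_C
        ({angleEntries θ 0, angleEntries θ 1, angleEntries θ 2} : Multiset ℂ)]
    congr 1
  rw [hr]
  have k01 : angleEntries θ 0 ≠ angleEntries θ 1 := by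
    rw [angleEntries_zero, angleEntries_one]; exact fun h => h12 (mul_left_cancel₀ h0 h)
  have k02 : angleEntries θ 0 ≠ angleEntries θ 2 := by
    rw [angleEntries_zero]
    exact fun h => h1 (mul_left_cancel₀ h0 (h.trans (mul_one _).symm))
  have k12 : angleEntries θ 1 ≠ angleEntries θ 2 := by
    rw [angleEntries_one]
    exact fun h => h2 (mul_left_cancel₀ h0 (h.trans (mul_one _).symm))
  simp [k01, k02, k12]

theorem isSpecialElliptic_angleElement {θ : ℝ} (h : cis θ ≠ 1) :
    IsSpecialElliptic 1 (angleElement (θ, 0)) := by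
  -- The entries are `e^{2iθ/3}, e^{-iθ/3}, e^{-iθ/3}`: the repeated one is the parameter and the
  -- first one is its power `-2`.
  refine ⟨cis (-(θ / 3)), Pi.single 0 1, norm_cis _, ?_, ?_, ?_, ?_⟩
  · rw [← cis_nat_mul]
    intro h'
    apply h
    have : cis (-θ) = 1 := by rw [← h']; congr 1; push_cast; ring
    rw [cis_neg, inv_eq_one] at this
    exact this
  · simp [sgn, herm]
  · simp [sgn, herm]
  · intro x
    rw [mat_angleElement]
    have e0 : angleEntries (θ, 0) 0 = (cis (-(θ / 3)) ^ 2)⁻¹ := by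
      rw [← cis_nat_mul, ← cis_neg, angleEntries, Matrix.cons_val_zero, cis]
      congr 3; push_cast; ring
    have e1 : angleEntries (θ, 0) 1 = cis (-(θ / 3)) := by
      rw [angleEntries, Matrix.cons_val_one, Matrix.cons_val_zero, cis]
      congr 3; push_cast; ring
    have e2 : angleEntries (θ, 0) 2 = cis (-(θ / 3)) := by
      rw [angleEntries_two, cis]
      congr 3; push_cast; ring
    ext i
    rw [Matrix.mulVec_diagonal]
    fin_cases i
    · simp [R, herm, e0]; ring
    · simp [R, herm, e1]
    · simp [R, herm, e2]

section product

variable {p₁ p₂ : V} {s₁ s₂ g a₁ a₂ : ℝ} {F : SU21}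

theorem cis_ne_cis_neg {φ : ℝ} (h : Real.sin φ ≠ 0) : cis φ ≠ cis (-φ) := by
  intro h'
  have := congrArg Complex.im h'
  rw [cis_im, cis_im, Real.sin_neg] at this
  exact h (by linarith)

/-- The three eigenvectors of a product. -/
theorem eigv_orthogonal (hN : NormalPair p₁ p₂ s₁ s₂ g)
    (hF : IsProduct (cis a₁) (cis a₂) p₁ p₂ F) {τ : ℝ} (hτ : τ = s₁ * s₂ * g ^ 2) {φ : ℝ}
    (hφ : Real.cos φ = (chord a₁ a₂ τ).re) :
    mat F *ᵥ eigv a₁ a₂ p₁ p₂ s₂ g (cis (-φ)) =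
      (hlf a₁ a₂ * cis φ) • eigv a₁ a₂ p₁ p₂ s₂ g (cis (-φ)) := by
  refine eigv_eigen hN hF hτ (by rw [← star_cis, cis_mul_star]) ?_
  rw [← star_cis, Complex.star_def, Complex.add_conj, Complex.add_conj, cis_re, hφ]

theorem hlf_mul_cis (a₁ a₂ t : ℝ) : hlf a₁ a₂ * cis t = cis (t - (a₁ + a₂) / 2) := by
  rw [hlf, ← cis_add]; congr 1; ring

/-- Centers spanning a hyperbolic line, elliptic product. -/
theorem cls_of_hyperbolic (hN : NormalPair p₁ p₂ s₁ s₂ g)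
    (hF : IsProduct (cis a₁) (cis a₂) p₁ p₂ F) {τ : ℝ} (hτ : τ = s₁ * s₂ * g ^ 2)
    (hW : s₁ * s₂ * (1 - τ) < 0) {φ : ℝ} (hφ : Real.cos φ = (chord a₁ a₂ τ).re)
    (hy : Real.sin φ ^ 2 < (chord a₁ a₂ τ).im ^ 2)
    (hs : 0 < s₁ * Real.sin φ * (chord a₁ a₂ τ).im) {θ : ℝ × ℝ}
    (h1 : cis θ.1 = cis (3 * (a₁ + a₂) / 2 + φ)) (h2 : cis θ.2 = cis (2 * φ)) :
    IsEllipticOrParabolic F ∧ cls F = cls (angleElement θ) := by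
  set y := (chord a₁ a₂ τ).im
  set S := Real.sin φ
  have hS : S ≠ 0 := by intro h; rw [h] at hs; simp at hs
  have hφ' : Real.cos (-φ) = (chord a₁ a₂ τ).re := by rw [Real.cos_neg, hφ]
  have hv := eigv_orthogonal hN hF hτ hφ
  have hu := eigv_orthogonal hN hF hτ hφ'
  have hvv := herm_eigv_eigv hN hF hτ hφ
  have huu := herm_eigv_eigv hN hF hτ hφ'
  rw [Real.sin_neg] at huu
  set v := eigv a₁ a₂ p₁ p₂ s₂ g (cis (-φ))
  set u := eigv a₁ a₂ p₁ p₂ s₂ g (cis (- -φ))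
  have hvc : herm v (cross p₁ p₂) = 0 := herm_eigv_cross _
  have huc : herm u (cross p₁ p₂) = 0 := herm_eigv_cross _
  have hvu : herm v u = 0 := by
    refine eigen_orthogonal hv hu (by rw [norm_mul, norm_hlf, norm_cis, one_mul]) ?_
    exact fun h => cis_ne_cis_neg hS (mul_left_cancel₀ (hlf_ne_zero _ _) h)
  have hs1 : s₁ = 1 ∨ s₁ = -1 := by
    have : (s₁ - 1) * (s₁ + 1) = 0 := by linear_combination hN.sq1
    rcases mul_eq_zero.1 this with h | h
    · exact Or.inl (by linarith)
    · exact Or.inr (by linarith)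
  -- As `|S| < |y|` and `s₁Sy > 0`, the term with `y` dominates both squares: `v` is positive and
  -- `u` is negative.
  have hSy : S ^ 2 < s₁ * S * y := by
    have h2 : 0 < S ^ 2 := by positivity
    refine lt_of_pow_lt_pow_left₀ 2 hs.le ?_
    have : (s₁ * S * y) ^ 2 = S ^ 2 * y ^ 2 := by rw [mul_pow, mul_pow, hN.sq1, one_mul]
    rw [this]
    nlinarith
  have p1 : 0 < (herm v v).re := by
    rw [hvv, Complex.ofReal_re]
    change 0 < 2 * s₁ * S * (S + y)
    rcases hs1 with h | h <;> rw [h] at hSy ⊢ <;> nlinarith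
  have p2 : (herm u u).re < 0 := by
    rw [huu, Complex.ofReal_re]
    change 2 * s₁ * -S * (-S + y) < 0
    rcases hs1 with h | h <;> rw [h] at hSy ⊢ <;> nlinarith
  have p3 : 0 < (herm (cross p₁ p₂) (cross p₁ p₂)).re := by
    rw [hN.herm_cross, Complex.ofReal_re]
    have h3 : s₁ * s₂ * (s₁ * s₂) = 1 := by nlinarith [hN.sq1, hN.sq2]
    rw [hτ] at hW
    have : s₁ * s₂ * (1 - s₁ * s₂ * g ^ 2) = s₁ * s₂ - g ^ 2 := by
      linear_combination (-g ^ 2) * h3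
    rw [this] at hW
    linarith
  refine ⟨isEllipticOrParabolic_of_neg p2 hu, ?_⟩
  -- The negative eigenvalue is `he^{-iφ}`, and the angles are the arguments of `he^{iΣ}` and
  -- `he^{iφ}` relative to it.
  refine cls_eq_angleElement p3 p1 p2 (herm_eq_zero_comm.1 hvc) (herm_eq_zero_comm.1 huc) hvu
    (product_cross hF) hv hu ?_ ?_
  · change _ = _ * cis θ.1
    rw [h1, hlf_mul_cis, ← cis_add, ← cis_add]; congr 1; ring
  · change _ = _ * cis θ.2
    rw [h2, hlf_mul_cis, hlf_mul_cis, ← cis_add]; congr 1; ring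

/-- Positive centers spanning a positive line, generic case. -/
theorem cls_of_definite (hN : NormalPair p₁ p₂ 1 1 g)
    (hF : IsProduct (cis a₁) (cis a₂) p₁ p₂ F) (hg : g ^ 2 < 1) {φ : ℝ}
    (hφ : Real.cos φ = (chord a₁ a₂ (g ^ 2)).re) (hS : Real.sin φ ≠ 0)
    (hy : (chord a₁ a₂ (g ^ 2)).im ^ 2 < Real.sin φ ^ 2) {θ : ℝ × ℝ}
    (h1 : cis θ.1 = cis (-(3 * (a₁ + a₂) / 2) + φ))
    (h2 : cis θ.2 = cis (-(3 * (a₁ + a₂) / 2) - φ)) :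
    IsEllipticOrParabolic F ∧ cls F = cls (angleElement θ) := by
  have hτ : g ^ 2 = 1 * 1 * g ^ 2 := by ring
  set y := (chord a₁ a₂ (g ^ 2)).im
  set S := Real.sin φ
  have hφ' : Real.cos (-φ) = (chord a₁ a₂ (g ^ 2)).re := by rw [Real.cos_neg, hφ]
  have hv := eigv_orthogonal hN hF hτ hφ
  have hu := eigv_orthogonal hN hF hτ hφ'
  have hvv := herm_eigv_eigv hN hF hτ hφ
  have huu := herm_eigv_eigv hN hF hτ hφ'
  rw [Real.sin_neg] at huu
  set v := eigv a₁ a₂ p₁ p₂ 1 g (cis (-φ))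
  set u := eigv a₁ a₂ p₁ p₂ 1 g (cis (- -φ))
  have hvc : herm v (cross p₁ p₂) = 0 := herm_eigv_cross _
  have huc : herm u (cross p₁ p₂) = 0 := herm_eigv_cross _
  have hvu : herm v u = 0 := by
    refine eigen_orthogonal hv hu (by rw [norm_mul, norm_hlf, norm_cis, one_mul]) ?_
    exact fun h => cis_ne_cis_neg hS (mul_left_cancel₀ (hlf_ne_zero _ _) h)
  have hS2 : 0 < S ^ 2 := by positivity
  -- Here the term `S²` dominates, so both eigenvectors in the span are positive and the angles are
  -- measured from the eigenvalue `he^{iΣ}` of the complement.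
  have hSy : |S * y| < S ^ 2 := by
    refine lt_of_pow_lt_pow_left₀ 2 hS2.le ?_
    rw [sq_abs]
    nlinarith
  obtain ⟨b1, b2⟩ := abs_lt.1 hSy
  have p1 : 0 < (herm v v).re := by
    rw [hvv, Complex.ofReal_re]
    change 0 < 2 * 1 * S * (S + y)
    nlinarith
  have p2 : 0 < (herm u u).re := by
    rw [huu, Complex.ofReal_re]
    change 0 < 2 * 1 * -S * (-S + y)
    nlinarith
  have p3 : (herm (cross p₁ p₂) (cross p₁ p₂)).re < 0 := by
    rw [hN.herm_cross, Complex.ofReal_re]; linarith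
  refine ⟨isEllipticOrParabolic_of_neg p3 (product_cross hF), ?_⟩
  refine cls_eq_angleElement p1 p2 p3 hvu hvc huc hv hu (product_cross hF) ?_ ?_
  · change _ = _ * cis θ.1
    rw [h1, hlf_mul_cis, ← cis_add, ← cis_add]; congr 1; ring
  · change _ = _ * cis θ.2
    rw [h2, hlf_mul_cis, ← cis_add, ← cis_add]; congr 1; ring

/-- Orthogonal centers are eigenvectors. -/
theorem product_of_orthogonal (hN : NormalPair p₁ p₂ s₁ s₂ 0)
    (hF : IsProduct (cis a₁) (cis a₂) p₁ p₂ F) :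
    mat F *ᵥ p₁ = cis (a₂ - 2 * a₁) • p₁ ∧ mat F *ᵥ p₂ = cis (a₁ - 2 * a₂) • p₂ := by
  have e : ∀ a : ℝ, cis (2 * a) = cis a ^ 2 := fun a => by
    rw [← cis_nat_mul]; norm_num
  constructor
  · rw [product_first hN hF, cis_sub, e, div_eq_mul_inv, mul_comm (cis a₂)]; simp
  · rw [product_second hN hF, cis_sub, e, div_eq_mul_inv]; simp

/-- Orthogonal positive centers. -/
theorem cls_of_orthogonal_pos (hN : NormalPair p₁ p₂ 1 1 0)
    (hF : IsProduct (cis a₁) (cis a₂) p₁ p₂ F) {θ : ℝ × ℝ}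
    (h1 : cis θ.1 = cis (-(3 * a₁))) (h2 : cis θ.2 = cis (-(3 * a₂))) :
    IsEllipticOrParabolic F ∧ cls F = cls (angleElement θ) := by
  obtain ⟨e1, e2⟩ := product_of_orthogonal hN hF
  have p3 : (herm (cross p₁ p₂) (cross p₁ p₂)).re < 0 := by
    rw [hN.herm_cross, Complex.ofReal_re]; norm_num
  refine ⟨isEllipticOrParabolic_of_neg p3 (product_cross hF), ?_⟩
  refine cls_eq_angleElement (by rw [hN.h11]; norm_num) (by rw [hN.h22]; norm_num) p3
    (by rw [hN.h12]; simp) (herm_cross_left _ _) (herm_cross_right _ _) e1 e2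
    (product_cross hF) ?_ ?_
  · change _ = _ * cis θ.1
    rw [h1, ← cis_add, ← cis_add]; congr 1; ring
  · change _ = _ * cis θ.2
    rw [h2, ← cis_add, ← cis_add]; congr 1; ring

/-- Orthogonal centers of different signature. -/
theorem cls_of_orthogonal_mixed (hN : NormalPair p₁ p₂ 1 (-1) 0)
    (hF : IsProduct (cis a₁) (cis a₂) p₁ p₂ F) {θ : ℝ × ℝ}
    (h1 : cis θ.1 = cis (3 * a₂)) (h2 : cis θ.2 = cis (3 * (a₂ - a₁))) :
    IsEllipticOrParabolic F ∧ cls F = cls (angleElement θ) := by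
  obtain ⟨e1, e2⟩ := product_of_orthogonal hN hF
  have p2 : (herm p₂ p₂).re < 0 := by rw [hN.h22]; norm_num
  have p3 : 0 < (herm (cross p₁ p₂) (cross p₁ p₂)).re := by
    rw [hN.herm_cross, Complex.ofReal_re]; norm_num
  refine ⟨isEllipticOrParabolic_of_neg p2 e2, ?_⟩
  refine cls_eq_angleElement p3 (by rw [hN.h11]; norm_num) p2
    (herm_eq_zero_comm.1 (herm_cross_left _ _)) (herm_eq_zero_comm.1 (herm_cross_right _ _))
    (by rw [hN.h12]; simp) (product_cross hF) e1 e2 ?_ ?_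
  · change _ = _ * cis θ.1
    rw [h1, ← cis_add, ← cis_add]; congr 1; ring
  · change _ = _ * cis θ.2
    rw [h2, ← cis_add]; congr 1; ring

/-- If `(F - c)³ = 0`, then `c` is the only eigenvalue. -/
theorem eq_of_pow_eq_zero {c : ℂ} (h : (mat F - c • (1 : Matrix (Fin 3) (Fin 3) ℂ)) ^ 3 = 0)
    {v : V} {μ : ℂ} (hv : v ≠ 0) (e : mat F *ᵥ v = μ • v) : μ = c := by
  have e1 : (mat F - c • (1 : Matrix (Fin 3) (Fin 3) ℂ)) *ᵥ v = (μ - c) • v := by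
    rw [Matrix.sub_mulVec, e, Matrix.smul_mulVec, Matrix.one_mulVec, sub_smul]
  have e3 : ((mat F - c • (1 : Matrix (Fin 3) (Fin 3) ℂ)) ^ 3) *ᵥ v = (μ - c) ^ 3 • v := by
    rw [pow_succ, pow_two, ← Matrix.mulVec_mulVec, ← Matrix.mulVec_mulVec, e1, Matrix.mulVec_smul,
      e1, Matrix.mulVec_smul, Matrix.mulVec_smul, e1, smul_smul, smul_smul]
    congr 1; ring
  rw [h, Matrix.zero_mulVec] at e3
  have := (smul_eq_zero.1 e3.symm).resolve_right hv
  exact sub_eq_zero.1 (pow_eq_zero_iff (by norm_num) |>.1 this)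

/-- Centers spanning a hyperbolic line, boundary case. -/
theorem isElliptoParabolic_of_hyperbolic (hN : NormalPair p₁ p₂ s₁ s₂ g)
    (hF : IsProduct (cis a₁) (cis a₂) p₁ p₂ F) {τ : ℝ} (hτ : τ = s₁ * s₂ * g ^ 2)
    (hτ1 : τ ≠ 1) {ε : ℝ} (hε : ε ^ 2 = 1) (hx : (chord a₁ a₂ τ).re = ε)
    (hy : (chord a₁ a₂ τ).im ≠ 0)
    (hne : hlf a₁ a₂ * ε ≠ cis a₁ * cis a₂) : IsElliptoParabolic F := by
  have hε' : (ε : ℂ) * ε = 1 := by rw [← sq]; exact_mod_cast hε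
  have he := eigv_eigen hN hF hτ hε' (by
    rw [Complex.star_def, Complex.add_conj, hx]; push_cast; ring)
  set μ := hlf a₁ a₂ * ε
  have hμ : ‖μ‖ = 1 := by
    rw [norm_mul, norm_hlf, one_mul, Complex.norm_real, Real.norm_eq_abs,
      ← sq_eq_sq₀ (abs_nonneg _) zero_le_one, sq_abs, hε]; norm_num
  have hv0 : eigv a₁ a₂ p₁ p₂ s₂ g ε ≠ 0 := by
    intro h0
    have h1 := herm_eigv_first (a₁ := a₁) (a₂ := a₂) hN hτ (ε : ℂ)
    rw [h0, herm_zero_left] at h1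
    have h2 : chord a₁ a₂ τ - (ε : ℂ) = 0 := by
      rcases mul_eq_zero.1 h1.symm with h | h
      · exact absurd h hN.s1_ne
      · exact (mul_eq_zero.1 h).resolve_left (hlf_ne_zero _ _)
    have h3 := congrArg Complex.im h2
    simp at h3
    exact hy h3
  -- The eigenvector is `(F-μ)p₁`, an element of the image of `F-μ`, and is therefore orthogonal to
  -- all eigenvectors for `μ`. It is one of them itself, hence isotropic.
  have horth : ∀ z, mat F *ᵥ z = μ • z → herm (eigv a₁ a₂ p₁ p₂ s₂ g ε) z = 0 := by
    intro z hz
    rw [eigv_eq hN hF, herm_sub_left, herm_sub_eigen hμ hz, herm_smul_left]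
    ring
  set v := eigv a₁ a₂ p₁ p₂ s₂ g ε with hv
  have hvv := horth v he
  have hc0 : cross p₁ p₂ ≠ 0 := by
    intro h
    have := hN.herm_cross
    rw [h, herm_zero_left] at this
    have h4 : s₁ * s₂ - g ^ 2 = 0 := by
      have : -(s₁ * s₂ - g ^ 2) = 0 := by exact_mod_cast this.symm
      linarith
    apply hτ1
    rw [hτ, ← sub_eq_zero.1 h4]
    have := hN.sq1; have := hN.sq2
    calc s₁ * s₂ * (s₁ * s₂) = s₁ ^ 2 * s₂ ^ 2 := by ring
      _ = 1 := by rw [hN.sq1, hN.sq2, one_mul]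
  refine ⟨⟨?_, v, sgn_eq_zero_iff.2 hvv, ⟨hv0, μ, he⟩, ?_⟩, ?_⟩
  · rintro ⟨δ, hδ⟩
    have h1 := he
    have h2 := product_cross hF
    rw [hδ, Matrix.smul_mulVec, Matrix.one_mulVec] at h1 h2
    exact hne ((smul_left_injective ℂ hv0 h1).symm.trans (smul_left_injective ℂ hc0 h2))
  · rintro w hw ⟨hw0, ν, hwν⟩
    rw [sgn_eq_zero_iff] at hw
    -- An isotropic fixed vector is orthogonal to `v`, by `horth` if its eigenvalue is `μ` and by
    -- distinctness of eigenvalues otherwise.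
    apply proportional_of_orthogonal hv0 (by rw [hvv]; simp) (by rw [hw]; simp)
    by_contra h0
    apply h0
    have h1 : ν = μ := by
      by_contra hn
      exact h0 (eigen_orthogonal hwν he hμ hn)
    exact herm_eq_zero_comm.1 (horth w (h1 ▸ hwν))
  · rintro ⟨c, hc⟩
    exact hne ((eq_of_pow_eq_zero hc hv0 he).trans
      (eq_of_pow_eq_zero hc hc0 (product_cross hF)).symm)

end product

/-! ### Tangent centers -/

theorem R_mul (α₁ α₂ : ℂ) {p : V} (hp : herm p p ≠ 0) (x : V) :
    R α₂ p (R α₁ p x) = R (α₁ * α₂) p x := by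
  simp only [R, herm_add_left, herm_smul_left, add_div, mul_div_assoc, div_self hp, mul_inv,
    mul_pow]
  module

theorem isSpecialElliptic_of_self {α₁ α₂ : ℂ} (h₁ : ‖α₁‖ = 1) (h₂ : ‖α₂‖ = 1)
    (h3 : (α₁ * α₂) ^ 3 ≠ 1) {p : V} {σ : SignType} (hp : sgn p ≠ 0) (hσ : sgn p = σ) {F : SU21}
    (hF : IsProduct α₁ α₂ p p F) : IsSpecialElliptic σ F :=
  ⟨α₁ * α₂, p, by rw [norm_mul, h₁, h₂, one_mul], h3, hp, hσ, fun x => by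
    rw [hF x, R_mul _ _ (herm_self_ne_zero_of_sgn hp)]⟩

theorem cls_eq_one_of_self {α₁ α₂ : ℂ} (h3 : (α₁ * α₂) ^ 3 = 1) {p : V} (hp : herm p p ≠ 0)
    {F : SU21} (hF : IsProduct α₁ α₂ p p F) : cls F = cls 1 := by
  have h0 : α₁ * α₂ ≠ 0 := by intro h; rw [h] at h3; norm_num at h3
  refine cls_eq_of_smul (δ := α₁ * α₂) (eq_of_mulVec fun x => ?_)
  have key : ∀ d : ℂ, d ≠ 0 → d ^ 3 = 1 → (d ^ 2)⁻¹ - d = 0 := by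
    intro d hd h; field_simp; linear_combination -h
  have := key _ h0 h3
  rw [hF x, R_mul _ _ hp, R, this, mat_one, Matrix.smul_mulVec, Matrix.one_mulVec]
  simp

/-- Products of special elliptic isometries with the same center. -/
theorem cls_eq_of_self {α₁ α₂ : ℂ} {p q : V} {s : ℝ} (hs : s ^ 2 = 1) (hp : herm p p = s)
    (hq : herm q q = s) {F G : SU21} (hF : IsProduct α₁ α₂ p p F) (hG : IsProduct α₁ α₂ q q G) :
    cls F = cls G := by
  obtain ⟨A, hA, k, hk, h⟩ := exists_isom_map_smul hs hp hq
  exact hF.cls_eq hk hk hG hA h h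

section tangent

variable {p₁ p₂ : V} {a₁ a₂ : ℝ} {F : SU21}

/-- The sum `p₁ + p₂` is isotropic and orthogonal to the negative `p₁`, so it is zero. Negative
centers with degenerate Gram matrix thus coincide. -/
theorem NormalPair.eq_neg_of_tangent (hN : NormalPair p₁ p₂ (-1) (-1) 1) : p₁ = -p₂ := by
  rw [eq_neg_iff_add_eq_zero]
  apply eq_zero_of_orthogonal_neg (v := p₁) (by rw [hN.h11]; norm_num)
  · simp only [herm_add_left, herm_add_right, hN.h11, hN.h12, hN.h21, hN.h22]; norm_num
  · simp only [herm_add_left, hN.h11, hN.h21]; norm_num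

theorem NormalPair.isotropic_sub (hN : NormalPair p₁ p₂ 1 1 1) :
    herm (p₁ - p₂) (p₁ - p₂) = 0 ∧ herm (p₁ - p₂) p₁ = 0 ∧ herm (p₁ - p₂) p₂ = 0 := by
  simp only [herm_sub_left, herm_sub_right, hN.h11, hN.h12, hN.h21, hN.h22]; norm_num

/-- The difference `n = p₁ - p₂` spans the radical of the degenerate span, so `cross` cannot
complete the pair to a frame. An isotropic vector orthogonal to `p₁` and dual to `n` does. -/
theorem NormalPair.exists_dual (hN : NormalPair p₁ p₂ 1 1 1) (hne : p₁ ≠ p₂) :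
    ∃ w, herm w p₁ = 0 ∧ herm w p₂ = -1 ∧ herm w w = 0 := by
  obtain ⟨hnn, hn1, hn2⟩ := hN.isotropic_sub
  set n := p₁ - p₂ with hn
  have hn0 : n ≠ 0 := sub_ne_zero.2 hne
  have h1n := herm_eq_zero_comm.1 hn1
  -- Flipping the last sign turns `⟨z,n⟩` into the Euclidean square of `n`, which is positive.
  set z : V := ![n 0, n 1, -n 2] with hz
  set r : ℝ := ‖n 0‖ ^ 2 + ‖n 1‖ ^ 2 + ‖n 2‖ ^ 2 with hr
  have hzn : herm z n = r := by
    simp only [herm, hz, Matrix.cons_val_zero, Matrix.cons_val_one, Matrix.cons_val,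
      Complex.star_def, neg_mul, Complex.mul_conj, Complex.normSq_eq_norm_sq, hr]
    push_cast; ring
  have hr0 : (r : ℂ) ≠ 0 := by
    norm_cast
    intro h0
    have h2 : ‖n 2‖ ^ 2 = 0 := by
      have := sq_nonneg ‖n 0‖; have := sq_nonneg ‖n 1‖; have := sq_nonneg ‖n 2‖; linarith
    exact last_ne_zero hn0 (by rw [hnn]; simp) (by simpa using h2)
  have h11 : herm p₁ p₁ = 1 := by rw [hN.h11]; simp
  set w₁ : V := (r : ℂ)⁻¹ • (z - herm z p₁ • p₁) with hw1
  have e1 : herm w₁ p₁ = 0 := by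
    rw [hw1, herm_smul_left, herm_sub_left, herm_smul_left, h11]; ring
  have e2 : herm w₁ n = 1 := by
    rw [hw1, herm_smul_left, herm_sub_left, herm_smul_left, h1n, hzn, mul_zero, sub_zero,
      inv_mul_cancel₀ hr0]
  have e2' : herm n w₁ = 1 := by rw [← star_herm, e2, star_one]
  -- Since `⟨w₁,n⟩ = 1` and `n` is isotropic and orthogonal to `p₁`, this correction kills the
  -- square and keeps the products with `p₁` and `n`.
  set w : V := w₁ - (herm w₁ w₁ / 2) • n with hw
  have f1 : herm w p₁ = 0 := by rw [hw, herm_sub_left, e1, herm_smul_left, hn1]; ring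
  have f2 : herm w n = 1 := by rw [hw, herm_sub_left, e2, herm_smul_left, hnn]; ring
  refine ⟨w, f1, ?_, ?_⟩
  · have : p₂ = p₁ - n := by rw [hn]; abel
    rw [this, herm_sub_right, f1, f2]; ring
  · rw [hw]
    simp only [herm_sub_left, herm_sub_right, herm_smul_left, herm_smul_right, hnn, e2, e2',
      star_div₀, star_herm]
    simp
    ring

/-- Two tangent pairs of distinct positive centers yield the same class. -/
theorem NormalPair.cls_eq_tangent {q₁ q₂ : V} (hp : NormalPair p₁ p₂ 1 1 1) (hpne : p₁ ≠ p₂)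
    (hq : NormalPair q₁ q₂ 1 1 1) (hqne : q₁ ≠ q₂) {α₁ α₂ : ℂ} {F G : SU21}
    (hF : IsProduct α₁ α₂ p₁ p₂ F) (hG : IsProduct α₁ α₂ q₁ q₂ G) : cls F = cls G := by
  obtain ⟨w, w1, w2, ww⟩ := hp.exists_dual hpne
  obtain ⟨z, z1, z2, zz⟩ := hq.exists_dual hqne
  have w2' : herm p₂ w = -1 := by rw [← star_herm, w2]; simp
  have z2' : herm q₂ z = -1 := by rw [← star_herm, z2]; simp
  have w1' := herm_eq_zero_comm.1 w1
  have z1' := herm_eq_zero_comm.1 z1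
  obtain ⟨A, hA, hAp⟩ := exists_isom_of_gram (p := ![p₁, p₂, w]) (q := ![q₁, q₂, z]) (by
      intro i j
      fin_cases i <;> fin_cases j <;>
      simp [hp.h11, hp.h22, hp.h12, hp.h21, hq.h11, hq.h22, hq.h12, hq.h21, w1, w2, ww, z1, z2,
        zz, w1', z1', w2', z2']) (by
      rw [Matrix.det_fin_three]
      simp [hp.h11, hp.h22, hp.h12, hp.h21, w1, w2, ww, w1', w2'])
  refine hF.cls_eq (k₁ := 1) (k₂ := 1) one_ne_zero one_ne_zero hG hA ?_ ?_
  · rw [one_smul]; exact hAp 0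
  · rw [one_smul]; exact hAp 1

theorem product_tangent (hN : NormalPair p₁ p₂ 1 1 1)
    (hF : IsProduct (cis a₁) (cis a₂) p₁ p₂ F) (x : V) :
    mat F *ᵥ x = (cis a₁ * cis a₂) • x + (cis a₂ * bet (cis a₁) * herm x p₁) • p₁ +
      (bet (cis a₂) * (cis a₁ * herm x p₂ + bet (cis a₁) * herm x p₁)) • p₂ := by
  rw [hF x, R, R, herm_add_left, herm_smul_left, herm_smul_left, hN.h11, hN.h12, hN.h22, bet, bet]
  simp only [Complex.ofReal_one, div_one]
  module

theorem tangent_independent (hN : NormalPair p₁ p₂ 1 1 1) (hne : p₁ ≠ p₂) {a b : ℂ}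
    (h : a • p₁ + b • p₂ = 0) : a = 0 ∧ b = 0 := by
  obtain ⟨w, w1, w2, -⟩ := hN.exists_dual hne
  have h1 := congrArg (fun x => herm x w) h
  have h2 := congrArg (fun x => herm x p₁) h
  have w1' : herm p₁ w = 0 := herm_eq_zero_comm.1 w1
  have w2' : herm p₂ w = -1 := by rw [← star_herm, w2]; simp
  simp only [herm_add_left, herm_smul_left, herm_zero_left, w1', w2', hN.h11, hN.h21] at h1 h2
  have hb : b = 0 := by linear_combination -h1
  rw [hb] at h2
  simp at h2
  exact ⟨h2, hb⟩

/-- The centers are independent and both `bet` factors nonzero, so the eigenvectors for `α₁α₂` are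
exactly the vectors orthogonal to both centers; `p₁ - p₂` is one of them. Any isotropic fixed vector
is orthogonal to `p₁ - p₂`, hence proportional to it. -/
theorem isParabolic_tangent (hN : NormalPair p₁ p₂ 1 1 1) (hne : p₁ ≠ p₂)
    (hF : IsProduct (cis a₁) (cis a₂) p₁ p₂ F) (hb₁ : bet (cis a₁) ≠ 0)
    (hb₂ : bet (cis a₂) ≠ 0) : IsParabolic F := by
  obtain ⟨hnn, hn1, hn2⟩ := hN.isotropic_sub
  have hn0 : p₁ - p₂ ≠ 0 := sub_ne_zero.2 hne
  have hμ : ‖cis a₁ * cis a₂‖ = 1 := by rw [norm_mul, norm_cis, norm_cis, one_mul]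
  have hFn : mat F *ᵥ (p₁ - p₂) = (cis a₁ * cis a₂) • (p₁ - p₂) := by
    rw [product_tangent hN hF, hn1, hn2]; simp
  have hpolar : ∀ w, mat F *ᵥ w = (cis a₁ * cis a₂) • w → herm w p₁ = 0 ∧ herm w p₂ = 0 := by
    intro w hw
    rw [product_tangent hN hF, add_assoc, add_eq_left] at hw
    obtain ⟨h1, h2⟩ := tangent_independent hN hne hw
    have k1 : herm w p₁ = 0 := by
      simpa [cis_ne_zero, hb₁] using h1
    rw [k1] at h2
    refine ⟨k1, ?_⟩
    simpa [cis_ne_zero, hb₂] using h2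
  refine ⟨?_, p₁ - p₂, sgn_eq_zero_iff.2 hnn, ⟨hn0, _, hFn⟩, ?_⟩
  · rintro ⟨δ, hδ⟩
    have h1 := hFn
    rw [hδ, Matrix.smul_mulVec, Matrix.one_mulVec] at h1
    have h2 := smul_left_injective ℂ hn0 h1
    have h3 := (hpolar p₁ (by rw [hδ, Matrix.smul_mulVec, Matrix.one_mulVec]; exact congrArg (· • p₁) h2)).1
    exact hN.ne1 h3
  · rintro w hw ⟨hw0, ν, hwν⟩
    rw [sgn_eq_zero_iff] at hw
    apply proportional_of_orthogonal hn0 (by rw [hnn]; simp) (by rw [hw]; simp)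
    by_contra h0
    apply h0
    have h1 : ν = cis a₁ * cis a₂ := by
      by_contra hn
      exact h0 (eigen_orthogonal hwν hFn hμ hn)
    obtain ⟨k1, k2⟩ := hpolar w (h1 ▸ hwν)
    rw [herm_sub_right, k1, k2, sub_zero]

theorem isElliptoParabolic_tangent (hN : NormalPair p₁ p₂ 1 1 1) (hne : p₁ ≠ p₂)
    (hF : IsProduct (cis a₁) (cis a₂) p₁ p₂ F) (hb₁ : bet (cis a₁) ≠ 0)
    (hb₂ : bet (cis a₂) ≠ 0) (h3 : (cis a₁ * cis a₂) ^ 3 ≠ 1) : IsElliptoParabolic F := by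
  refine ⟨isParabolic_tangent hN hne hF hb₁ hb₂, ?_⟩
  rintro ⟨c, hc⟩
  obtain ⟨-, hn1, hn2⟩ := hN.isotropic_sub
  have hFn : mat F *ᵥ (p₁ - p₂) = (cis a₁ * cis a₂) • (p₁ - p₂) := by
    rw [product_tangent hN hF, hn1, hn2]; simp
  have hc1 := eq_of_pow_eq_zero hc (sub_ne_zero.2 hne) hFn
  -- The map `F - α₁α₂` sends each of `p₁`, `p₂` to the same vector `Ap₁ + Bp₂`. This vector is an
  -- eigenvector for `α₁α₂ + A + B = (α₁α₂)⁻²`, and that eigenvalue differs from `α₁α₂` when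
  -- `(α₁α₂)³ ≠ 1`.
  set A := cis a₂ * bet (cis a₁)
  set B := bet (cis a₂) * (cis a₁ + bet (cis a₁))
  have e1 := cis_ne_zero a₁
  have e2 := cis_ne_zero a₂
  have hAB : cis a₁ * cis a₂ + A + B = ((cis a₁ * cis a₂) ^ 2)⁻¹ := by
    simp only [A, B, bet]; field_simp; ring
  have hz : mat F *ᵥ (A • p₁ + B • p₂) = ((cis a₁ * cis a₂) ^ 2)⁻¹ • (A • p₁ + B • p₂) := by
    rw [product_tangent hN hF, ← hAB]
    simp only [herm_add_left, herm_smul_left, hN.h11, hN.h12, hN.h21, hN.h22, Complex.ofReal_one,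
      mul_one]
    simp only [A, B]
    module
  have hz0 : A • p₁ + B • p₂ ≠ 0 := by
    intro h
    exact mul_ne_zero e2 hb₁ (tangent_independent hN hne h).1
  have hc2 := eq_of_pow_eq_zero hc hz0 hz
  have h0 := mul_ne_zero e1 e2
  apply h3
  rw [← hc2] at hc1
  field_simp at hc1
  rw [mul_pow]
  linear_combination hc1

/-- The lift `G = δ⁻¹F` is unipotent: `G - 1` sends the space into the span of the centers, the span
into the line of `p₁ - p₂` because now `A + B = 0`, and that line to zero. The square is nonzero on
the dual vector orthogonal to `p₁`. -/
theorem exists_threeStep_tangent (hN : NormalPair p₁ p₂ 1 1 1) (hne : p₁ ≠ p₂)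
    (hF : IsProduct (cis a₁) (cis a₂) p₁ p₂ F) (hb₁ : bet (cis a₁) ≠ 0)
    (hb₂ : bet (cis a₂) ≠ 0) (h3 : (cis a₁ * cis a₂) ^ 3 = 1) :
    cls F ∈ classesOf IsThreeStepUnipotent := by
  set δ := cis a₁ * cis a₂ with hδ
  have e1 := cis_ne_zero a₁
  have e2 := cis_ne_zero a₂
  have hδ0 : δ ≠ 0 := mul_ne_zero e1 e2
  have hδn : δ⁻¹ * star δ⁻¹ = 1 := mul_star_of_norm (by
    rw [norm_inv, hδ, norm_mul, norm_cis, norm_cis, one_mul, inv_one])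
  let G : SU21 := ⟨⟨δ⁻¹ • mat F, by
    rw [Matrix.det_smul, det_mat, Fintype.card_fin, inv_pow, h3]; norm_num⟩, by
    intro x y
    change herm ((δ⁻¹ • mat F) *ᵥ x) ((δ⁻¹ • mat F) *ᵥ y) = _
    rw [Matrix.smul_mulVec, Matrix.smul_mulVec, herm_smul_left, herm_smul_right, ← mul_assoc,
      hδn, one_mul, isIsom_mat F]⟩
  have hG : mat G = δ⁻¹ • mat F := rfl
  refine ⟨G, cls_eq_of_smul hG, ?_⟩
  set A := cis a₂ * bet (cis a₁) with hA
  set B := bet (cis a₂) * (cis a₁ + bet (cis a₁)) with hB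
  have hAB : A + B = 0 := by
    have : δ + A + B = (δ ^ 2)⁻¹ := by
      simp only [A, B, hδ, bet]; field_simp; ring
    have h4 : (δ ^ 2)⁻¹ = δ := by field_simp; exact h3.symm
    linear_combination this + h4
  have hBA : B = -A := by linear_combination hAB
  have hA0 : A ≠ 0 := mul_ne_zero e2 hb₁
  have step : ∀ x, (mat G - 1) *ᵥ x = δ⁻¹ • ((A * herm x p₁) • p₁ +
      (bet (cis a₂) * (cis a₁ * herm x p₂ + bet (cis a₁) * herm x p₁)) • p₂) := by
    intro x
    rw [Matrix.sub_mulVec, hG, Matrix.smul_mulVec, product_tangent hN hF, Matrix.one_mulVec,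
      add_assoc, smul_add, ← hδ, smul_smul, inv_mul_cancel₀ hδ0, one_smul, add_sub_cancel_left]
  have st1 : (mat G - 1) *ᵥ p₁ = (δ⁻¹ * A) • (p₁ - p₂) := by
    rw [step, hN.h11, hN.h12]
    have : bet (cis a₂) * (cis a₁ * ((1 : ℝ) : ℂ) + bet (cis a₁) * ((1 : ℝ) : ℂ)) = B := by
      rw [hB]; push_cast; ring
    rw [this, hBA]; push_cast; module
  have st2 : (mat G - 1) *ᵥ p₂ = (δ⁻¹ * A) • (p₁ - p₂) := by
    rw [step, hN.h21, hN.h22]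
    have : bet (cis a₂) * (cis a₁ * ((1 : ℝ) : ℂ) + bet (cis a₁) * ((1 : ℝ) : ℂ)) = B := by
      rw [hB]; push_cast; ring
    rw [this, hBA]; push_cast; module
  have st3 : (mat G - 1) *ᵥ (p₁ - p₂) = 0 := by rw [Matrix.mulVec_sub, st1, st2, sub_self]
  constructor
  · refine eq_of_mulVec fun x => ?_
    rw [pow_succ, pow_two, ← Matrix.mulVec_mulVec, ← Matrix.mulVec_mulVec, step x]
    simp only [Matrix.mulVec_smul, Matrix.mulVec_add, st1, st2, st3, Matrix.zero_mulVec,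
      smul_zero, add_zero]
  · intro h0
    obtain ⟨w, w1, w2, -⟩ := hN.exists_dual hne
    have h := congrArg (fun M => M *ᵥ w) h0
    simp only [pow_two, ← Matrix.mulVec_mulVec, step w, w1, w2, Matrix.mulVec_smul,
      Matrix.mulVec_add, st1, st2, Matrix.zero_mulVec, smul_smul, ← add_smul] at h
    have h5 := (smul_eq_zero.1 h).resolve_right (sub_ne_zero.2 hne)
    have h6 : δ⁻¹ * (δ⁻¹ * A * (bet (cis a₂) * cis a₁)) = 0 := by linear_combination -h5
    simp [hδ0, hA0, hb₂, e1] at h6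

end tangent

/-! ### One-parameter families of products -/

/-- Admissible arguments of the parameters. -/
structure Angles (a₁ a₂ : ℝ) : Prop where
  pos1 : 0 < a₁
  lt1 : a₁ < 2 * Real.pi / 3
  pos2 : 0 < a₂
  lt2 : a₂ < 2 * Real.pi / 3

/-- The value of `τ` for which the product has the eigenvalues `e^{-i(a₁+a₂)/2 ± iφ}`. -/
def tauOf (a₁ a₂ φ : ℝ) : ℝ :=
  (Real.cos (3 * (a₂ - a₁) / 2) - Real.cos φ) /
    (Real.cos (3 * (a₂ - a₁) / 2) - Real.cos (3 * (a₁ + a₂) / 2))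

theorem chord_re_eq_sub (a₁ a₂ τ : ℝ) : (chord a₁ a₂ τ).re = Real.cos (3 * (a₂ - a₁) / 2) -
    τ * (Real.cos (3 * (a₂ - a₁) / 2) - Real.cos (3 * (a₁ + a₂) / 2)) := by
  rw [chord_re]; ring

theorem tauOf_eq_zero {a₁ a₂ φ : ℝ} (h : Real.cos φ = Real.cos (3 * (a₂ - a₁) / 2)) :
    tauOf a₁ a₂ φ = 0 := by rw [tauOf, h, sub_self, zero_div]

namespace Angles

variable {a₁ a₂ : ℝ}

theorem swap (ha : Angles a₁ a₂) : Angles a₂ a₁ := ⟨ha.pos2, ha.lt2, ha.pos1, ha.lt1⟩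

/-- The difference is `2 sin(3a₁/2) sin(3a₂/2)`, and both half angles lie in `(0,π)`. Hence `Re z`
strictly decreases with `τ`. -/
theorem den_pos (ha : Angles a₁ a₂) : 0 < Real.cos (3 * (a₂ - a₁) / 2) - Real.cos (3 * (a₁ + a₂) / 2) := by
  have h1 : 0 < Real.sin (3 * a₁ / 2) :=
    Real.sin_pos_of_pos_of_lt_pi (by linarith [ha.pos1]) (by linarith [ha.lt1])
  have h2 : 0 < Real.sin (3 * a₂ / 2) :=
    Real.sin_pos_of_pos_of_lt_pi (by linarith [ha.pos2]) (by linarith [ha.lt2])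
  rw [show 3 * (a₂ - a₁) / 2 = 3 * a₂ / 2 - 3 * a₁ / 2 by ring,
    show 3 * (a₁ + a₂) / 2 = 3 * a₂ / 2 + 3 * a₁ / 2 by ring, Real.cos_sub, Real.cos_add]
  nlinarith

theorem chord_re_tauOf (ha : Angles a₁ a₂) (φ : ℝ) : (chord a₁ a₂ (tauOf a₁ a₂ φ)).re = Real.cos φ := by
  rw [chord_re_eq_sub, tauOf, div_mul_cancel₀ _ ha.den_pos.ne']; ring

theorem tauOf_eq (ha : Angles a₁ a₂) {τ φ : ℝ} (h : (chord a₁ a₂ τ).re = Real.cos φ) : tauOf a₁ a₂ φ = τ := by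
  rw [chord_re_eq_sub] at h
  rw [tauOf, div_eq_iff ha.den_pos.ne']; linarith

theorem tauOf_eq_one (ha : Angles a₁ a₂) {φ : ℝ} (h : Real.cos φ = Real.cos (3 * (a₁ + a₂) / 2)) :
    tauOf a₁ a₂ φ = 1 := by rw [tauOf, h, div_self ha.den_pos.ne']

theorem one_le_tauOf (ha : Angles a₁ a₂) {φ : ℝ} (h : Real.cos φ ≤ Real.cos (3 * (a₁ + a₂) / 2)) :
    1 ≤ tauOf a₁ a₂ φ := by
  rw [tauOf, le_div_iff₀ ha.den_pos]; linarith

theorem one_lt_tauOf (ha : Angles a₁ a₂) {φ : ℝ} (h : Real.cos φ < Real.cos (3 * (a₁ + a₂) / 2)) :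
    1 < tauOf a₁ a₂ φ := by
  rw [tauOf, lt_div_iff₀ ha.den_pos]; linarith

theorem tauOf_le_one (ha : Angles a₁ a₂) {φ : ℝ} (h : Real.cos (3 * (a₁ + a₂) / 2) ≤ Real.cos φ) :
    tauOf a₁ a₂ φ ≤ 1 := by
  rw [tauOf, div_le_iff₀ ha.den_pos]; linarith

theorem tauOf_lt_one (ha : Angles a₁ a₂) {φ : ℝ} (h : Real.cos (3 * (a₁ + a₂) / 2) < Real.cos φ) :
    tauOf a₁ a₂ φ < 1 := by
  rw [tauOf, div_lt_iff₀ ha.den_pos]; linarith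

theorem tauOf_pos (ha : Angles a₁ a₂) {φ : ℝ} (h : Real.cos φ < Real.cos (3 * (a₂ - a₁) / 2)) :
    0 < tauOf a₁ a₂ φ := div_pos (by linarith) ha.den_pos

theorem tauOf_neg (ha : Angles a₁ a₂) {φ : ℝ} (h : Real.cos (3 * (a₂ - a₁) / 2) < Real.cos φ) :
    tauOf a₁ a₂ φ < 0 := div_neg_of_neg_of_pos (by linarith) ha.den_pos

theorem one_sub_cos_pos (ha : Angles a₁ a₂) : 0 < 1 - Real.cos (3 * a₂) := by
  have h : Real.cos (3 * a₂) ≠ 1 := by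
    intro h
    have h1 := (Real.cos_eq_one_iff_of_lt_of_lt (x := 3 * a₂)
      (by linarith [ha.pos2, Real.pi_pos]) (by linarith [ha.lt2])).1 h
    linarith [ha.pos2]
  have := lt_of_le_of_ne (Real.cos_le_one (3 * a₂)) h
  linarith

/-- Beyond the ends of the chord its line lies strictly outside the unit disc; between the ends, as
in `im_sq_lt`, it lies strictly inside. -/
theorem lt_im_sq (ha : Angles a₁ a₂) {τ : ℝ} (hτ : τ * (1 - τ) < 0) :
    1 - (chord a₁ a₂ τ).re ^ 2 < (chord a₁ a₂ τ).im ^ 2 := by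
  have h1 := one_sub_normSq_chord a₁ a₂ τ
  have h2 := mul_neg_of_neg_of_pos hτ ha.one_sub_cos_pos
  nlinarith

theorem im_sq_lt (ha : Angles a₁ a₂) {τ : ℝ} (hτ : 0 < τ * (1 - τ)) :
    (chord a₁ a₂ τ).im ^ 2 < 1 - (chord a₁ a₂ τ).re ^ 2 := by
  have h1 := one_sub_normSq_chord a₁ a₂ τ
  have h2 := mul_pos hτ ha.one_sub_cos_pos
  nlinarith

/-- At `τ = 1` the imaginary part is `-sin Σ`. A change of sign later would be a crossing of the
real axis outside the unit disc, but `Re z` decreases from `cos Σ` and has not yet passed `-1`. -/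
theorem im_sign_of_one_lt (ha : Angles a₁ a₂) {τ : ℝ} (hτ : 1 < τ) (hx : -1 ≤ (chord a₁ a₂ τ).re)
    (hS : Real.sin (3 * (a₁ + a₂) / 2) ≠ 0) :
    Real.sin (3 * (a₁ + a₂) / 2) * (chord a₁ a₂ τ).im < 0 := by
  by_contra! hcon
  have hden := ha.den_pos
  rw [chord_re_eq_sub] at hx
  rw [chord_im] at hcon
  set S := Real.sin (3 * (a₁ + a₂) / 2)
  set m := -(Real.sin (3 * (a₂ - a₁) / 2) + S) with hm
  have h1 : S ^ 2 ≤ S * (m * (τ - 1)) := by rw [hm]; nlinarith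
  have hS2 : 0 < S ^ 2 := by positivity
  have hm0 : m ≠ 0 := by intro h; rw [h] at h1; simp at h1; exact hS h1
  have hSm : 0 < S * m := by
    by_contra! h
    nlinarith [mul_nonneg (neg_nonneg.2 h) (sub_pos.2 hτ).le]
  have hd : 0 < S / m := by
    have : S / m = S * m / m ^ 2 := by field_simp
    rw [this]; positivity
  have hd' : S / m ≤ τ - 1 := by
    have : S / m = S ^ 2 / (S * m) := by field_simp
    rw [this, div_le_iff₀ hSm]; linarith
  have him : (chord a₁ a₂ (1 + S / m)).im = 0 := by
    rw [chord_im]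
    have : S / m * m = S := div_mul_cancel₀ _ hm0
    have e : Real.sin (3 * (a₂ - a₁) / 2) = -m - S := by rw [hm]; ring
    change (1 - (1 + S / m)) * Real.sin (3 * (a₂ - a₁) / 2) - (1 + S / m) * S = 0
    rw [e]; linear_combination this
  have h2 := ha.lt_im_sq (τ := 1 + S / m) (by nlinarith)
  rw [him, chord_re_eq_sub] at h2
  have c1 := Real.cos_le_one (3 * (a₁ + a₂) / 2)
  have h3 : Real.cos (3 * (a₂ - a₁) / 2) -
    (1 + S / m) * (Real.cos (3 * (a₂ - a₁) / 2) - Real.cos (3 * (a₁ + a₂) / 2)) ≤ 1 := by nlinarith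
  have h4 : -1 ≤ Real.cos (3 * (a₂ - a₁) / 2) -
    (1 + S / m) * (Real.cos (3 * (a₂ - a₁) / 2) - Real.cos (3 * (a₁ + a₂) / 2)) := by nlinarith
  nlinarith

/-- The same argument starts from `τ = 0`, where the imaginary part is `sin D`: as `τ` decreases,
`Re z` grows but has not yet passed `1`. The crossing would be at `τ = S/m`. -/
theorem im_sign_of_neg (ha : Angles a₁ a₂) {τ : ℝ} (hτ : τ < 0) (hx : (chord a₁ a₂ τ).re ≤ 1)
    (hS : Real.sin (3 * (a₂ - a₁) / 2) ≠ 0) :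
    0 < Real.sin (3 * (a₂ - a₁) / 2) * (chord a₁ a₂ τ).im := by
  by_contra! hcon
  have hden := ha.den_pos
  rw [chord_re_eq_sub] at hx
  rw [chord_im] at hcon
  set S := Real.sin (3 * (a₂ - a₁) / 2)
  set m := S + Real.sin (3 * (a₁ + a₂) / 2) with hm
  have h1 : S ^ 2 ≤ S * (m * τ) := by rw [hm]; nlinarith
  have hS2 : 0 < S ^ 2 := by positivity
  have hm0 : m ≠ 0 := by intro h; rw [h] at h1; simp at h1; exact hS h1
  have hSm : S * m < 0 := by
    by_contra! h
    nlinarith [mul_nonneg h (neg_pos.2 hτ).le]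
  have hd : S / m < 0 := by
    have : S / m = S * m / m ^ 2 := by field_simp
    rw [this]; exact div_neg_of_neg_of_pos hSm (by positivity)
  have hd' : τ ≤ S / m := by
    have : S / m = S ^ 2 / (S * m) := by field_simp
    rw [this, le_div_iff_of_neg hSm]; linarith
  have him : (chord a₁ a₂ (S / m)).im = 0 := by
    rw [chord_im]
    have : S / m * m = S := div_mul_cancel₀ _ hm0
    have e : Real.sin (3 * (a₁ + a₂) / 2) = m - S := by rw [hm]; ring
    change (1 - (S / m)) * S - (S / m) * Real.sin (3 * (a₁ + a₂) / 2) = 0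
    rw [e]; linear_combination -this
  have h2 := ha.lt_im_sq (τ := S / m) (by nlinarith)
  rw [him, chord_re_eq_sub] at h2
  have c1 := Real.neg_one_le_cos (3 * (a₂ - a₁) / 2)
  have h3 : Real.cos (3 * (a₂ - a₁) / 2) -
    (S / m) * (Real.cos (3 * (a₂ - a₁) / 2) - Real.cos (3 * (a₁ + a₂) / 2)) ≤ 1 := by nlinarith
  have h4 : -1 ≤ Real.cos (3 * (a₂ - a₁) / 2) -
    (S / m) * (Real.cos (3 * (a₂ - a₁) / 2) - Real.cos (3 * (a₁ + a₂) / 2)) := by nlinarith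
  nlinarith

theorem bet1 (ha : Angles a₁ a₂) : bet (cis a₁) ≠ 0 := bet_ne_zero ha.pos1 ha.lt1

theorem bet2 (ha : Angles a₁ a₂) : bet (cis a₂) ≠ 0 := bet_ne_zero ha.pos2 ha.lt2

end Angles

/-! ### Explicit continuous families of centers and their products -/

theorem continuous_tauOf (a₁ a₂ : ℝ) : Continuous (tauOf a₁ a₂) :=
  (continuous_const.sub Real.continuous_cos).div_const _

theorem normalPair_pos (u : ℝ) :
    NormalPair ![1, 0, 0] ![(Real.cos u : ℂ), (Real.sin u : ℂ), 0] 1 1 (Real.cos u) := by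
  have h : (Real.cos u : ℂ) ^ 2 + (Real.sin u : ℂ) ^ 2 = 1 := by
    exact_mod_cast Real.cos_sq_add_sin_sq u
  refine ⟨by simp [herm], ?_, ?_, by norm_num, by norm_num⟩
  · simp only [herm, Matrix.cons_val_zero, Matrix.cons_val_one, Matrix.cons_val, Complex.star_def,
      Complex.conj_ofReal]
    simp only [map_zero]
    push_cast at h ⊢
    linear_combination h
  · simp only [herm, Matrix.cons_val_zero, Matrix.cons_val_one, Matrix.cons_val, Complex.star_def,
      Complex.conj_ofReal]
    ring

theorem normalPair_hyp (u : ℝ) :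
    NormalPair ![1, 0, 0] ![(Real.cosh u : ℂ), 0, (Real.sinh u : ℂ)] 1 1 (Real.cosh u) := by
  have h : (Real.cosh u : ℂ) ^ 2 - (Real.sinh u : ℂ) ^ 2 = 1 := by
    exact_mod_cast Real.cosh_sq_sub_sinh_sq u
  refine ⟨by simp [herm], ?_, ?_, by norm_num, by norm_num⟩
  · simp only [herm, Matrix.cons_val_zero, Matrix.cons_val_one, Matrix.cons_val, Complex.star_def,
      Complex.conj_ofReal]
    push_cast at h ⊢
    linear_combination h
  · simp only [herm, Matrix.cons_val_zero, Matrix.cons_val_one, Matrix.cons_val, Complex.star_def,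
      Complex.conj_ofReal]
    ring

/-- The minus sign before `cosh` makes the product of the two representatives positive, as the
normalization `g ≥ 0` demands. -/
theorem normalPair_neg (u : ℝ) :
    NormalPair ![0, 0, 1] ![(Real.sinh u : ℂ), 0, -(Real.cosh u : ℂ)] (-1) (-1)
      (Real.cosh u) := by
  have h : (Real.cosh u : ℂ) ^ 2 - (Real.sinh u : ℂ) ^ 2 = 1 := by
    exact_mod_cast Real.cosh_sq_sub_sinh_sq u
  refine ⟨by simp [herm], ?_, ?_, by norm_num, by norm_num⟩
  · simp only [herm, Matrix.cons_val_zero, Matrix.cons_val_one, Matrix.cons_val, Complex.star_def,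
      Complex.conj_ofReal, map_neg]
    push_cast at h ⊢
    linear_combination -h
  · simp only [herm, Matrix.cons_val_zero, Matrix.cons_val_one, Matrix.cons_val, Complex.star_def,
      Complex.conj_ofReal, map_neg]
    ring

theorem normalPair_mix (u : ℝ) :
    NormalPair ![1, 0, 0] ![(Real.sinh u : ℂ), 0, (Real.cosh u : ℂ)] 1 (-1) (Real.sinh u) := by
  have h : (Real.cosh u : ℂ) ^ 2 - (Real.sinh u : ℂ) ^ 2 = 1 := by
    exact_mod_cast Real.cosh_sq_sub_sinh_sq u
  refine ⟨by simp [herm], ?_, ?_, by norm_num, by norm_num⟩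
  · simp only [herm, Matrix.cons_val_zero, Matrix.cons_val_one, Matrix.cons_val, Complex.star_def,
      Complex.conj_ofReal]
    push_cast at h ⊢
    linear_combination -h
  · simp only [herm, Matrix.cons_val_zero, Matrix.cons_val_one, Matrix.cons_val, Complex.star_def,
      Complex.conj_ofReal]
    ring

theorem normalPair_tangent : NormalPair ![1, 0, 0] ![1, 1, 1] 1 1 1 :=
  ⟨by simp [herm], by simp [herm], by simp [herm], by norm_num, by norm_num⟩

/-- The product for a normalized pair. -/
def normalProd (a₁ a₂ : ℝ) {p₁ p₂ : V} {s₁ s₂ g : ℝ} (h : NormalPair p₁ p₂ s₁ s₂ g) : SU21 :=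
  prodRefl (cis a₁) (cis a₂) (norm_cis _) (norm_cis _) p₁ p₂ h.ne1 h.ne2

theorem isProduct_normalProd (a₁ a₂ : ℝ) {p₁ p₂ : V} {s₁ s₂ g : ℝ}
    (h : NormalPair p₁ p₂ s₁ s₂ g) : IsProduct (cis a₁) (cis a₂) p₁ p₂ (normalProd a₁ a₂ h) :=
  isProduct_prodRefl _ _ _ _

theorem continuous_normalProd (a₁ a₂ : ℝ) {p₁ : V} {p₂ : ℝ → V} {s₁ s₂ : ℝ} {g : ℝ → ℝ}
    (h : ∀ u, NormalPair p₁ (p₂ u) s₁ s₂ (g u)) (hc : Continuous p₂) :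
    Continuous fun u => normalProd a₁ a₂ (h u) :=
  (continuous_refl (norm_cis _) (fun u => (h u).ne2) hc).mul
    (continuous_refl (p := fun _ => p₁) (norm_cis _) (fun u => (h u).ne1) continuous_const)

/-- Positive centers on a positive line. -/
def posProd (a₁ a₂ φ : ℝ) : SU21 :=
  normalProd a₁ a₂ (normalPair_pos (Real.arccos (Real.sqrt (tauOf a₁ a₂ φ))))

/-- Positive centers on a hyperbolic line. -/
def hypProd (a₁ a₂ φ : ℝ) : SU21 :=
  -- Since `cosh² = 1 + sinh²`, this realizes `g² = τ` for `τ ≥ 1`. For `τ < 1` the square root is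
  -- `0`, so the family remains defined and continuous but no longer represents `τ`.
  normalProd a₁ a₂ (normalPair_hyp (Real.arsinh (Real.sqrt (tauOf a₁ a₂ φ - 1))))

/-- Negative centers. -/
def negProd (a₁ a₂ φ : ℝ) : SU21 :=
  normalProd a₁ a₂ (normalPair_neg (Real.arsinh (Real.sqrt (tauOf a₁ a₂ φ - 1))))

/-- A positive and a negative center. -/
def mixProd (a₁ a₂ φ : ℝ) : SU21 :=
  normalProd a₁ a₂ (normalPair_mix (Real.arsinh (Real.sqrt (-tauOf a₁ a₂ φ))))

theorem continuous_posProd (a₁ a₂ : ℝ) : Continuous (posProd a₁ a₂) := by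
  have h : Continuous fun u : ℝ => (![(Real.cos u : ℂ), (Real.sin u : ℂ), 0] : V) := by
    refine continuous_pi fun i => ?_
    fin_cases i
    · exact Complex.continuous_ofReal.comp Real.continuous_cos
    · exact Complex.continuous_ofReal.comp Real.continuous_sin
    · exact continuous_const
  exact (continuous_normalProd a₁ a₂ normalPair_pos h).comp
    (Real.continuous_arccos.comp (Real.continuous_sqrt.comp (continuous_tauOf a₁ a₂)))

theorem continuous_hypProd (a₁ a₂ : ℝ) : Continuous (hypProd a₁ a₂) := by
  have h : Continuous fun u : ℝ => (![(Real.cosh u : ℂ), 0, (Real.sinh u : ℂ)] : V) := by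
    refine continuous_pi fun i => ?_
    fin_cases i
    · exact Complex.continuous_ofReal.comp Real.continuous_cosh
    · exact continuous_const
    · exact Complex.continuous_ofReal.comp Real.continuous_sinh
  exact (continuous_normalProd a₁ a₂ normalPair_hyp h).comp
    (Real.continuous_arsinh.comp
      (Real.continuous_sqrt.comp ((continuous_tauOf a₁ a₂).sub continuous_const)))

theorem continuous_negProd (a₁ a₂ : ℝ) : Continuous (negProd a₁ a₂) := by
  have h : Continuous fun u : ℝ => (![(Real.sinh u : ℂ), 0, -(Real.cosh u : ℂ)] : V) := by
    refine continuous_pi fun i => ?_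
    fin_cases i
    · exact Complex.continuous_ofReal.comp Real.continuous_sinh
    · exact continuous_const
    · exact (Complex.continuous_ofReal.comp Real.continuous_cosh).neg
  exact (continuous_normalProd a₁ a₂ normalPair_neg h).comp
    (Real.continuous_arsinh.comp
      (Real.continuous_sqrt.comp ((continuous_tauOf a₁ a₂).sub continuous_const)))

theorem continuous_mixProd (a₁ a₂ : ℝ) : Continuous (mixProd a₁ a₂) := by
  have h : Continuous fun u : ℝ => (![(Real.sinh u : ℂ), 0, (Real.cosh u : ℂ)] : V) := by
    refine continuous_pi fun i => ?_
    fin_cases i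
    · exact Complex.continuous_ofReal.comp Real.continuous_sinh
    · exact continuous_const
    · exact Complex.continuous_ofReal.comp Real.continuous_cosh
  exact (continuous_normalProd a₁ a₂ normalPair_mix h).comp
    (Real.continuous_arsinh.comp
      (Real.continuous_sqrt.comp (continuous_tauOf a₁ a₂).neg))

/-- The pair of centers of `posProd`. -/
theorem exists_pair_posProd {a₁ a₂ φ : ℝ} (h1 : tauOf a₁ a₂ φ ≤ 1) :
    ∃ p₂, NormalPair ![1, 0, 0] p₂ 1 1 (Real.sqrt (tauOf a₁ a₂ φ)) ∧
      IsProduct (cis a₁) (cis a₂) ![1, 0, 0] p₂ (posProd a₁ a₂ φ) := by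
  have h := normalPair_pos (Real.arccos (Real.sqrt (tauOf a₁ a₂ φ)))
  refine ⟨_, ?_, isProduct_normalProd a₁ a₂ h⟩
  have e := Real.cos_arccos (by linarith [Real.sqrt_nonneg (tauOf a₁ a₂ φ)])
    (Real.sqrt_le_one.2 h1)
  simp only [e] at h ⊢
  exact h

theorem exists_pair_hypProd {a₁ a₂ φ : ℝ} (h1 : 1 ≤ tauOf a₁ a₂ φ) :
    ∃ p₂, NormalPair ![1, 0, 0] p₂ 1 1 (Real.sqrt (tauOf a₁ a₂ φ)) ∧
      IsProduct (cis a₁) (cis a₂) ![1, 0, 0] p₂ (hypProd a₁ a₂ φ) := by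
  have h := normalPair_hyp (Real.arsinh (Real.sqrt (tauOf a₁ a₂ φ - 1)))
  refine ⟨_, ?_, isProduct_normalProd a₁ a₂ h⟩
  have e : Real.cosh (Real.arsinh (Real.sqrt (tauOf a₁ a₂ φ - 1))) =
      Real.sqrt (tauOf a₁ a₂ φ) := by
    rw [Real.cosh_arsinh, Real.sq_sqrt (by linarith)]; congr 1; ring
  rw [← e]; exact h

theorem exists_pair_negProd {a₁ a₂ φ : ℝ} (h1 : 1 ≤ tauOf a₁ a₂ φ) :
    ∃ p₂, NormalPair ![0, 0, 1] p₂ (-1) (-1) (Real.sqrt (tauOf a₁ a₂ φ)) ∧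
      IsProduct (cis a₁) (cis a₂) ![0, 0, 1] p₂ (negProd a₁ a₂ φ) := by
  have h := normalPair_neg (Real.arsinh (Real.sqrt (tauOf a₁ a₂ φ - 1)))
  refine ⟨_, ?_, isProduct_normalProd a₁ a₂ h⟩
  have e : Real.cosh (Real.arsinh (Real.sqrt (tauOf a₁ a₂ φ - 1))) =
      Real.sqrt (tauOf a₁ a₂ φ) := by
    rw [Real.cosh_arsinh, Real.sq_sqrt (by linarith)]; congr 1; ring
  rw [← e]; exact h

theorem exists_pair_mixProd {a₁ a₂ φ : ℝ} :
    ∃ p₂, NormalPair ![1, 0, 0] p₂ 1 (-1) (Real.sqrt (-tauOf a₁ a₂ φ)) ∧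
      IsProduct (cis a₁) (cis a₂) ![1, 0, 0] p₂ (mixProd a₁ a₂ φ) := by
  have h := normalPair_mix (Real.arsinh (Real.sqrt (-tauOf a₁ a₂ φ)))
  refine ⟨_, ?_, isProduct_normalProd a₁ a₂ h⟩
  have e := Real.sinh_arsinh (Real.sqrt (-tauOf a₁ a₂ φ))
  rw [← e]; simp only [Real.sinh_arsinh] at h ⊢; exact h

/-- Equality in the Hausdorff quotient passes to the ends of an interval. -/
theorem rho_cls_eq_point {F : ℝ → SU21} (hF : Continuous F) {θ : ℝ → ℝ × ℝ} (hθ : Continuous θ)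
    {l r : ℝ} (hlr : l < r)
    (h : ∀ φ ∈ Set.Ioo l r, cls (F φ) = cls (angleElement (θ φ))) :
    ∀ φ ∈ Set.Icc l r, rho (cls (F φ)) = point (θ φ) := by
  have hcont : Continuous fun θ : ℝ × ℝ => angleElement θ := by
    refine Continuous.subtype_mk (Continuous.subtype_mk ?_ _) _
    refine Continuous.matrix_diagonal (continuous_pi fun i => ?_)
    fin_cases i
    · change Continuous fun θ : ℝ × ℝ => cis ((2 * θ.1 - θ.2) / 3)
      exact continuous_cis.comp (by fun_prop)
    · change Continuous fun θ : ℝ × ℝ => cis ((2 * θ.2 - θ.1) / 3)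
      exact continuous_cis.comp (by fun_prop)
    · change Continuous fun θ : ℝ × ℝ => cis (-(θ.1 + θ.2) / 3)
      exact continuous_cis.comp (by fun_prop)
  have h1 : Continuous fun φ => rho (cls (F φ)) := continuous_rho_cls.comp hF
  have h2 : Continuous fun φ => point (θ φ) := continuous_rho_cls.comp (hcont.comp hθ)
  have h3 : Set.EqOn (fun φ => rho (cls (F φ))) (fun φ => point (θ φ)) (Set.Ioo l r) :=
    fun φ hφ => congrArg rho (h φ hφ)
  have h4 := h3.closure h1 h2
  rw [closure_Ioo hlr.ne] at h4
  exact h4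

/-! ### Classification of the products -/

theorem sgn_of_herm_one {p : V} (h : herm p p = (1 : ℝ)) : sgn p = 1 := by
  rw [sgn_eq_one_iff, h]; simp

theorem sgn_of_herm_neg_one {p : V} (h : herm p p = (-1 : ℝ)) : sgn p = -1 := by
  rw [sgn_eq_neg_one_iff, h]; simp

theorem mem_signedClasses_iff {α₁ α₂ : ℂ} {σ₁ σ₂ : SignType} (h1 : σ₁ ≠ 0) (h2 : σ₂ ≠ 0)
    {c : ClassSpace} : c ∈ signedClasses α₁ α₂ σ₁ σ₂ ↔
      ∃ (F : SU21) (p₁ p₂ : V) (g : ℝ), cls F = c ∧ IsEllipticOrParabolic F ∧ 0 ≤ g ∧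
        NormalPair p₁ p₂ (σ₁ : ℝ) (σ₂ : ℝ) g ∧ IsProduct α₁ α₂ p₁ p₂ F := by
  constructor
  · rintro ⟨F, hc, hE, p₁, p₂, n1, n2, e1, e2, hF⟩
    obtain ⟨k₁, k₂, g, hk₁, hk₂, hg, hN⟩ := exists_normalPair n1 n2 e1 e2
    exact ⟨F, _, _, g, hc, hE, hg, hN, hF.smul_centers hk₁ hk₂⟩
  · rintro ⟨F, p₁, p₂, g, hc, hE, -, hN, hF⟩
    have key : ∀ (σ : SignType) (p : V), herm p p = ((σ : ℝ) : ℂ) → sgn p = σ := by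
      intro σ p h
      rw [sgn, h, Complex.ofReal_re]
      cases σ <;> simp
    have e1 := key σ₁ p₁ hN.h11
    have e2 := key σ₂ p₂ hN.h22
    exact ⟨F, hc, hE, p₁, p₂, e1 ▸ h1, e2 ▸ h2, e1, e2, hF⟩

theorem le_iff_cos_le {x y : ℝ} (hx : 0 ≤ x) (hx' : x ≤ Real.pi) (hy : 0 ≤ y)
    (hy' : y ≤ Real.pi) : x ≤ y ↔ Real.cos y ≤ Real.cos x := by
  constructor
  · intro h; exact Real.cos_le_cos_of_nonneg_of_le_pi hx hy' h
  · intro h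
    by_contra! hlt
    exact absurd (Real.cos_lt_cos_of_nonneg_of_le_pi hy hx' hlt) (not_lt.2 h)

/-- The vector `p₂ + g p₁` is orthogonal to the negative `p₁` and has square `g² - 1`, which
therefore cannot be negative. -/
theorem NormalPair.one_le_of_neg {p₁ p₂ : V} {g : ℝ} (hN : NormalPair p₁ p₂ (-1) (-1) g) :
    1 ≤ g ^ 2 := by
  by_contra! h
  have h1 : p₂ + (g : ℂ) • p₁ = 0 := by
    apply eq_zero_of_orthogonal_neg (v := p₁) (by rw [hN.h11]; norm_num)
    · have : herm (p₂ + (g : ℂ) • p₁) (p₂ + (g : ℂ) • p₁) = ((g ^ 2 - 1 : ℝ) : ℂ) := by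
        simp only [herm_add_left, herm_add_right, herm_smul_left, herm_smul_right, hN.h11, hN.h12,
          hN.h21, hN.h22, Complex.star_def, Complex.conj_ofReal]
        push_cast; ring
      rw [this, Complex.ofReal_re]; linarith
    · simp only [herm_add_left, herm_smul_left, hN.h11, hN.h21]; push_cast; ring
  have h2 : p₂ = (-(g : ℂ)) • p₁ := by
    rw [neg_smul]; exact eq_neg_of_add_eq_zero_left h1
  have h3 := hN.h22
  rw [h2, herm_smul_left, herm_smul_right, hN.h11, star_neg, Complex.star_def,
    Complex.conj_ofReal] at h3
  have h4 : g ^ 2 = 1 := by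
    have : ((g ^ 2 : ℝ) : ℂ) = ((1 : ℝ) : ℂ) := by push_cast at h3 ⊢; linear_combination -h3
    exact_mod_cast this
  linarith

theorem NormalPair.cls_eq_neg {p₁ p₂ q₁ q₂ : V} {g : ℝ} (hp : NormalPair p₁ p₂ (-1) (-1) g)
    (hq : NormalPair q₁ q₂ (-1) (-1) g) (hg : 0 ≤ g) {α₁ α₂ : ℂ} {F G : SU21}
    (hF : IsProduct α₁ α₂ p₁ p₂ F) (hG : IsProduct α₁ α₂ q₁ q₂ G) : cls F = cls G := by
  by_cases h : g = 1
  · subst h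
    have e1 : p₂ = (-1 : ℂ) • p₁ := by rw [hp.eq_neg_of_tangent]; simp
    have e2 : q₂ = (-1 : ℂ) • q₁ := by rw [hq.eq_neg_of_tangent]; simp
    have n : (-1 : ℂ) ≠ 0 := by norm_num
    have hF' := hF.smul_centers one_ne_zero n
    have hG' := hG.smul_centers one_ne_zero n
    rw [e1, one_smul, smul_smul] at hF'
    rw [e2, one_smul, smul_smul] at hG'
    norm_num at hF' hG'
    exact cls_eq_of_self hp.sq1 hp.h11 hq.h11 hF' hG'
  · refine hp.cls_eq hq ?_ hF hG
    intro h0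
    apply h
    nlinarith

/-- For `g = 1` the Gram matrix does not separate coincident from tangent centers, hence the
additional hypothesis. -/
theorem NormalPair.cls_eq_pos {p₁ p₂ q₁ q₂ : V} {g : ℝ} (hp : NormalPair p₁ p₂ 1 1 g)
    (hq : NormalPair q₁ q₂ 1 1 g) (hg : 0 ≤ g) (hg1 : g = 1 → (p₁ = p₂ ↔ q₁ = q₂)) {α₁ α₂ : ℂ}
    {F G : SU21} (hF : IsProduct α₁ α₂ p₁ p₂ F) (hG : IsProduct α₁ α₂ q₁ q₂ G) :
    cls F = cls G := by
  by_cases h : g = 1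
  · subst h
    by_cases h1 : p₁ = p₂
    · have h2 := (hg1 rfl).1 h1
      subst h1
      subst h2
      exact cls_eq_of_self hp.sq1 hp.h11 hq.h11 hF hG
    · exact hp.cls_eq_tangent h1 hq (fun h2 => h1 ((hg1 rfl).2 h2)) hF hG
  · refine hp.cls_eq hq ?_ hF hG
    intro h0
    apply h
    nlinarith

namespace Angles

variable {a₁ a₂ : ℝ}

/-- This is the change of parameter from `τ` to `φ`. Membership in an interval of `φ` then
translates into bounds on `τ`, which are the constraints imposed by the signs of the centers. -/
theorem exists_phi (ha : Angles a₁ a₂) {p₁ p₂ : V} {s₁ s₂ g : ℝ} {F : SU21}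
    (hN : NormalPair p₁ p₂ s₁ s₂ g) (hF : IsProduct (cis a₁) (cis a₂) p₁ p₂ F)
    (hE : IsEllipticOrParabolic F) : ∃ φ, 0 ≤ φ ∧ φ ≤ Real.pi ∧
      tauOf a₁ a₂ φ = s₁ * s₂ * g ^ 2 ∧ Real.cos φ = (chord a₁ a₂ (s₁ * s₂ * g ^ 2)).re := by
  obtain ⟨b1, b2⟩ := abs_le.1 (abs_chord_re_le hN hF rfl hE)
  have e := Real.cos_arccos b1 b2
  exact ⟨Real.arccos _, Real.arccos_nonneg _, Real.arccos_le_pi _, ha.tauOf_eq e.symm, e⟩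

/-- Exponents of the hyperbolic case; `e` is the sign of `sin Σ`. -/
theorem negProd_interior (ha : Angles a₁ a₂) {φ e : ℝ} (h0 : 0 < φ) (hpi : φ < Real.pi)
    (hc : Real.cos φ < Real.cos (3 * (a₁ + a₂) / 2)) (he : e = 1 ∨ e = -1)
    (hes : 0 < e * Real.sin (3 * (a₁ + a₂) / 2)) {θ : ℝ × ℝ}
    (h1 : cis θ.1 = cis (3 * (a₁ + a₂) / 2 + e * φ)) (h2 : cis θ.2 = cis (2 * (e * φ))) :
    IsEllipticOrParabolic (negProd a₁ a₂ φ) ∧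
      cls (negProd a₁ a₂ φ) = cls (angleElement θ) := by
  have hτ := ha.one_lt_tauOf hc
  obtain ⟨p₂, hN, hF⟩ := exists_pair_negProd hτ.le
  have hre := ha.chord_re_tauOf φ
  have hS := Real.sin_pos_of_pos_of_lt_pi h0 hpi
  have him := ha.im_sign_of_one_lt hτ (by rw [hre]; exact Real.neg_one_le_cos φ)
    (by intro h; rw [h] at hes; simp at hes)
  have hsq := ha.lt_im_sq (τ := tauOf a₁ a₂ φ) (by nlinarith)
  rw [hre] at hsq
  have hcs := Real.sin_sq_add_cos_sq φ
  have e1 : Real.cos (e * φ) = Real.cos φ ∧ Real.sin (e * φ) = e * Real.sin φ := by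
    rcases he with rfl | rfl <;> simp
  have hee : e ^ 2 = 1 := by rcases he with rfl | rfl <;> norm_num
  refine cls_of_hyperbolic hN hF (τ := tauOf a₁ a₂ φ) ?_ ?_ (φ := e * φ) ?_ ?_ ?_ h1 h2
  · rw [Real.sq_sqrt (by linarith)]; ring
  · linarith
  · rw [e1.1, hre]
  · rw [e1.2, mul_pow, hee]; linarith
  · rw [e1.2]
    rcases he with rfl | rfl
    · nlinarith
    · nlinarith

/-- For `τ > 1` the sign of `Im z` is `-e`. With `s₁ = 1` instead of `-1`, the role of the negative
eigenvector passes to the other eigenvalue, so `e * φ` is replaced by its opposite in the angles of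
`negProd_interior`. -/
theorem hypProd_interior (ha : Angles a₁ a₂) {φ e : ℝ} (h0 : 0 < φ) (hpi : φ < Real.pi)
    (hc : Real.cos φ < Real.cos (3 * (a₁ + a₂) / 2)) (he : e = 1 ∨ e = -1)
    (hes : 0 < e * Real.sin (3 * (a₁ + a₂) / 2)) {θ : ℝ × ℝ}
    (h1 : cis θ.1 = cis (3 * (a₁ + a₂) / 2 - e * φ)) (h2 : cis θ.2 = cis (-(2 * (e * φ)))) :
    IsEllipticOrParabolic (hypProd a₁ a₂ φ) ∧
      cls (hypProd a₁ a₂ φ) = cls (angleElement θ) := by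
  have hτ := ha.one_lt_tauOf hc
  obtain ⟨p₂, hN, hF⟩ := exists_pair_hypProd hτ.le
  have hre := ha.chord_re_tauOf φ
  have hS := Real.sin_pos_of_pos_of_lt_pi h0 hpi
  have him := ha.im_sign_of_one_lt hτ (by rw [hre]; exact Real.neg_one_le_cos φ)
    (by intro h; rw [h] at hes; simp at hes)
  have hsq := ha.lt_im_sq (τ := tauOf a₁ a₂ φ) (by nlinarith)
  rw [hre] at hsq
  have hcs := Real.sin_sq_add_cos_sq φ
  have e1 : Real.cos (-(e * φ)) = Real.cos φ ∧ Real.sin (-(e * φ)) = -(e * Real.sin φ) := by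
    rcases he with rfl | rfl <;> simp
  have hee : e ^ 2 = 1 := by rcases he with rfl | rfl <;> norm_num
  refine cls_of_hyperbolic hN hF (τ := tauOf a₁ a₂ φ) ?_ ?_ (φ := -(e * φ)) ?_ ?_ ?_
    (by rw [h1]; congr 1) (by rw [h2]; congr 1; ring)
  · rw [Real.sq_sqrt (by linarith)]; ring
  · linarith
  · rw [e1.1, hre]
  · rw [e1.2, neg_sq, mul_pow, hee]; linarith
  · rw [e1.2]
    rcases he with rfl | rfl
    · nlinarith
    · nlinarith

theorem mixProd_interior (ha : Angles a₁ a₂) {φ e : ℝ} (h0 : 0 < φ) (hpi : φ < Real.pi)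
    (hc : Real.cos (3 * (a₂ - a₁) / 2) < Real.cos φ) (he : e = 1 ∨ e = -1)
    (hes : 0 < e * Real.sin (3 * (a₂ - a₁) / 2)) {θ : ℝ × ℝ}
    (h1 : cis θ.1 = cis (3 * (a₁ + a₂) / 2 + e * φ)) (h2 : cis θ.2 = cis (2 * (e * φ))) :
    IsEllipticOrParabolic (mixProd a₁ a₂ φ) ∧
      cls (mixProd a₁ a₂ φ) = cls (angleElement θ) := by
  have hτ := ha.tauOf_neg hc
  obtain ⟨p₂, hN, hF⟩ := exists_pair_mixProd (a₁ := a₁) (a₂ := a₂) (φ := φ)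
  have hre := ha.chord_re_tauOf φ
  have hS := Real.sin_pos_of_pos_of_lt_pi h0 hpi
  have him := ha.im_sign_of_neg hτ (by rw [hre]; exact Real.cos_le_one φ)
    (by intro h; rw [h] at hes; simp at hes)
  have hsq := ha.lt_im_sq (τ := tauOf a₁ a₂ φ) (by nlinarith)
  rw [hre] at hsq
  have hcs := Real.sin_sq_add_cos_sq φ
  have e1 : Real.cos (e * φ) = Real.cos φ ∧ Real.sin (e * φ) = e * Real.sin φ := by
    rcases he with rfl | rfl <;> simp
  have hee : e ^ 2 = 1 := by rcases he with rfl | rfl <;> norm_num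
  refine cls_of_hyperbolic hN hF (τ := tauOf a₁ a₂ φ) ?_ ?_ (φ := e * φ) ?_ ?_ ?_ h1 h2
  · rw [Real.sq_sqrt (by linarith)]; ring
  · linarith
  · rw [e1.1, hre]
  · rw [e1.2, mul_pow, hee]; linarith
  · rw [e1.2]
    rcases he with rfl | rfl
    · nlinarith
    · nlinarith

theorem posProd_interior (ha : Angles a₁ a₂) {φ : ℝ} (h0 : 0 < φ) (hpi : φ < Real.pi)
    (hc : Real.cos (3 * (a₁ + a₂) / 2) < Real.cos φ)
    (hc' : Real.cos φ < Real.cos (3 * (a₂ - a₁) / 2)) {θ : ℝ × ℝ}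
    (h1 : cis θ.1 = cis (-(3 * (a₁ + a₂) / 2) + φ))
    (h2 : cis θ.2 = cis (-(3 * (a₁ + a₂) / 2) - φ)) :
    IsEllipticOrParabolic (posProd a₁ a₂ φ) ∧
      cls (posProd a₁ a₂ φ) = cls (angleElement θ) := by
  have hτ1 := ha.tauOf_lt_one hc
  have hτ0 := ha.tauOf_pos hc'
  obtain ⟨p₂, hN, hF⟩ := exists_pair_posProd hτ1.le
  have hre := ha.chord_re_tauOf φ
  have hS := Real.sin_pos_of_pos_of_lt_pi h0 hpi
  have hsq := ha.im_sq_lt (τ := tauOf a₁ a₂ φ) (by nlinarith)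
  rw [hre] at hsq
  have hcs := Real.sin_sq_add_cos_sq φ
  have hs := Real.sq_sqrt hτ0.le
  refine cls_of_definite hN hF (by rw [hs]; exact hτ1) (φ := φ) ?_ hS.ne' ?_ h1 h2
  · rw [hs, hre]
  · rw [hs]; linarith

theorem cis_sigma_ne_one (ha : Angles a₁ a₂) : cis (3 * (a₁ + a₂) / 2) ≠ 1 :=
  cis_ne_one (by linarith [ha.pos1, ha.pos2]) (by linarith [ha.lt1, ha.lt2])

theorem cis_sigma (a₁ a₂ : ℝ) : cis a₁ * cis a₂ = hlf a₁ a₂ * cis (3 * (a₁ + a₂) / 2) := by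
  rw [hlf_mul_cis, ← cis_add]; congr 1; ring

theorem cis_sigma_sq (a₁ a₂ : ℝ) : (cis a₁ * cis a₂) ^ 3 = cis (2 * (3 * (a₁ + a₂) / 2)) := by
  rw [← cis_add, ← cis_nat_mul]; congr 1; push_cast; ring

/-- At `φ = π` the eigenvalue `-h` on the span is double. The point `z` lies outside the unit disc
with real part `-1`, so it is not real; the third eigenvalue `he^{iΣ}` is different because `cos Σ >
-1`. -/
theorem negProd_end (ha : Angles a₁ a₂) (hc : -1 < Real.cos (3 * (a₁ + a₂) / 2)) :
    IsElliptoParabolic (negProd a₁ a₂ Real.pi) := by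
  have hτ := ha.one_lt_tauOf (φ := Real.pi) (by rw [Real.cos_pi]; exact hc)
  obtain ⟨p₂, hN, hF⟩ := exists_pair_negProd hτ.le
  have hre := ha.chord_re_tauOf Real.pi
  rw [Real.cos_pi] at hre
  have hsq := ha.lt_im_sq (τ := tauOf a₁ a₂ Real.pi) (by nlinarith)
  refine isElliptoParabolic_of_hyperbolic hN hF (τ := tauOf a₁ a₂ Real.pi) ?_ hτ.ne' (ε := -1)
    (by norm_num) hre ?_ ?_
  · rw [Real.sq_sqrt (by linarith)]; ring
  · intro h; rw [h, hre] at hsq; norm_num at hsq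
  · rw [cis_sigma]
    intro h
    have h1 := congrArg Complex.re (mul_left_cancel₀ (hlf_ne_zero a₁ a₂) h)
    rw [cis_re, Complex.ofReal_re] at h1
    linarith

theorem hypProd_end (ha : Angles a₁ a₂) (hc : -1 < Real.cos (3 * (a₁ + a₂) / 2)) :
    IsElliptoParabolic (hypProd a₁ a₂ Real.pi) := by
  have hτ := ha.one_lt_tauOf (φ := Real.pi) (by rw [Real.cos_pi]; exact hc)
  obtain ⟨p₂, hN, hF⟩ := exists_pair_hypProd hτ.le
  have hre := ha.chord_re_tauOf Real.pi
  rw [Real.cos_pi] at hre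
  have hsq := ha.lt_im_sq (τ := tauOf a₁ a₂ Real.pi) (by nlinarith)
  refine isElliptoParabolic_of_hyperbolic hN hF (τ := tauOf a₁ a₂ Real.pi) ?_ hτ.ne' (ε := -1)
    (by norm_num) hre ?_ ?_
  · rw [Real.sq_sqrt (by linarith)]; ring
  · intro h; rw [h, hre] at hsq; norm_num at hsq
  · rw [cis_sigma]
    intro h
    have h1 := congrArg Complex.re (mul_left_cancel₀ (hlf_ne_zero a₁ a₂) h)
    rw [cis_re, Complex.ofReal_re] at h1
    linarith

theorem mixProd_end (ha : Angles a₁ a₂) (hc : Real.cos (3 * (a₂ - a₁) / 2) < 1) :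
    IsElliptoParabolic (mixProd a₁ a₂ 0) := by
  have hτ := ha.tauOf_neg (φ := 0) (by rw [Real.cos_zero]; exact hc)
  obtain ⟨p₂, hN, hF⟩ := exists_pair_mixProd (a₁ := a₁) (a₂ := a₂) (φ := 0)
  have hre := ha.chord_re_tauOf 0
  rw [Real.cos_zero] at hre
  have hsq := ha.lt_im_sq (τ := tauOf a₁ a₂ 0) (by nlinarith)
  refine isElliptoParabolic_of_hyperbolic hN hF (τ := tauOf a₁ a₂ 0) ?_ (by linarith) (ε := 1)
    (by norm_num) hre ?_ ?_
  · rw [Real.sq_sqrt (by linarith)]; ring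
  · intro h; rw [h, hre] at hsq; norm_num at hsq
  · rw [cis_sigma]
    intro h
    exact ha.cis_sigma_ne_one
      (by simpa using (mul_left_cancel₀ (hlf_ne_zero a₁ a₂) h).symm)

/-- Sign of `sin Σ`. -/
theorem exists_sign (ha : Angles a₁ a₂) (hc : -1 < Real.cos (3 * (a₁ + a₂) / 2)) :
    ∃ e : ℝ, (e = 1 ∨ e = -1) ∧ 0 < e * Real.sin (3 * (a₁ + a₂) / 2) := by
  rcases lt_trichotomy (3 * (a₁ + a₂) / 2) Real.pi with h | h | h
  · exact ⟨1, Or.inl rfl, by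
      rw [one_mul]; exact Real.sin_pos_of_pos_of_lt_pi (by linarith [ha.pos1, ha.pos2]) h⟩
  · rw [h, Real.cos_pi] at hc; exact absurd hc (lt_irrefl _)
  · refine ⟨-1, Or.inr rfl, ?_⟩
    have : 0 < Real.sin (3 * (a₁ + a₂) / 2 - Real.pi) :=
      Real.sin_pos_of_pos_of_lt_pi (by linarith) (by linarith [ha.lt1, ha.lt2])
    rw [Real.sin_sub_pi] at this
    linarith

theorem negProd_self (ha : Angles a₁ a₂) {L : ℝ}
    (hL : Real.cos L = Real.cos (3 * (a₁ + a₂) / 2)) :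
    IsProduct (cis a₁) (cis a₂) ![0, 0, 1] ![0, 0, 1] (negProd a₁ a₂ L) := by
  have h1 := ha.tauOf_eq_one hL
  obtain ⟨p₂, hN, hF⟩ := exists_pair_negProd h1.ge
  rw [h1, Real.sqrt_one] at hN
  have e := hN.eq_neg_of_tangent
  have := hF.smul_centers (k₁ := 1) (k₂ := -1) one_ne_zero (by norm_num)
  rwa [neg_smul, one_smul, one_smul, ← e] at this

/-- At `τ = 1` the explicit family passes through coincident centers, not through tangent ones. This
is why `signedClasses_pos_pos` lists the tangent class separately. -/
theorem hypProd_self (ha : Angles a₁ a₂) {L : ℝ}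
    (hL : Real.cos L = Real.cos (3 * (a₁ + a₂) / 2)) :
    IsProduct (cis a₁) (cis a₂) ![1, 0, 0] ![1, 0, 0] (hypProd a₁ a₂ L) := by
  have h1 := ha.tauOf_eq_one hL
  have h2 := isProduct_normalProd a₁ a₂
    (normalPair_hyp (Real.arsinh (Real.sqrt (tauOf a₁ a₂ L - 1))))
  have h3 : hypProd a₁ a₂ L =
    normalProd a₁ a₂ (normalPair_hyp (Real.arsinh (Real.sqrt (tauOf a₁ a₂ L - 1)))) := rfl
  rw [← h3] at h2
  simpa [h1] using h2

theorem posProd_self (ha : Angles a₁ a₂) {L : ℝ}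
    (hL : Real.cos L = Real.cos (3 * (a₁ + a₂) / 2)) :
    IsProduct (cis a₁) (cis a₂) ![1, 0, 0] ![1, 0, 0] (posProd a₁ a₂ L) := by
  have h1 := ha.tauOf_eq_one hL
  have h2 := isProduct_normalProd a₁ a₂
    (normalPair_pos (Real.arccos (Real.sqrt (tauOf a₁ a₂ L))))
  have h3 : posProd a₁ a₂ L =
    normalProd a₁ a₂ (normalPair_pos (Real.arccos (Real.sqrt (tauOf a₁ a₂ L)))) := rfl
  rw [← h3] at h2
  simpa [h1] using h2

theorem isEllipticOrParabolic_self_pos {F : SU21} {α₁ α₂ : ℂ}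
    (hF : IsProduct α₁ α₂ ![1, 0, 0] ![1, 0, 0] F) : IsEllipticOrParabolic F := by
  refine isEllipticOrParabolic_of_neg (v := ![0, 0, 1]) (μ := α₂ * α₁) (by simp [herm]) ?_
  have h : herm ![0, 0, 1] ![1, 0, 0] = 0 := by simp [herm]
  rw [hF, R_orthogonal _ h, R_smul, R_orthogonal _ h, smul_smul, mul_comm]

theorem isEllipticOrParabolic_self_neg {F : SU21} {α₁ α₂ : ℂ}
    (hF : IsProduct α₁ α₂ ![0, 0, 1] ![0, 0, 1] F) : IsEllipticOrParabolic F := by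
  have h : herm ![0, 0, 1] ![0, 0, 1] ≠ 0 := by simp [herm]
  refine isEllipticOrParabolic_of_neg (v := ![0, 0, 1]) (by simp [herm]) ?_
    (μ := (α₁ ^ 2)⁻¹ * (α₂ ^ 2)⁻¹)
  rw [hF, R_self _ h, R_smul, R_self _ h, smul_smul]

end Angles

/-- Both centers negative. -/
theorem signedClasses_neg_neg {a₁ a₂ : ℝ} (ha : Angles a₁ a₂) {L : ℝ} (hL0 : 0 < L)
    (hLpi : L ≤ Real.pi) (hL : Real.cos L = Real.cos (3 * (a₁ + a₂) / 2)) :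
    signedClasses (cis a₁) (cis a₂) (-1) (-1) =
      (fun φ => cls (negProd a₁ a₂ φ)) '' Set.Icc L Real.pi := by
  ext c
  rw [mem_signedClasses_iff (by decide) (by decide)]
  constructor
  · rintro ⟨F, p₁, p₂, g, rfl, hE, hg, hN, hF⟩
    simp only [SignType.coe_neg_one] at hN
    obtain ⟨φ, hφ0, hφpi, hτ, hre⟩ := ha.exists_phi hN hF hE
    have hg1 := hN.one_le_of_neg
    have hτ' : tauOf a₁ a₂ φ = g ^ 2 := by rw [hτ]; ring
    refine ⟨φ, ⟨?_, hφpi⟩, ?_⟩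
    · rw [le_iff_cos_le hL0.le hLpi hφ0 hφpi, hre, hL, chord_re_eq_sub]
      have := ha.den_pos
      nlinarith
    -- The member of the family with the same `g` has the same Gram matrix, hence the same class.
    · obtain ⟨q₂, hN', hF'⟩ := exists_pair_negProd (hτ' ▸ hg1)
      rw [hτ', Real.sqrt_sq hg] at hN'
      exact hN'.cls_eq_neg hN hg hF' hF
  · rintro ⟨φ, ⟨h1, h2⟩, rfl⟩
    have hcos : Real.cos φ ≤ Real.cos (3 * (a₁ + a₂) / 2) := by
      rw [← hL]; exact (le_iff_cos_le hL0.le hLpi (hL0.le.trans h1) h2).1 h1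
    obtain ⟨q₂, hN', hF'⟩ := exists_pair_negProd (ha.one_le_tauOf hcos)
    refine ⟨_, _, _, _, rfl, ?_, Real.sqrt_nonneg _, by simpa using hN', hF'⟩
    rcases hcos.lt_or_eq with hlt | heq
    · have hc : -1 < Real.cos (3 * (a₁ + a₂) / 2) := (Real.neg_one_le_cos φ).trans_lt hlt
      rcases h2.lt_or_eq with h3 | h3
      · obtain ⟨e, he, hes⟩ := ha.exists_sign hc
        exact (ha.negProd_interior (hL0.trans_le h1) h3 hlt he hes
          (θ := (3 * (a₁ + a₂) / 2 + e * φ, 2 * (e * φ))) rfl rfl).1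
      · rw [h3]; exact Or.inr (Or.inr (ha.negProd_end hc).1)
    · exact Angles.isEllipticOrParabolic_self_neg (ha.negProd_self heq)

/-- The product with tangent centers. -/
def tangentProd (a₁ a₂ : ℝ) : SU21 := normalProd a₁ a₂ normalPair_tangent

theorem tangent_ne : (![1, 0, 0] : V) ≠ ![1, 1, 1] := by
  intro h; have := congrFun h 1; simp at this

/-- Both centers positive. -/
theorem signedClasses_pos_pos {a₁ a₂ : ℝ} (ha : Angles a₁ a₂) {L M : ℝ} (hL0 : 0 < L)
    (hLpi : L ≤ Real.pi) (hL : Real.cos L = Real.cos (3 * (a₁ + a₂) / 2)) (hM0 : 0 ≤ M)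
    (hMpi : M ≤ Real.pi) (hM : Real.cos M = Real.cos (3 * (a₂ - a₁) / 2)) :
    signedClasses (cis a₁) (cis a₂) 1 1 =
      (fun φ => cls (posProd a₁ a₂ φ)) '' Set.Icc M L ∪
      (fun φ => cls (hypProd a₁ a₂ φ)) '' Set.Icc L Real.pi ∪ {cls (tangentProd a₁ a₂)} := by
  have hden := ha.den_pos
  ext c
  rw [mem_signedClasses_iff (by decide) (by decide)]
  constructor
  · rintro ⟨F, p₁, p₂, g, rfl, hE, hg, hN, hF⟩
    simp only [SignType.coe_one] at hN
    obtain ⟨φ, hφ0, hφpi, hτ, hre⟩ := ha.exists_phi hN hF hE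
    have hτ' : tauOf a₁ a₂ φ = g ^ 2 := by rw [hτ]; ring
    rw [← hτ, hτ', chord_re_eq_sub] at hre
    -- Apart from tangent pairs, a positive pair with `g ≤ 1` matches the definite family and one
    -- with `g ≥ 1` the hyperbolic family; both contain coincident centers.
    by_cases ht : g = 1 ∧ p₁ ≠ p₂
    · right
      obtain ⟨rfl, hne⟩ := ht
      exact hN.cls_eq_tangent hne normalPair_tangent tangent_ne hF (isProduct_normalProd _ _ _)
    · left
      push Not at ht
      rcases le_total (g ^ 2) 1 with h1 | h1
      · left
        refine ⟨φ, ⟨?_, ?_⟩, ?_⟩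
        · rw [le_iff_cos_le hM0 hMpi hφ0 hφpi, hre, hM]; nlinarith [sq_nonneg g]
        · rw [le_iff_cos_le hφ0 hφpi hL0.le hLpi, hre, hL]; nlinarith
        · obtain ⟨q₂, hN', hF'⟩ := exists_pair_posProd (hτ' ▸ h1)
          by_cases hg1 : g = 1
          · subst hg1
            have hs := ha.posProd_self (L := φ) (by rw [hre]; ring)
            have hp := ht rfl
            subst hp
            exact cls_eq_of_self hN.sq1 normalPair_tangent.h11 hN.h11 hs hF
          · rw [hτ', Real.sqrt_sq hg] at hN'
            exact hN'.cls_eq_pos hN hg (fun h => absurd h hg1) hF' hF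
      · right
        refine ⟨φ, ⟨?_, hφpi⟩, ?_⟩
        · rw [le_iff_cos_le hL0.le hLpi hφ0 hφpi, hre, hL]; nlinarith
        · obtain ⟨q₂, hN', hF'⟩ := exists_pair_hypProd (hτ' ▸ h1)
          by_cases hg1 : g = 1
          · subst hg1
            have hs := ha.hypProd_self (L := φ) (by rw [hre]; ring)
            have hp := ht rfl
            subst hp
            exact cls_eq_of_self hN.sq1 normalPair_tangent.h11 hN.h11 hs hF
          · rw [hτ', Real.sqrt_sq hg] at hN'
            exact hN'.cls_eq_pos hN hg (fun h => absurd h hg1) hF' hF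
  · rintro ((⟨φ, ⟨h1, h2⟩, rfl⟩ | ⟨φ, ⟨h1, h2⟩, rfl⟩) | rfl)
    · have hφpi := h2.trans hLpi
      have hφ0 := hM0.trans h1
      have hcos : Real.cos (3 * (a₁ + a₂) / 2) ≤ Real.cos φ := by
        rw [← hL]; exact (le_iff_cos_le hφ0 hφpi hL0.le hLpi).1 h2
      have hcos' : Real.cos φ ≤ Real.cos (3 * (a₂ - a₁) / 2) := by
        rw [← hM]; exact (le_iff_cos_le hM0 hMpi hφ0 hφpi).1 h1
      obtain ⟨q₂, hN', hF'⟩ := exists_pair_posProd (ha.tauOf_le_one hcos)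
      refine ⟨_, _, _, _, rfl, ?_, Real.sqrt_nonneg _, by simpa using hN', hF'⟩
      rcases hcos.lt_or_eq with hlt | heq
      · rcases hcos'.lt_or_eq with hlt' | heq'
        · have k0 : 0 < φ := by
            rcases hφ0.lt_or_eq with h | h
            · exact h
            · rw [← h, Real.cos_zero] at hlt'
              exact absurd (Real.cos_le_one _) (not_le.2 hlt')
          have kpi : φ < Real.pi := by
            rcases hφpi.lt_or_eq with h | h
            · exact h
            · rw [h, Real.cos_pi] at hlt
              exact absurd (Real.neg_one_le_cos _) (not_le.2 hlt)
          exact (ha.posProd_interior k0 kpi hlt hlt'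
            (θ := (-(3 * (a₁ + a₂) / 2) + φ, -(3 * (a₁ + a₂) / 2) - φ)) rfl rfl).1
        · rw [tauOf_eq_zero heq', Real.sqrt_zero] at hN'
          exact (cls_of_orthogonal_pos hN' hF' (θ := (-(3 * a₁), -(3 * a₂))) rfl rfl).1
      · exact Angles.isEllipticOrParabolic_self_pos (ha.posProd_self heq.symm)
    · have hcos : Real.cos φ ≤ Real.cos (3 * (a₁ + a₂) / 2) := by
        rw [← hL]; exact (le_iff_cos_le hL0.le hLpi (hL0.le.trans h1) h2).1 h1
      obtain ⟨q₂, hN', hF'⟩ := exists_pair_hypProd (ha.one_le_tauOf hcos)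
      refine ⟨_, _, _, _, rfl, ?_, Real.sqrt_nonneg _, by simpa using hN', hF'⟩
      rcases hcos.lt_or_eq with hlt | heq
      · have hc : -1 < Real.cos (3 * (a₁ + a₂) / 2) := (Real.neg_one_le_cos φ).trans_lt hlt
        rcases h2.lt_or_eq with h3 | h3
        · obtain ⟨e, he, hes⟩ := ha.exists_sign hc
          exact (ha.hypProd_interior (hL0.trans_le h1) h3 hlt he hes
            (θ := (3 * (a₁ + a₂) / 2 - e * φ, -(2 * (e * φ)))) rfl rfl).1
        · rw [h3]; exact Or.inr (Or.inr (ha.hypProd_end hc).1)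
      · exact Angles.isEllipticOrParabolic_self_pos (ha.hypProd_self heq)
    · have hF := isProduct_normalProd a₁ a₂ normalPair_tangent
      exact ⟨_, _, _, _, rfl, Or.inr (Or.inr (isParabolic_tangent normalPair_tangent tangent_ne hF
        ha.bet1 ha.bet2)), zero_le_one, by simpa using normalPair_tangent, hF⟩

/-- A positive and a negative center. -/
theorem signedClasses_pos_neg {a₁ a₂ : ℝ} (ha : Angles a₁ a₂) {M : ℝ} (hM0 : 0 ≤ M)
    (hMpi : M < Real.pi) (hM : Real.cos M = Real.cos (3 * (a₂ - a₁) / 2))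
    (hsin : M ≠ 0 → ∃ e : ℝ, (e = 1 ∨ e = -1) ∧ 0 < e * Real.sin (3 * (a₂ - a₁) / 2)) :
    signedClasses (cis a₁) (cis a₂) 1 (-1) =
      (fun φ => cls (mixProd a₁ a₂ φ)) '' Set.Icc 0 M := by
  have hden := ha.den_pos
  ext c
  rw [mem_signedClasses_iff (by decide) (by decide)]
  constructor
  · rintro ⟨F, p₁, p₂, g, rfl, hE, hg, hN, hF⟩
    simp only [SignType.coe_neg_one, SignType.coe_one] at hN
    obtain ⟨φ, hφ0, hφpi, hτ, hre⟩ := ha.exists_phi hN hF hE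
    have hτ' : tauOf a₁ a₂ φ = -g ^ 2 := by rw [hτ]; ring
    refine ⟨φ, ⟨hφ0, ?_⟩, ?_⟩
    · rw [le_iff_cos_le hφ0 hφpi hM0 hMpi.le, hre, hM, chord_re_eq_sub]
      nlinarith [sq_nonneg g]
    · obtain ⟨q₂, hN', hF'⟩ := exists_pair_mixProd (a₁ := a₁) (a₂ := a₂) (φ := φ)
      rw [hτ', neg_neg, Real.sqrt_sq hg] at hN'
      -- With opposite signs the Gram determinant `-1 - g²` never vanishes, so no degenerate case
      -- arises.
      exact hN'.cls_eq hN (by nlinarith) hF' hF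
  · rintro ⟨φ, ⟨h1, h2⟩, rfl⟩
    have hφpi := h2.trans_lt hMpi
    have hcos : Real.cos (3 * (a₂ - a₁) / 2) ≤ Real.cos φ := by
      rw [← hM]; exact (le_iff_cos_le h1 hφpi.le hM0 hMpi.le).1 h2
    obtain ⟨q₂, hN', hF'⟩ := exists_pair_mixProd (a₁ := a₁) (a₂ := a₂) (φ := φ)
    refine ⟨_, _, _, _, rfl, ?_, Real.sqrt_nonneg _, by simpa using hN', hF'⟩
    rcases hcos.lt_or_eq with hlt | heq
    · have hM1 : M ≠ 0 := by
        rintro rfl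
        rw [← hM, Real.cos_zero] at hlt
        exact absurd (Real.cos_le_one _) (not_le.2 hlt)
      rcases h1.lt_or_eq with h3 | h3
      · obtain ⟨e, he, hes⟩ := hsin hM1
        exact (ha.mixProd_interior h3 hφpi hlt he hes
          (θ := (3 * (a₁ + a₂) / 2 + e * φ, 2 * (e * φ))) rfl rfl).1
      · rw [← h3] at hlt ⊢
        rw [Real.cos_zero] at hlt
        exact Or.inr (Or.inr (ha.mixProd_end hlt).1)
    · rw [tauOf_eq_zero heq.symm, neg_zero, Real.sqrt_zero] at hN'
      exact (cls_of_orthogonal_mixed hN' hF' (θ := (3 * a₂, 3 * (a₂ - a₁))) rfl rfl).1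

/-! ### Segments of angle pairs -/

theorem segment_eq_image_line {θ : ℝ → ℝ × ℝ} {k₁ k₂ m₁ m₂ : ℝ}
    (hθ : ∀ φ, θ φ = (k₁ + φ * m₁, k₂ + φ * m₂)) {l r : ℝ} (hlr : l ≤ r) :
    segment ℝ (θ l) (θ r) = θ '' Set.Icc l r := by
  let f : ℝ →ᵃ[ℝ] ℝ × ℝ :=
    AffineMap.const ℝ ℝ (k₁, k₂) + (LinearMap.toSpanSingleton ℝ (ℝ × ℝ) (m₁, m₂)).toAffineMap
  have hf : ⇑f = θ := by
    funext φ
    rw [hθ]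
    ext <;> simp [f]
  rw [← hf, ← image_segment, segment_eq_Icc hlr]

theorem convex_triangle : Convex ℝ triangle := by
  rintro x ⟨hx0, hx1, hx2⟩ y ⟨hy0, hy1, hy2⟩ a b ha hb hab
  refine ⟨?_, ?_, ?_⟩
  · simp only [Prod.snd_add, Prod.smul_snd, smul_eq_mul]; positivity
  · simp only [Prod.snd_add, Prod.smul_snd, Prod.fst_add, Prod.smul_fst, smul_eq_mul]
    nlinarith [mul_le_mul_of_nonneg_left hx1 ha, mul_le_mul_of_nonneg_left hy1 hb]
  · simp only [Prod.fst_add, Prod.smul_fst, smul_eq_mul]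
    have h := mul_le_mul_of_nonneg_left hx2 ha
    have h' := mul_le_mul_of_nonneg_left hy2 hb
    have : a * (2 * Real.pi) + b * (2 * Real.pi) = 2 * Real.pi := by rw [← add_mul, hab, one_mul]
    linarith

/-- Points of the triangle off the glued sides. -/
def Inner (θ : ℝ × ℝ) : Prop := 0 < θ.2 ∧ θ.1 < 2 * Real.pi

/-- At most one parameter, `q`, may land on the glued sides. Of two different parameters at least
one is off them, and this suffices for `eq_of_point_eq`. -/
theorem injOn_point {θ : ℝ → ℝ × ℝ} {l r q : ℝ} (hinj : Function.Injective θ)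
    (hT : ∀ φ ∈ Set.Icc l r, θ φ ∈ triangle) (hI : ∀ φ ∈ Set.Icc l r, φ ≠ q → Inner (θ φ)) :
    Set.InjOn (fun φ => point (θ φ)) (Set.Icc l r) := by
  intro x hx y hy hxy
  by_cases h : y = q
  · by_cases h' : x = q
    · rw [h, h']
    · exact (hinj (eq_of_point_eq (hT y hy) (hT x hx) (hI x hx h').1 (hI x hx h').2 hxy.symm)).symm
  · exact hinj (eq_of_point_eq (hT x hx) (hT y hy) (hI y hy h).1 (hI y hy h).2 hxy)

theorem lyingOver_image {C : ℝ → ClassSpace} {θ : ℝ → ℝ × ℝ} {l r : ℝ}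
    (hC : ∀ φ ∈ Set.Icc l r, rho (C φ) = point (θ φ))
    (hinj : Set.InjOn (fun φ => point (θ φ)) (Set.Icc l r)) {x : ℝ} (hx : x ∈ Set.Icc l r) :
    lyingOver (C '' Set.Icc l r) (θ x) = {C x} := by
  ext c
  constructor
  · rintro ⟨⟨φ, hφ, rfl⟩, h⟩
    rw [hC φ hφ] at h
    rw [hinj hφ hx h]; rfl
  · rintro rfl
    exact ⟨⟨x, hx, rfl⟩, hC x hx⟩

theorem rho_image {C : ℝ → ClassSpace} {θ : ℝ → ℝ × ℝ} {k₁ k₂ m₁ m₂ : ℝ}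
    (hθ : ∀ φ, θ φ = (k₁ + φ * m₁, k₂ + φ * m₂)) {l r : ℝ} (hlr : l ≤ r)
    (hC : ∀ φ ∈ Set.Icc l r, rho (C φ) = point (θ φ)) :
    rho '' (C '' Set.Icc l r) = seg (θ l) (θ r) := by
  rw [seg, segment_eq_image_line hθ hlr, Set.image_image, Set.image_image]
  exact Set.image_congr hC

theorem not_singleton_image {C : ℝ → ClassSpace} {θ : ℝ → ℝ × ℝ} {l r : ℝ} (hlr : l < r)
    (hC : ∀ φ ∈ Set.Icc l r, rho (C φ) = point (θ φ))
    (hinj : Set.InjOn (fun φ => point (θ φ)) (Set.Icc l r)) :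
    ¬ ∃ x, rho '' (C '' Set.Icc l r) = {x} := by
  rintro ⟨x, hx⟩
  have hl : l ∈ Set.Icc l r := Set.left_mem_Icc.2 hlr.le
  have hr : r ∈ Set.Icc l r := Set.right_mem_Icc.2 hlr.le
  have h1 : rho (C l) ∈ rho '' (C '' Set.Icc l r) := ⟨_, ⟨l, hl, rfl⟩, rfl⟩
  have h2 : rho (C r) ∈ rho '' (C '' Set.Icc l r) := ⟨_, ⟨r, hr, rfl⟩, rfl⟩
  rw [hx, Set.mem_singleton_iff] at h1 h2
  rw [hC l hl] at h1
  rw [hC r hr] at h2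
  exact hlr.ne (hinj hl hr (h1.trans h2.symm))

theorem cls_one_eq {θ : ℝ × ℝ} (h1 : cis θ.1 = 1) (h2 : cis θ.2 = 1) :
    cls (angleElement θ) = cls 1 := by
  have h : angleElement (0, 0) = 1 := by
    apply mat_injective
    rw [mat_angleElement, mat_one, ← Matrix.diagonal_one]
    congr 1
    funext i
    fin_cases i <;> simp [angleEntries]
  rw [← h]
  exact cls_angleElement_eq (by rw [h1]; exact cis_zero.symm) (by rw [h2]; exact cis_zero.symm)

/-! ### Both centers negative -/

theorem sin_sigma_pos {a₁ a₂ : ℝ} (ha : Angles a₁ a₂) (h : 3 * (a₁ + a₂) / 2 < Real.pi) :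
    0 < (1 : ℝ) * Real.sin (3 * (a₁ + a₂) / 2) := by
  rw [one_mul]; exact Real.sin_pos_of_pos_of_lt_pi (by linarith [ha.pos1, ha.pos2]) h

theorem sin_sigma_neg {a₁ a₂ : ℝ} (ha : Angles a₁ a₂) (h : Real.pi < 3 * (a₁ + a₂) / 2) :
    0 < (-1 : ℝ) * Real.sin (3 * (a₁ + a₂) / 2) := by
  have : 0 < Real.sin (3 * (a₁ + a₂) / 2 - Real.pi) :=
    Real.sin_pos_of_pos_of_lt_pi (by linarith) (by linarith [ha.lt1, ha.lt2])
  rw [Real.sin_sub_pi] at this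
  linarith

theorem cis_two_sigma_ne_one {a₁ a₂ : ℝ} (ha : Angles a₁ a₂) (h : 3 * (a₁ + a₂) / 2 ≠ Real.pi) :
    (cis a₁ * cis a₂) ^ 3 ≠ 1 := by
  rw [Angles.cis_sigma_sq]
  intro h1
  apply h
  have := eq_of_exp_eq (a := 2 * (3 * (a₁ + a₂) / 2)) (b := 2 * Real.pi)
    (h1.trans cis_two_pi.symm) (by linarith [ha.lt1, ha.lt2]) (by linarith [ha.pos1, ha.pos2])
  linarith

theorem cis_two_sigma_eq_one {a₁ a₂ : ℝ} (h : 3 * (a₁ + a₂) / 2 = Real.pi) :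
    (cis a₁ * cis a₂) ^ 3 = 1 := by
  rw [Angles.cis_sigma_sq, h, cis_two_pi]

/-- The conclusions on negative centers when the parameter interval is nondegenerate. -/
theorem neg_generic {a₁ a₂ : ℝ} (ha : Angles a₁ a₂) {L e : ℝ} (hL0 : 0 < L) (hLpi : L < Real.pi)
    (hL : Real.cos L = Real.cos (3 * (a₁ + a₂) / 2)) (he : e = 1 ∨ e = -1)
    (hes : 0 < e * Real.sin (3 * (a₁ + a₂) / 2)) {θ : ℝ → ℝ × ℝ} {k₁ k₂ m₁ m₂ : ℝ}
    (hθ : ∀ φ, θ φ = (k₁ + φ * m₁, k₂ + φ * m₂)) (hm : m₁ ≠ 0)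
    (hc : ∀ φ, (cis (θ φ).1 = cis (3 * (a₁ + a₂) / 2 + e * φ) ∧ cis (θ φ).2 = cis (2 * (e * φ))) ∨
      (cis (θ φ).2 = cis (3 * (a₁ + a₂) / 2 + e * φ) ∧ cis (θ φ).1 = cis (2 * (e * φ))))
    (hT : ∀ φ ∈ Set.Icc L Real.pi, θ φ ∈ triangle)
    (hI : ∀ φ ∈ Set.Icc L Real.pi, φ ≠ Real.pi → Inner (θ φ)) :
    segment ℝ (θ L) (θ Real.pi) ⊆ triangle ∧
    signedSet (cis a₁) (cis a₂) (-1) (-1) = seg (θ L) (θ Real.pi) ∧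
    ((∃ x, signedSet (cis a₁) (cis a₂) (-1) (-1) = {x}) →
      signedClasses (cis a₁) (cis a₂) (-1) (-1) = {cls 1}) ∧
    ((¬ ∃ x, signedSet (cis a₁) (cis a₂) (-1) (-1) = {x}) →
      (∃ c ∈ classesOf (IsSpecialElliptic (-1)),
        lyingOver (signedClasses (cis a₁) (cis a₂) (-1) (-1)) (θ L) = {c}) ∧
      (∃ c ∈ classesOf IsElliptoParabolic,
        lyingOver (signedClasses (cis a₁) (cis a₂) (-1) (-1)) (θ Real.pi) = {c})) := by
  have hlm : L ∈ Set.Icc L Real.pi := Set.left_mem_Icc.2 hLpi.le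
  have hrm : Real.pi ∈ Set.Icc L Real.pi := Set.right_mem_Icc.2 hLpi.le
  have hcont : Continuous θ := by
    rw [funext hθ]; fun_prop
  have hinj' : Function.Injective θ := by
    intro x y hxy
    rw [hθ, hθ, Prod.mk.injEq] at hxy
    exact mul_right_cancel₀ hm (add_left_cancel hxy.1)
  have hC : ∀ φ ∈ Set.Icc L Real.pi, rho (cls (negProd a₁ a₂ φ)) = point (θ φ) := by
    refine rho_cls_eq_point (continuous_negProd a₁ a₂) hcont hLpi ?_
    rintro φ ⟨h1, h2⟩
    have h0 := hL0.trans h1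
    have hlt : Real.cos φ < Real.cos (3 * (a₁ + a₂) / 2) := by
      rw [← hL]; exact Real.cos_lt_cos_of_nonneg_of_le_pi hL0.le h2.le h1
    -- The two angles may have to be listed in the opposite order to obey `θ₂ ≤ θ₁`; the class does
    -- not depend on the order.
    rcases hc φ with ⟨c1, c2⟩ | ⟨c1, c2⟩
    · exact (ha.negProd_interior h0 h2 hlt he hes c1 c2).2
    · rw [(ha.negProd_interior h0 h2 hlt he hes (θ := ((θ φ).2, (θ φ).1)) c1 c2).2]
      exact cls_angleElement_swap rfl rfl
  have hinj := injOn_point hinj' hT hI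
  have hD := signedClasses_neg_neg ha hL0 hLpi.le hL
  have hns := not_singleton_image hLpi hC hinj
  have hLne : 3 * (a₁ + a₂) / 2 ≠ Real.pi := by
    intro h
    rw [h, Real.cos_pi] at hL
    have := Real.cos_lt_cos_of_nonneg_of_le_pi hL0.le le_rfl hLpi
    rw [hL, Real.cos_pi] at this
    exact lt_irrefl _ this
  have hcm : -1 < Real.cos (3 * (a₁ + a₂) / 2) := by
    rw [← hL, ← Real.cos_pi]; exact Real.cos_lt_cos_of_nonneg_of_le_pi hL0.le le_rfl hLpi
  refine ⟨convex_triangle.segment_subset (hT L hlm) (hT _ hrm), ?_, ?_, fun _ => ⟨?_, ?_⟩⟩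
  · rw [signedSet, hD, rho_image hθ hLpi.le hC]
  · rw [signedSet, hD]; exact fun h => absurd h hns
  · refine ⟨_, ⟨negProd a₁ a₂ L, rfl, ?_⟩, ?_⟩
    · exact isSpecialElliptic_of_self (norm_cis _) (norm_cis _) (cis_two_sigma_ne_one ha hLne)
        (by rw [sgn_of_herm_neg_one (normalPair_neg 0).h11]; decide)
        (sgn_of_herm_neg_one (normalPair_neg 0).h11) (ha.negProd_self hL)
    · rw [hD]; exact lyingOver_image hC hinj hlm
  · refine ⟨_, ⟨negProd a₁ a₂ Real.pi, rfl, ha.negProd_end hcm⟩, ?_⟩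
    rw [hD]; exact lyingOver_image hC hinj hrm

theorem neg_part {a₁ a₂ : ℝ} (ha : Angles a₁ a₂) (P Q : ℝ × ℝ)
    (h : a₁ + a₂ ≤ 2 * Real.pi / 3 ∧
          P = (3 * a₁ + 3 * a₂, 3 * a₁ + 3 * a₂) ∧
          Q = (2 * Real.pi, Real.pi + 3 * (a₁ + a₂) / 2) ∨
        2 * Real.pi / 3 < a₁ + a₂ ∧
          P = (3 * (a₁ + a₂) - 2 * Real.pi, 3 * (a₁ + a₂) - 2 * Real.pi) ∧
          Q = (3 * (a₁ + a₂) / 2 - Real.pi, 0)) :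
    segment ℝ P Q ⊆ triangle ∧
    signedSet (cis a₁) (cis a₂) (-1) (-1) = seg P Q ∧
    ((∃ x, signedSet (cis a₁) (cis a₂) (-1) (-1) = {x}) →
      signedClasses (cis a₁) (cis a₂) (-1) (-1) = {cls 1}) ∧
    ((¬ ∃ x, signedSet (cis a₁) (cis a₂) (-1) (-1) = {x}) →
      (∃ c ∈ classesOf (IsSpecialElliptic (-1)),
        lyingOver (signedClasses (cis a₁) (cis a₂) (-1) (-1)) P = {c}) ∧
      (∃ c ∈ classesOf IsElliptoParabolic,
        lyingOver (signedClasses (cis a₁) (cis a₂) (-1) (-1)) Q = {c})) := by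
  have hpi := Real.pi_pos
  obtain ⟨q1, q2, q3, q4⟩ := ha
  have ha : Angles a₁ a₂ := ⟨q1, q2, q3, q4⟩
  rcases h with ⟨hs, rfl, rfl⟩ | ⟨hs, rfl, rfl⟩
  · rcases hs.lt_or_eq with hs | hs
    · have hlt : 3 * (a₁ + a₂) / 2 < Real.pi := by linarith
      -- For `Σ < π` the interval starts at `L = Σ` and `sin Σ > 0`. The angle `2φ` is the larger
      -- one because `φ ≥ Σ`.
      have := neg_generic ha (L := 3 * (a₁ + a₂) / 2) (e := 1) (by linarith) hlt rfl (Or.inl rfl)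
        (sin_sigma_pos ha hlt) (θ := fun φ => (2 * φ, 3 * (a₁ + a₂) / 2 + φ))
        (k₁ := 0) (m₁ := 2) (k₂ := 3 * (a₁ + a₂) / 2) (m₂ := 1)
        (fun φ => by ext <;> simp; ring) (by norm_num)
        (fun φ => Or.inr ⟨by simp, by simp⟩)
        (fun φ hφ => ⟨by linarith [hφ.1], by linarith [hφ.1], by linarith [hφ.2]⟩)
        (fun φ hφ hne => ⟨by linarith [hφ.1], by
          have := lt_of_le_of_ne hφ.2 hne; simp only; linarith⟩)
      have e1 : ((3 * a₁ + 3 * a₂, 3 * a₁ + 3 * a₂) : ℝ × ℝ) =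
          (2 * (3 * (a₁ + a₂) / 2), 3 * (a₁ + a₂) / 2 + 3 * (a₁ + a₂) / 2) := by
        ext <;> simp <;> ring
      rw [e1, add_comm Real.pi]
      exact this
    -- Here the interval shrinks to `φ = π`, where the centers coincide and `(α₁α₂)³ = 1`, so the
    -- product is a scalar.
    · have hS : 3 * (a₁ + a₂) / 2 = Real.pi := by linarith
      have e1 : ((3 * a₁ + 3 * a₂, 3 * a₁ + 3 * a₂) : ℝ × ℝ) = (2 * Real.pi, 2 * Real.pi) := by
        ext <;> simp <;> linarith
      have e2 : ((2 * Real.pi, Real.pi + 3 * (a₁ + a₂) / 2) : ℝ × ℝ) =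
          (2 * Real.pi, 2 * Real.pi) := by
        ext <;> simp; linarith
      have hcos : Real.cos Real.pi = Real.cos (3 * (a₁ + a₂) / 2) := by rw [hS]
      have hD := signedClasses_neg_neg ha hpi le_rfl hcos
      rw [Set.Icc_self, Set.image_singleton, cls_eq_one_of_self (cis_two_sigma_eq_one hS)
        (normalPair_neg 0).ne1 (ha.negProd_self hcos)] at hD
      have hset : signedSet (cis a₁) (cis a₂) (-1) (-1) = {rho (cls 1)} := by
        rw [signedSet, hD, Set.image_singleton]
      rw [e1, e2, segment_same]
      refine ⟨?_, ?_, fun _ => hD, fun h => absurd ⟨_, hset⟩ h⟩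
      · rintro x rfl; exact ⟨by simp only; positivity, le_rfl, le_rfl⟩
      · rw [hset, seg, segment_same, Set.image_singleton, point, cls_one_eq cis_two_pi cis_two_pi]
  · have hlt : Real.pi < 3 * (a₁ + a₂) / 2 := by linarith
    -- For `Σ > π` the number in `[0,π]` with cosine `cos Σ` is `2π - Σ`, and `sin Σ < 0`; the
    -- second angle `-2φ` is shifted by `2π` into the triangle.
    have := neg_generic ha (L := 2 * Real.pi - 3 * (a₁ + a₂) / 2) (e := -1) (by linarith)
      (by linarith) (Real.cos_two_pi_sub _) (Or.inr rfl)
      (sin_sigma_neg ha hlt) (θ := fun φ => (3 * (a₁ + a₂) / 2 - φ, 2 * Real.pi - 2 * φ))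
      (k₁ := 3 * (a₁ + a₂) / 2) (m₁ := -1) (k₂ := 2 * Real.pi) (m₂ := -2)
      (fun φ => by ext <;> simp <;> ring) (by norm_num)
      (fun φ => Or.inl ⟨by congr 1; ring, by
        simp only; rw [cis_two_pi_sub]; congr 1; ring⟩)
      (fun φ hφ => ⟨by simp only; linarith [hφ.2], by simp only; linarith [hφ.1],
        by simp only; linarith [hφ.1]⟩)
      (fun φ hφ hne => ⟨by
        have := lt_of_le_of_ne hφ.2 hne; simp only; linarith, by simp only; linarith [hφ.1]⟩)
    have e1 : ((3 * (a₁ + a₂) - 2 * Real.pi, 3 * (a₁ + a₂) - 2 * Real.pi) : ℝ × ℝ) =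
        (3 * (a₁ + a₂) / 2 - (2 * Real.pi - 3 * (a₁ + a₂) / 2),
          2 * Real.pi - 2 * (2 * Real.pi - 3 * (a₁ + a₂) / 2)) := by
      ext <;> simp <;> ring
    have e2 : ((3 * (a₁ + a₂) / 2 - Real.pi, 0) : ℝ × ℝ) =
        (3 * (a₁ + a₂) / 2 - Real.pi, 2 * Real.pi - 2 * Real.pi) := by simp
    rw [e1, e2]
    exact this

/-! ### Centers of different signatures -/

theorem isEllipticOrParabolic_conj {F G B : SU21} (h : mat G * mat B = mat B * mat F)
    (hF : IsEllipticOrParabolic F) : IsEllipticOrParabolic G := by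
  have h' : mat F * mat B⁻¹ = mat B⁻¹ * mat G := by
    calc mat F * mat B⁻¹ = mat B⁻¹ * (mat B * mat F) * mat B⁻¹ := by
          rw [← Matrix.mul_assoc, mat_inv_mul, one_mul]
      _ = mat B⁻¹ * mat G := by
          rw [← h, Matrix.mul_assoc, Matrix.mul_assoc, mat_mul_inv, mul_one]
  have push : ∀ {A A' C : SU21}, mat A' * mat C = mat C * mat A → ∀ {v : V}, Fixes A v →
      Fixes A' (mat C *ᵥ v) := by
    rintro A A' C hAC v ⟨hv, μ, hμ⟩
    refine ⟨fun h0 => hv ?_, μ, ?_⟩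
    · have : mat C⁻¹ *ᵥ (mat C *ᵥ v) = v := by
        rw [Matrix.mulVec_mulVec, mat_inv_mul, Matrix.one_mulVec]
      rw [← this, h0, Matrix.mulVec_zero]
    · rw [Matrix.mulVec_mulVec, hAC, ← Matrix.mulVec_mulVec, hμ, Matrix.mulVec_smul]
  have hsgn : ∀ (C : SU21) (v : V), sgn (mat C *ᵥ v) = sgn v := by
    intro C v; rw [sgn, isIsom_mat C, sgn]
  have triv : IsTrivial G → IsTrivial F := by
    rintro ⟨δ, hδ⟩
    refine ⟨δ, ?_⟩
    calc mat F = mat B⁻¹ * (mat B * mat F) := by rw [← Matrix.mul_assoc, mat_inv_mul, one_mul]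
      _ = δ • 1 := by rw [← h, hδ, smul_mul_assoc, one_mul, mul_smul_comm, mat_inv_mul]
  rcases hF with ⟨δ, hδ⟩ | ⟨ht, v, hv, hfix⟩ | ⟨ht, v, hv, hfix, huniq⟩
  · left
    refine ⟨δ, ?_⟩
    calc mat G = mat G * mat B * mat B⁻¹ := by rw [Matrix.mul_assoc, mat_mul_inv, mul_one]
      _ = δ • 1 := by rw [h, hδ, mul_smul_comm, mul_one, smul_mul_assoc, mat_mul_inv]
  · exact Or.inr (Or.inl ⟨fun h0 => ht (triv h0), _, (hsgn B v).trans hv, push h hfix⟩)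
  · refine Or.inr (Or.inr ⟨fun h0 => ht (triv h0), _, (hsgn B v).trans hv, push h hfix, ?_⟩)
    intro w hw hwf
    obtain ⟨δ, hδ⟩ := huniq (mat B⁻¹ *ᵥ w) ((hsgn _ w).trans hw) (push h' hwf)
    refine ⟨δ, ?_⟩
    rw [← Matrix.mulVec_smul, ← hδ, Matrix.mulVec_mulVec, mat_mul_inv, Matrix.one_mulVec]

/-- The isometry `R_{α₁}^{p₁}` conjugates `R_{α₂}^{p₂}R_{α₁}^{p₁}` to the product in the opposite
order, which has the parameters and centers interchanged. -/
theorem signedClasses_swap_subset {α₁ α₂ : ℂ} (h₁ : ‖α₁‖ = 1) (h₂ : ‖α₂‖ = 1)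
    (σ₁ σ₂ : SignType) : signedClasses α₁ α₂ σ₁ σ₂ ⊆ signedClasses α₂ α₁ σ₂ σ₁ := by
  rintro c ⟨F, rfl, hE, p₁, p₂, n1, n2, e1, e2, hF⟩
  have hp₁ := herm_self_ne_zero_of_sgn n1
  have hp₂ := herm_self_ne_zero_of_sgn n2
  rw [hF.eq_prodRefl h₁ h₂ hp₁ hp₂] at hE ⊢
  refine ⟨prodRefl α₂ α₁ h₂ h₁ p₂ p₁ hp₂ hp₁, cls_mul_comm _ _, ?_, p₂, p₁, n2, n1, e2, e1,
    isProduct_prodRefl h₂ h₁ hp₂ hp₁⟩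
  refine isEllipticOrParabolic_conj (B := refl α₁ h₁ p₁ hp₁) ?_ hE
  rw [← mat_mul, ← mat_mul, prodRefl, prodRefl, mul_assoc]

theorem signedClasses_swap {α₁ α₂ : ℂ} (h₁ : ‖α₁‖ = 1) (h₂ : ‖α₂‖ = 1) (σ₁ σ₂ : SignType) :
    signedClasses α₁ α₂ σ₁ σ₂ = signedClasses α₂ α₁ σ₂ σ₁ :=
  (signedClasses_swap_subset h₁ h₂ σ₁ σ₂).antisymm (signedClasses_swap_subset h₂ h₁ σ₂ σ₁)

theorem cls_mixProd_orthogonal {a₁ a₂ M : ℝ}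
    (hM : Real.cos M = Real.cos (3 * (a₂ - a₁) / 2)) :
    cls (mixProd a₁ a₂ M) = cls (angleElement (3 * a₂, 3 * (a₂ - a₁))) := by
  obtain ⟨q₂, hN, hF⟩ := exists_pair_mixProd (a₁ := a₁) (a₂ := a₂) (φ := M)
  rw [tauOf_eq_zero hM, neg_zero, Real.sqrt_zero] at hN
  exact (cls_of_orthogonal_mixed hN hF rfl rfl).2

/-- Here `M = |D|`. The end `φ = M` is `τ = 0`, orthogonal centers; the end `φ = 0` has the double
eigenvalue `h`. If `M = 0` the interval is a point and only orthogonal centers remain, which happens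
exactly when the parameters agree. -/
theorem mix_generic {a₁ a₂ : ℝ} (ha : Angles a₁ a₂) {M e : ℝ} (hM0 : 0 ≤ M) (hMpi : M < Real.pi)
    (hM : Real.cos M = Real.cos (3 * (a₂ - a₁) / 2)) (he : e = 1 ∨ e = -1)
    (heM : e * M = 3 * (a₂ - a₁) / 2)
    (hes : M ≠ 0 → 0 < e * Real.sin (3 * (a₂ - a₁) / 2)) {θ : ℝ → ℝ × ℝ} {k₁ k₂ m₁ m₂ : ℝ}
    (hθ : ∀ φ, θ φ = (k₁ + φ * m₁, k₂ + φ * m₂)) (hm : m₁ ≠ 0)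
    (hc : ∀ φ, (cis (θ φ).1 = cis (3 * (a₁ + a₂) / 2 + e * φ) ∧ cis (θ φ).2 = cis (2 * (e * φ))) ∨
      (cis (θ φ).2 = cis (3 * (a₁ + a₂) / 2 + e * φ) ∧ cis (θ φ).1 = cis (2 * (e * φ))))
    (hT : ∀ φ ∈ Set.Icc 0 M, θ φ ∈ triangle)
    (hI : ∀ φ ∈ Set.Icc 0 M, φ ≠ 0 → Inner (θ φ)) :
    segment ℝ (θ M) (θ 0) ⊆ triangle ∧
    signedSet (cis a₁) (cis a₂) 1 (-1) = seg (θ M) (θ 0) ∧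
    ((∃ x, signedSet (cis a₁) (cis a₂) 1 (-1) = {x}) ↔ cis a₁ = cis a₂) ∧
    (cis a₁ = cis a₂ → ∃ c ∈ classesOf (IsSpecialElliptic 1),
      signedClasses (cis a₁) (cis a₂) 1 (-1) = {c}) ∧
    (cis a₁ ≠ cis a₂ →
      (∃ c ∈ classesOf IsRegularElliptic,
        lyingOver (signedClasses (cis a₁) (cis a₂) 1 (-1)) (θ M) = {c}) ∧
      (∃ c ∈ classesOf IsElliptoParabolic,
        lyingOver (signedClasses (cis a₁) (cis a₂) 1 (-1)) (θ 0) = {c})) := by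
  obtain ⟨q1, q2, q3, q4⟩ := ha
  have ha : Angles a₁ a₂ := ⟨q1, q2, q3, q4⟩
  have hlm : 0 ∈ Set.Icc 0 M := Set.left_mem_Icc.2 hM0
  have hrm : M ∈ Set.Icc 0 M := Set.right_mem_Icc.2 hM0
  have hcont : Continuous θ := by
    rw [funext hθ]; fun_prop
  have hinj' : Function.Injective θ := by
    intro x y hxy
    rw [hθ, hθ, Prod.mk.injEq] at hxy
    exact mul_right_cancel₀ hm (add_left_cancel hxy.1)
  have hMpt : cls (mixProd a₁ a₂ M) = cls (angleElement (θ M)) := by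
    rw [cls_mixProd_orthogonal hM]
    -- At this end `Σ + D = 3a₂` and `2D = 3(a₂-a₁)`, so the affine formula reproduces the angles of
    -- orthogonal centers.
    have e1 : (3 * a₂ : ℝ) = 3 * (a₁ + a₂) / 2 + e * M := by rw [heM]; ring
    have e2 : 3 * (a₂ - a₁) = 2 * (e * M) := by rw [heM]; ring
    rcases hc M with ⟨c1, c2⟩ | ⟨c1, c2⟩
    · exact cls_angleElement_eq (by rw [c1]; congr 1) (by rw [c2]; congr 1)
    · exact cls_angleElement_swap (by rw [c1]; congr 1) (by rw [c2]; congr 1)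
  have hC : ∀ φ ∈ Set.Icc 0 M, rho (cls (mixProd a₁ a₂ φ)) = point (θ φ) := by
    rcases hM0.lt_or_eq with hMlt | hMeq
    · refine rho_cls_eq_point (continuous_mixProd a₁ a₂) hcont hMlt ?_
      rintro φ ⟨h1, h2⟩
      have hlt : Real.cos (3 * (a₂ - a₁) / 2) < Real.cos φ := by
        rw [← hM]; exact Real.cos_lt_cos_of_nonneg_of_le_pi h1.le hMpi.le h2
      rcases hc φ with ⟨c1, c2⟩ | ⟨c1, c2⟩
      · exact (ha.mixProd_interior h1 (h2.trans hMpi) hlt he (hes hMlt.ne') c1 c2).2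
      · rw [(ha.mixProd_interior h1 (h2.trans hMpi) hlt he (hes hMlt.ne')
          (θ := ((θ φ).2, (θ φ).1)) c1 c2).2]
        exact cls_angleElement_swap rfl rfl
    · intro φ hφ
      have : φ = M := le_antisymm hφ.2 (by rw [← hMeq]; exact hφ.1)
      rw [this, hMpt]; rfl
  have hinj := injOn_point hinj' hT hI
  have hD := signedClasses_pos_neg ha hM0 hMpi hM fun h => ⟨e, he, hes h⟩
  have hM_iff : M = 0 ↔ cis a₁ = cis a₂ := by
    constructor
    · rintro rfl
      rw [mul_zero] at heM
      congr 1; linarith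
    · intro h
      have : a₁ = a₂ := eq_of_exp_eq h (by linarith) (by linarith)
      rw [this, sub_self, mul_zero, zero_div] at heM
      rcases mul_eq_zero.1 heM with h0 | h0
      · rcases he with h1 | h1 <;> rw [h1] at h0 <;> norm_num at h0
      · exact h0
  have hsingle : cis a₁ = cis a₂ → signedClasses (cis a₁) (cis a₂) 1 (-1) =
      {cls (mixProd a₁ a₂ M)} := by
    intro h
    rw [hD, hM_iff.2 h, Set.Icc_self, Set.image_singleton]
  refine ⟨convex_triangle.segment_subset (hT M hrm) (hT _ hlm), ?_, ⟨?_, ?_⟩, ?_, fun h => ⟨?_, ?_⟩⟩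
  · rw [signedSet, hD, rho_image hθ hM0 hC, seg, seg, segment_symm]
  · intro h
    rw [← hM_iff]
    by_contra hne
    rw [signedSet, hD] at h
    exact not_singleton_image (lt_of_le_of_ne hM0 (Ne.symm hne)) hC hinj h
  · intro h
    exact ⟨rho (cls (mixProd a₁ a₂ M)), by rw [signedSet, hsingle h, Set.image_singleton]⟩
  · intro h
    refine ⟨_, ⟨angleElement (3 * a₂, 0), ?_, ?_⟩, hsingle h⟩
    · have : a₁ = a₂ := eq_of_exp_eq h (by linarith) (by linarith)
      rw [cls_mixProd_orthogonal hM, this, sub_self, mul_zero]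
    · exact isSpecialElliptic_angleElement (cis_ne_one (by linarith) (by linarith))
  · refine ⟨_, ⟨angleElement (3 * a₂, 3 * (a₂ - a₁)), (cls_mixProd_orthogonal hM).symm, ?_⟩, ?_⟩
    · refine isRegularElliptic_angleElement (cis_ne_one (by linarith) (by linarith)) ?_ ?_
      · intro h0
        have := eq_of_exp_eq (a := 3 * (a₂ - a₁)) (b := 0)
          (h0.trans cis_zero.symm) (by linarith) (by linarith)
        apply h; congr 1; linarith
      · intro h0
        have := eq_of_exp_eq (a := 3 * a₂) (b := 3 * (a₂ - a₁)) h0 (by linarith) (by linarith)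
        linarith
    · rw [hD]; exact lyingOver_image hC hinj hrm
  · have hM1 : M ≠ 0 := fun h0 => h (hM_iff.1 h0)
    have hcos : Real.cos (3 * (a₂ - a₁) / 2) < 1 := by
      rw [← hM, ← Real.cos_zero]
      exact Real.cos_lt_cos_of_nonneg_of_le_pi le_rfl hMpi.le (lt_of_le_of_ne hM0 hM1.symm)
    refine ⟨_, ⟨mixProd a₁ a₂ 0, rfl, ha.mixProd_end hcos⟩, ?_⟩
    rw [hD]; exact lyingOver_image hC hinj hlm

theorem mix_part {a₁ a₂ : ℝ} (ha : Angles a₁ a₂) (P Q : ℝ × ℝ)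
    (h : a₁ ≤ a₂ ∧ P = (3 * a₂, 3 * a₂ - 3 * a₁) ∧ Q = (3 * (a₁ + a₂) / 2, 0) ∨
        a₂ ≤ a₁ ∧ P = (2 * Real.pi + 3 * a₂ - 3 * a₁, 3 * a₂) ∧
          Q = (2 * Real.pi, 3 * (a₁ + a₂) / 2)) :
    segment ℝ P Q ⊆ triangle ∧
    signedSet (cis a₁) (cis a₂) 1 (-1) = seg P Q ∧
    ((∃ x, signedSet (cis a₁) (cis a₂) 1 (-1) = {x}) ↔ cis a₁ = cis a₂) ∧
    (cis a₁ = cis a₂ → ∃ c ∈ classesOf (IsSpecialElliptic 1),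
      signedClasses (cis a₁) (cis a₂) 1 (-1) = {c}) ∧
    (cis a₁ ≠ cis a₂ →
      (∃ c ∈ classesOf IsRegularElliptic,
        lyingOver (signedClasses (cis a₁) (cis a₂) 1 (-1)) P = {c}) ∧
      (∃ c ∈ classesOf IsElliptoParabolic,
        lyingOver (signedClasses (cis a₁) (cis a₂) 1 (-1)) Q = {c})) := by
  have hpi := Real.pi_pos
  obtain ⟨q1, q2, q3, q4⟩ := ha
  have ha : Angles a₁ a₂ := ⟨q1, q2, q3, q4⟩
  rcases h with ⟨hs, rfl, rfl⟩ | ⟨hs, rfl, rfl⟩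
  · have := mix_generic ha (M := 3 * (a₂ - a₁) / 2) (e := 1) (by linarith) (by linarith) rfl
      (Or.inl rfl) (one_mul _)
      (fun h => by
        rw [one_mul]
        exact Real.sin_pos_of_pos_of_lt_pi (lt_of_le_of_ne (by linarith) h.symm) (by linarith))
      (θ := fun φ => (3 * (a₁ + a₂) / 2 + φ, 2 * φ))
      (k₁ := 3 * (a₁ + a₂) / 2) (m₁ := 1) (k₂ := 0) (m₂ := 2)
      (fun φ => by ext <;> simp; ring) (by norm_num)
      (fun φ => Or.inl ⟨by simp, by simp⟩)
      (fun φ hφ => ⟨by simp only; linarith [hφ.1], by simp only; linarith [hφ.2],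
        by simp only; linarith [hφ.2]⟩)
      (fun φ hφ hne => ⟨by
        have := lt_of_le_of_ne hφ.1 hne.symm; simp only; linarith, by simp only; linarith [hφ.2]⟩)
    have e1 : ((3 * a₂, 3 * a₂ - 3 * a₁) : ℝ × ℝ) =
        (3 * (a₁ + a₂) / 2 + 3 * (a₂ - a₁) / 2, 2 * (3 * (a₂ - a₁) / 2)) := by
      ext <;> simp <;> ring
    have e2 : ((3 * (a₁ + a₂) / 2, 0) : ℝ × ℝ) = (3 * (a₁ + a₂) / 2 + 0, 2 * 0) := by simp
    rw [e1, e2]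
    exact this
  · have := mix_generic ha (M := -(3 * (a₂ - a₁) / 2)) (e := -1) (by linarith) (by linarith)
      (Real.cos_neg _) (Or.inr rfl) (by ring)
      (fun h => by
        rw [neg_one_mul, ← Real.sin_neg]
        exact Real.sin_pos_of_pos_of_lt_pi (lt_of_le_of_ne (by linarith) h.symm) (by linarith))
      (θ := fun φ => (2 * Real.pi - 2 * φ, 3 * (a₁ + a₂) / 2 - φ))
      (k₁ := 2 * Real.pi) (m₁ := -2) (k₂ := 3 * (a₁ + a₂) / 2) (m₂ := -1)
      (fun φ => by ext <;> simp <;> ring) (by norm_num)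
      (fun φ => Or.inr ⟨by congr 1; ring, by
        simp only; rw [cis_two_pi_sub]; congr 1; ring⟩)
      (fun φ hφ => ⟨by simp only; linarith [hφ.2], by simp only; linarith [hφ.2],
        by simp only; linarith [hφ.1]⟩)
      (fun φ hφ hne => ⟨by simp only; linarith [hφ.2], by
        have := lt_of_le_of_ne hφ.1 hne.symm; simp only; linarith⟩)
    have e1 : ((2 * Real.pi + 3 * a₂ - 3 * a₁, 3 * a₂) : ℝ × ℝ) =
        (2 * Real.pi - 2 * -(3 * (a₂ - a₁) / 2),
          3 * (a₁ + a₂) / 2 - -(3 * (a₂ - a₁) / 2)) := by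
      ext <;> simp <;> ring
    have e2 : ((2 * Real.pi, 3 * (a₁ + a₂) / 2) : ℝ × ℝ) =
        (2 * Real.pi - 2 * 0, 3 * (a₁ + a₂) / 2 - 0) := by simp
    rw [e1, e2]
    exact this

/-! ### Both centers positive -/

/-- For `u ≠ 0` all these pairs are tangent and give one class; at `u = 0` the centers coincide.
This family exhibits two classes that cannot be separated. -/
theorem normalPair_tangent_line (u : ℝ) : NormalPair ![1, 0, 0] ![1, (u : ℂ), (u : ℂ)] 1 1 1 :=
  ⟨by simp [herm], by simp [herm], by simp [herm], by norm_num, by norm_num⟩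

/-- In the Hausdorff quotient the tangent product is glued to the product with equal centers. -/
theorem rho_cls_tangentProd {a₁ a₂ : ℝ} {F : SU21}
    (hF : IsProduct (cis a₁) (cis a₂) ![1, 0, 0] ![1, 0, 0] F) :
    rho (cls (tangentProd a₁ a₂)) = rho (cls F) := by
  have hc : Continuous fun u : ℝ => rho (cls (normalProd a₁ a₂ (normalPair_tangent_line u))) :=
    continuous_rho_cls.comp (continuous_normalProd a₁ a₂ normalPair_tangent_line (by
      refine continuous_pi fun i => ?_
      fin_cases i
      · exact continuous_const
      · exact Complex.continuous_ofReal
      · exact Complex.continuous_ofReal))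
  have h := Continuous.ext_on (dense_compl_singleton (0 : ℝ)) hc
    (continuous_const (y := rho (cls (tangentProd a₁ a₂)))) (fun u hu => congrArg rho
      ((normalPair_tangent_line u).cls_eq_tangent (fun h => hu (by
        have := congrFun h 1
        simpa using this.symm)) normalPair_tangent tangent_ne (isProduct_normalProd _ _ _)
        (isProduct_normalProd _ _ _)))
  have h0 := isProduct_normalProd a₁ a₂ (normalPair_tangent_line 0)
  simp only [Complex.ofReal_zero] at h0
  rw [← congrFun h 0]
  exact congrArg rho (cls_eq_of_self normalPair_tangent.sq1 normalPair_tangent.h11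
    normalPair_tangent.h11 h0 hF)

/-- Two affine paths meet at `τ = 1`: `η` for the definite range `M ≤ φ ≤ L` and `θ` for the
hyperbolic range `L ≤ φ ≤ π`. Along `η` the sum of the angles is constant, and by `hsum` the path
`θ` takes this sum only at `L`, so the segments do not meet elsewhere. The tangent class lies over
the common vertex. -/
theorem pos_generic {a₁ a₂ : ℝ} (ha : Angles a₁ a₂) {L M e : ℝ} (hM0 : 0 ≤ M) (hML : M < L)
    (hLpi : L ≤ Real.pi) (hL1 : L ≤ 3 * (a₁ + a₂) / 2)
    (hL2 : L ≤ 2 * Real.pi - 3 * (a₁ + a₂) / 2)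
    (hL : Real.cos L = Real.cos (3 * (a₁ + a₂) / 2))
    (hM : Real.cos M = Real.cos (3 * (a₂ - a₁) / 2))
    (hMP : cls (angleElement (-(3 * a₁), -(3 * a₂))) =
      cls (angleElement (2 * Real.pi - 3 * (a₁ + a₂) / 2 + M, 2 * Real.pi - 3 * (a₁ + a₂) / 2 - M)))
    (he : e = 1 ∨ e = -1) (hes : L < Real.pi → 0 < e * Real.sin (3 * (a₁ + a₂) / 2))
    {η θ : ℝ → ℝ × ℝ} {k₁ k₂ m₁ m₂ : ℝ}
    (hη : ∀ φ, η φ = (2 * Real.pi - 3 * (a₁ + a₂) / 2 + φ, 2 * Real.pi - 3 * (a₁ + a₂) / 2 - φ))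
    (hθ : ∀ φ, θ φ = (k₁ + φ * m₁, k₂ + φ * m₂)) (hm : m₁ ≠ 0)
    (hc : ∀ φ, (cis (θ φ).1 = cis (3 * (a₁ + a₂) / 2 - e * φ) ∧
        cis (θ φ).2 = cis (-(2 * (e * φ)))) ∨
      (cis (θ φ).2 = cis (3 * (a₁ + a₂) / 2 - e * φ) ∧ cis (θ φ).1 = cis (-(2 * (e * φ)))))
    (hT : ∀ φ ∈ Set.Icc L Real.pi, θ φ ∈ triangle) (hI : ∀ φ ∈ Set.Ioo L Real.pi, Inner (θ φ))
    (hQ : θ L = η L)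
    (hsum : ∀ φ, (θ φ).1 + (θ φ).2 = 4 * Real.pi - 3 * (a₁ + a₂) → φ = L) :
    segment ℝ (η M) (η L) ⊆ triangle ∧ segment ℝ (η L) (θ Real.pi) ⊆ triangle ∧
    η M ≠ η L ∧ HasSlope (-1) (η M) (η L) ∧
    signedSet (cis a₁) (cis a₂) 1 1 = seg (η M) (η L) ∪ seg (η L) (θ Real.pi) ∧
    (∃ c ∈ classesOf IsElliptic, lyingOver (signedClasses (cis a₁) (cis a₂) 1 1) (η M) = {c}) ∧
    ((∃ x, seg (η L) (θ Real.pi) = {x}) →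
      ∃ c ∈ classesOf IsThreeStepUnipotent,
        lyingOver (signedClasses (cis a₁) (cis a₂) 1 1) (η L) = {cls 1, c}) ∧
    ((¬ ∃ x, seg (η L) (θ Real.pi) = {x}) →
      ∃ c ∈ classesOf (IsSpecialElliptic 1), ∃ d ∈ classesOf IsElliptoParabolic,
      ∃ e ∈ classesOf IsElliptoParabolic,
        rho c = point (η L) ∧ rho d = point (η L) ∧ rho e = point (θ Real.pi) ∧
        lyingOver (signedClasses (cis a₁) (cis a₂) 1 1) (η L) ∪
          lyingOver (signedClasses (cis a₁) (cis a₂) 1 1) (θ Real.pi) = {c, d, e}) := by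
  have hL0 : 0 < L := hM0.trans_lt hML
  have hlm : L ∈ Set.Icc L Real.pi := Set.left_mem_Icc.2 hLpi
  have hrm : Real.pi ∈ Set.Icc L Real.pi := Set.right_mem_Icc.2 hLpi
  have hlM : M ∈ Set.Icc M L := Set.left_mem_Icc.2 hML.le
  have hrM : L ∈ Set.Icc M L := Set.right_mem_Icc.2 hML.le
  have hηaff : ∀ φ, η φ = (2 * Real.pi - 3 * (a₁ + a₂) / 2 + φ * 1,
      2 * Real.pi - 3 * (a₁ + a₂) / 2 + φ * (-1)) := by
    intro φ; rw [hη]; ext <;> simp; ring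
  have hηT : ∀ φ ∈ Set.Icc M L, η φ ∈ triangle := by
    rintro φ ⟨h1, h2⟩
    rw [hη]
    exact ⟨by simp only; linarith, by simp only; linarith, by simp only; linarith⟩
  have hηI : ∀ φ ∈ Set.Icc M L, φ ≠ L → Inner (η φ) := by
    rintro φ ⟨h1, h2⟩ hne
    have := lt_of_le_of_ne h2 hne
    rw [hη]
    exact ⟨by simp only; linarith, by simp only; linarith⟩
  have hηsum : ∀ φ, (η φ).1 + (η φ).2 = 4 * Real.pi - 3 * (a₁ + a₂) := by
    intro φ; rw [hη]; ring
  have hηinj : Function.Injective η := by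
    intro x y hxy
    rw [hη, hη, Prod.mk.injEq] at hxy
    exact add_left_cancel hxy.1
  have hθinj : Function.Injective θ := by
    intro x y hxy
    rw [hθ, hθ, Prod.mk.injEq] at hxy
    exact mul_right_cancel₀ hm (add_left_cancel hxy.1)
  have hCη : ∀ φ ∈ Set.Icc M L, rho (cls (posProd a₁ a₂ φ)) = point (η φ) := by
    refine rho_cls_eq_point (continuous_posProd a₁ a₂) (by rw [funext hη]; fun_prop) hML ?_
    rintro φ ⟨h1, h2⟩
    refine (ha.posProd_interior (hM0.trans_lt h1) (h2.trans_le hLpi) ?_ ?_ ?_ ?_).2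
    · rw [← hL]
      exact Real.cos_lt_cos_of_nonneg_of_le_pi (hM0.trans h1.le) hLpi h2
    · rw [← hM]; exact Real.cos_lt_cos_of_nonneg_of_le_pi hM0 (h2.le.trans hLpi) h1
    · rw [hη, ← cis_sub_two_pi]; congr 1; ring
    · rw [hη, ← cis_sub_two_pi]; congr 1; ring
  -- At `φ = L` both families have coincident positive centers, so they contribute the same class
  -- there.
  have hself := cls_eq_of_self normalPair_tangent.sq1 normalPair_tangent.h11
    normalPair_tangent.h11 (ha.hypProd_self hL) (ha.posProd_self hL)
  have hCθ : ∀ φ ∈ Set.Icc L Real.pi, rho (cls (hypProd a₁ a₂ φ)) = point (θ φ) := by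
    rcases hLpi.lt_or_eq with hlt | heq
    · refine rho_cls_eq_point (continuous_hypProd a₁ a₂) (by rw [funext hθ]; fun_prop) hlt ?_
      rintro φ ⟨h1, h2⟩
      have h0 := hL0.trans h1
      have hlt' : Real.cos φ < Real.cos (3 * (a₁ + a₂) / 2) := by
        rw [← hL]; exact Real.cos_lt_cos_of_nonneg_of_le_pi hL0.le h2.le h1
      rcases hc φ with ⟨c1, c2⟩ | ⟨c1, c2⟩
      · exact (ha.hypProd_interior h0 h2 hlt' he (hes hlt) c1 c2).2
      · rw [(ha.hypProd_interior h0 h2 hlt' he (hes hlt) (θ := ((θ φ).2, (θ φ).1)) c1 c2).2]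
        exact cls_angleElement_swap rfl rfl
    · intro φ hφ
      have : φ = L := le_antisymm (hφ.2.trans heq.ge) hφ.1
      rw [this, hQ, hself, hCη L hrM]
  have hd : rho (cls (tangentProd a₁ a₂)) = point (η L) := by
    rw [rho_cls_tangentProd (ha.posProd_self hL), hCη L hrM]
  have hD := signedClasses_pos_pos ha hL0 hLpi hL hM0 (hML.le.trans hLpi) hM
  have hinj := injOn_point hηinj hηT hηI
  have hPQ : point (η L) ≠ point (η M) := fun h => hML.ne' (hinj hrM hlM h)
  have hηθ : ∀ φ ∈ Set.Icc M L, ∀ ψ ∈ Set.Icc L Real.pi, point (η φ) = point (θ ψ) →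
      φ = L ∨ ψ = L := by
    intro φ hφ ψ hψ h
    by_cases hne : φ = L
    · exact Or.inl hne
    · right
      have := eq_of_point_eq (hT ψ hψ) (hηT φ hφ) (hηI φ hφ hne).1 (hηI φ hφ hne).2 h.symm
      exact hsum ψ (by rw [this, hηsum])
  have hmid : ∀ φ ∈ Set.Ioo L Real.pi, ∀ ψ ∈ Set.Icc L Real.pi, point (θ φ) = point (θ ψ) →
      φ = ψ := fun φ hφ ψ hψ h =>
    (hθinj (eq_of_point_eq (hT ψ hψ) (hT φ ⟨hφ.1.le, hφ.2.le⟩) (hI φ hφ).1 (hI φ hφ).2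
      h.symm)).symm
  have hsing : (∃ x, seg (η L) (θ Real.pi) = {x}) → L = Real.pi := by
    rintro ⟨x, hx⟩
    by_contra hne
    have hlt := lt_of_le_of_ne hLpi hne
    -- The midpoint is compared with an end rather than the two ends with each other, since the ends
    -- may be glued in the quotient.
    have hm' : (L + Real.pi) / 2 ∈ Set.Ioo L Real.pi := ⟨by linarith, by linarith⟩
    rw [← hQ, seg, segment_eq_image_line hθ hLpi] at hx
    have x1 : point (θ L) = x := by
      rw [← Set.mem_singleton_iff, ← hx]; exact ⟨_, ⟨L, hlm, rfl⟩, rfl⟩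
    have x2 : point (θ ((L + Real.pi) / 2)) = x := by
      rw [← Set.mem_singleton_iff, ← hx]; exact ⟨_, ⟨_, ⟨hm'.1.le, hm'.2.le⟩, rfl⟩, rfl⟩
    have := hmid _ hm' L hlm (x2.trans x1.symm)
    linarith
  have hIn := hηI M hlM hML.ne
  refine ⟨convex_triangle.segment_subset (hηT M hlM) (hηT L hrM), ?_, fun h => hML.ne (hηinj h),
    ?_, ?_, ⟨cls (posProd a₁ a₂ M), ⟨angleElement (η M), ?_, ?_⟩, ?_⟩, ?_, ?_⟩
  · rw [← hQ]; exact convex_triangle.segment_subset (hT L hlm) (hT _ hrm)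
  · rw [HasSlope, hη, hη]; ring
  · rw [signedSet, hD, Set.image_union, Set.image_union, rho_image hηaff hML.le hCη,
      rho_image hθ hLpi hCθ, hQ, Set.image_singleton, hd, Set.union_assoc]
    congr 1
    exact Set.union_eq_self_of_subset_right
      (Set.singleton_subset_iff.2 ⟨_, left_mem_segment ℝ _ _, rfl⟩)
  · obtain ⟨q₂, hN, hF⟩ := exists_pair_posProd (a₁ := a₁) (a₂ := a₂) (φ := M)
      (by rw [tauOf_eq_zero hM]; exact zero_le_one)
    rw [tauOf_eq_zero hM, Real.sqrt_zero] at hN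
    rw [(cls_of_orthogonal_pos hN hF (θ := (-(3 * a₁), -(3 * a₂))) rfl rfl).2, hMP, hη]
  · have hT' := hηT M hlM
    exact isElliptic_angleElement (Or.inr (cis_ne_one hIn.1 (hT'.2.1.trans_lt hIn.2)))
  · rw [hD]
    ext c
    constructor
    · rintro ⟨(⟨φ, hφ, rfl⟩ | ⟨φ, hφ, rfl⟩) | rfl, h⟩
      · have : φ = M := hinj hφ hlM ((hCη φ hφ).symm.trans h)
        rw [this]; rfl
      · have h' := (hCθ φ hφ).symm.trans h
        rcases hηθ M hlM φ hφ h'.symm with h1 | h1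
        · exact absurd h1 hML.ne
        · rw [h1, hQ] at h'; exact absurd h' hPQ
      · exact absurd (hd.symm.trans h) hPQ
    · rintro rfl
      exact ⟨Or.inl (Or.inl ⟨M, hlM, rfl⟩), hCη M hlM⟩
  · intro hs
    have hLe := hsing hs
    have hSig : 3 * (a₁ + a₂) / 2 = Real.pi := by linarith
    have h3 := cis_two_sigma_eq_one hSig
    have hone := cls_eq_one_of_self h3 normalPair_tangent.ne1 (ha.posProd_self hL)
    refine ⟨cls (tangentProd a₁ a₂), exists_threeStep_tangent normalPair_tangent tangent_ne
      (isProduct_normalProd _ _ _) ha.bet1 ha.bet2 h3, ?_⟩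
    rw [hD]
    ext c
    constructor
    · rintro ⟨(⟨φ, hφ, rfl⟩ | ⟨φ, hφ, rfl⟩) | rfl, h⟩
      · left
        have : φ = L := hinj hφ hrM ((hCη φ hφ).symm.trans h)
        simp only [this, hone]
      · left
        have : φ = L := le_antisymm (hφ.2.trans hLe.ge) hφ.1
        simp only [this, hself, hone]
      · exact Or.inr rfl
    · rintro (rfl | rfl)
      · exact ⟨Or.inl (Or.inl ⟨L, hrM, hone⟩), by rw [← hone, hCη L hrM]⟩
      · exact ⟨Or.inr rfl, hd⟩
  · intro hns
    have hlt : L < Real.pi := by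
      refine lt_of_le_of_ne hLpi fun h => hns ⟨point (η L), ?_⟩
      rw [← hQ, ← h, seg, segment_same, Set.image_singleton]
    have hSig : 3 * (a₁ + a₂) / 2 ≠ Real.pi := by
      intro h
      have := Real.cos_lt_cos_of_nonneg_of_le_pi hL0.le le_rfl hlt
      rw [hL, h] at this
      exact lt_irrefl _ this
    have hcm : -1 < Real.cos (3 * (a₁ + a₂) / 2) := by
      rw [← hL, ← Real.cos_pi]; exact Real.cos_lt_cos_of_nonneg_of_le_pi hL0.le le_rfl hlt
    have h3 := cis_two_sigma_ne_one ha hSig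
    have hs1 := sgn_of_herm_one normalPair_tangent.h11
    refine ⟨cls (posProd a₁ a₂ L), ⟨_, rfl, isSpecialElliptic_of_self (norm_cis _) (norm_cis _) h3
        (by rw [hs1]; decide) hs1 (ha.posProd_self hL)⟩,
      cls (tangentProd a₁ a₂), ⟨_, rfl, isElliptoParabolic_tangent normalPair_tangent tangent_ne
        (isProduct_normalProd _ _ _) ha.bet1 ha.bet2 h3⟩,
      cls (hypProd a₁ a₂ Real.pi), ⟨_, rfl, ha.hypProd_end hcm⟩, hCη L hrM, hd,
      hCθ _ hrm, ?_⟩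
    rw [hD]
    -- Both ends are treated at once: `Q` and `S` may be the same point of the quotient, so the
    -- fibres cannot be listed separately.
    have key : ∀ ψ ∈ Set.Icc L Real.pi, ∀ c, rho c = point (θ ψ) → ψ = L ∨ ψ = Real.pi →
        c ∈ (fun φ => cls (posProd a₁ a₂ φ)) '' Set.Icc M L ∪
          (fun φ => cls (hypProd a₁ a₂ φ)) '' Set.Icc L Real.pi ∪ {cls (tangentProd a₁ a₂)} →
        c ∈ ({cls (posProd a₁ a₂ L), cls (tangentProd a₁ a₂), cls (hypProd a₁ a₂ Real.pi)} :
          Set ClassSpace) := by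
      rintro ψ hψ _ h hψ' ((⟨φ, hφ, rfl⟩ | ⟨φ, hφ, rfl⟩) | rfl)
      · left
        have h' := (hCη φ hφ).symm.trans h
        have : φ = L := by
          rcases hηθ φ hφ ψ hψ h' with h1 | h1
          · exact h1
          · rw [h1, hQ] at h'; exact hinj hφ hrM h'
        simp only [this]
      · have h' := (hCθ φ hφ).symm.trans h
        rcases hφ.1.lt_or_eq with h1 | h1
        · rcases hφ.2.lt_or_eq with h2 | h2
          · have h4 := hmid φ ⟨h1, h2⟩ ψ hψ h'
            rcases hψ' with h5 | h5
            · exact absurd (h4.trans h5) h1.ne'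
            · exact absurd (h4.trans h5) h2.ne
          · right; right; simp only [h2]; rfl
        · left; simp only [← h1, hself]
      · exact Or.inr (Or.inl rfl)
    ext c
    constructor
    · rintro (⟨hc', h⟩ | ⟨hc', h⟩)
      · exact key L hlm c (by rw [h, hQ]) (Or.inl rfl) hc'
      · exact key _ hrm c h (Or.inr rfl) hc'
    · rintro (rfl | rfl | rfl)
      · exact Or.inl ⟨Or.inl (Or.inl ⟨L, hrM, rfl⟩), hCη L hrM⟩
      · exact Or.inl ⟨Or.inr rfl, hd⟩
      · exact Or.inr ⟨Or.inl (Or.inr ⟨_, hrm, rfl⟩), hCθ _ hrm⟩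

theorem pos_part {a₁ a₂ : ℝ} (ha : Angles a₁ a₂) (P Q S : ℝ × ℝ)
    (hP : a₁ ≤ a₂ ∧ P = (2 * Real.pi - 3 * a₁, 2 * Real.pi - 3 * a₂) ∨
      a₂ ≤ a₁ ∧ P = (2 * Real.pi - 3 * a₂, 2 * Real.pi - 3 * a₁))
    (hQS : a₁ + a₂ ≤ 2 * Real.pi / 3 ∧
          Q = (2 * Real.pi, 2 * Real.pi - 3 * (a₁ + a₂)) ∧
          S = (Real.pi + 3 * (a₁ + a₂) / 2, 0) ∨
        2 * Real.pi / 3 < a₁ + a₂ ∧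
          Q = (4 * Real.pi - 3 * (a₁ + a₂), 0) ∧
          S = (2 * Real.pi, 3 * (a₁ + a₂) / 2 - Real.pi)) :
    segment ℝ P Q ⊆ triangle ∧ segment ℝ Q S ⊆ triangle ∧
    P ≠ Q ∧ HasSlope (-1) P Q ∧ (HasSlope (1 / 2) Q S ∨ HasSlope 2 Q S) ∧
    signedSet (cis a₁) (cis a₂) 1 1 = seg P Q ∪ seg Q S ∧
    (∃ c ∈ classesOf IsElliptic, lyingOver (signedClasses (cis a₁) (cis a₂) 1 1) P = {c}) ∧
    ((∃ x, seg Q S = {x}) →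
      ∃ c ∈ classesOf IsThreeStepUnipotent,
        lyingOver (signedClasses (cis a₁) (cis a₂) 1 1) Q = {cls 1, c}) ∧
    ((¬ ∃ x, seg Q S = {x}) →
      ∃ c ∈ classesOf (IsSpecialElliptic 1), ∃ d ∈ classesOf IsElliptoParabolic,
      ∃ e ∈ classesOf IsElliptoParabolic,
        rho c = point Q ∧ rho d = point Q ∧ rho e = point S ∧
        lyingOver (signedClasses (cis a₁) (cis a₂) 1 1) Q ∪
          lyingOver (signedClasses (cis a₁) (cis a₂) 1 1) S = {c, d, e}) := by
  have hpi := Real.pi_pos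
  obtain ⟨q1, q2, q3, q4⟩ := ha
  have ha : Angles a₁ a₂ := ⟨q1, q2, q3, q4⟩
  -- Take `M = |D|`, so that `P` is the point of the path `η` with orthogonal centers, where the
  -- angles are `-3a₁` and `-3a₂` modulo `2π`; their order depends on the sign of `D`.
  obtain ⟨M, hM0, hM, hPM, hM1, hM2, hMP⟩ : ∃ M : ℝ, 0 ≤ M ∧
      Real.cos M = Real.cos (3 * (a₂ - a₁) / 2) ∧
      P = (2 * Real.pi - 3 * (a₁ + a₂) / 2 + M, 2 * Real.pi - 3 * (a₁ + a₂) / 2 - M) ∧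
      M < 3 * (a₁ + a₂) / 2 ∧ M < 2 * Real.pi - 3 * (a₁ + a₂) / 2 ∧
      cls (angleElement (-(3 * a₁), -(3 * a₂))) = cls (angleElement (2 * Real.pi -
        3 * (a₁ + a₂) / 2 + M, 2 * Real.pi - 3 * (a₁ + a₂) / 2 - M)) := by
    rcases hP with ⟨h, rfl⟩ | ⟨h, rfl⟩
    · refine ⟨3 * (a₂ - a₁) / 2, by linarith, rfl, by ext <;> simp <;> ring, by linarith,
        by linarith, cls_angleElement_eq ?_ ?_⟩
      · rw [← cis_add_two_pi]; congr 1; simp only; ring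
      · rw [← cis_add_two_pi]; congr 1; simp only; ring
    · refine ⟨-(3 * (a₂ - a₁) / 2), by linarith, Real.cos_neg _, by ext <;> simp <;> ring,
        by linarith, by linarith, cls_angleElement_swap ?_ ?_⟩
      · rw [← cis_add_two_pi]; congr 1; simp only; ring
      · rw [← cis_add_two_pi]; congr 1; simp only; ring
  rcases hQS with ⟨hs, rfl, rfl⟩ | ⟨hs, rfl, rfl⟩
  · obtain ⟨r1, r2, r3, r4, r5⟩ := pos_generic ha (L := 3 * (a₁ + a₂) / 2) (e := 1) hM0 hM1
      (by linarith) le_rfl (by linarith) rfl hM hMP (Or.inl rfl) (sin_sigma_pos ha)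
      (fun φ => rfl) (θ := fun φ => (3 * (a₁ + a₂) / 2 - φ + 2 * Real.pi, 2 * Real.pi - 2 * φ))
      (k₁ := 3 * (a₁ + a₂) / 2 + 2 * Real.pi) (m₁ := -1) (k₂ := 2 * Real.pi) (m₂ := -2)
      (fun φ => by ext <;> simp <;> ring) (by norm_num)
      (fun φ => Or.inl ⟨by simp only; rw [cis_add_two_pi, one_mul], by
        simp only; rw [cis_two_pi_sub, one_mul]⟩)
      (fun φ hφ => ⟨by simp only; linarith [hφ.2], by simp only; linarith [hφ.1],
        by simp only; linarith [hφ.1]⟩)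
      (fun φ hφ => ⟨by simp only; linarith [hφ.2], by simp only; linarith [hφ.1]⟩)
      (by ext <;> simp; ring) (fun φ h => by simp only at h; linarith)
    have e1 : ((2 * Real.pi, 2 * Real.pi - 3 * (a₁ + a₂)) : ℝ × ℝ) =
        (2 * Real.pi - 3 * (a₁ + a₂) / 2 + 3 * (a₁ + a₂) / 2,
          2 * Real.pi - 3 * (a₁ + a₂) / 2 - 3 * (a₁ + a₂) / 2) := by
      ext <;> simp; ring
    have e2 : ((Real.pi + 3 * (a₁ + a₂) / 2, 0) : ℝ × ℝ) =
        (3 * (a₁ + a₂) / 2 - Real.pi + 2 * Real.pi, 2 * Real.pi - 2 * Real.pi) := by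
      ext <;> simp; ring
    rw [hPM, e1, e2]
    exact ⟨r1, r2, r3, r4, Or.inr (by simp only [HasSlope]; ring), r5⟩
  · obtain ⟨r1, r2, r3, r4, r5⟩ := pos_generic ha (L := 2 * Real.pi - 3 * (a₁ + a₂) / 2)
      (e := -1) hM0 hM2 (by linarith) (by linarith) le_rfl (Real.cos_two_pi_sub _) hM hMP
      (Or.inr rfl) (fun _ => sin_sigma_neg ha (by linarith))
      (fun φ => rfl) (θ := fun φ => (2 * φ, 3 * (a₁ + a₂) / 2 + φ - 2 * Real.pi))
      (k₁ := 0) (m₁ := 2) (k₂ := 3 * (a₁ + a₂) / 2 - 2 * Real.pi) (m₂ := 1)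
      (fun φ => by ext <;> simp <;> ring) (by norm_num)
      (fun φ => Or.inr ⟨by simp only; rw [cis_sub_two_pi]; congr 1; ring, by congr 1; ring⟩)
      (fun φ hφ => ⟨by simp only; linarith [hφ.1], by simp only; linarith [hφ.1],
        by simp only; linarith [hφ.2]⟩)
      (fun φ hφ => ⟨by simp only; linarith [hφ.1], by simp only; linarith [hφ.2]⟩)
      (by ext <;> simp; ring) (fun φ h => by simp only at h; linarith)
    have e1 : ((4 * Real.pi - 3 * (a₁ + a₂), 0) : ℝ × ℝ) =
        (2 * Real.pi - 3 * (a₁ + a₂) / 2 + (2 * Real.pi - 3 * (a₁ + a₂) / 2),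
          2 * Real.pi - 3 * (a₁ + a₂) / 2 - (2 * Real.pi - 3 * (a₁ + a₂) / 2)) := by
      ext <;> simp; ring
    have e2 : ((2 * Real.pi, 3 * (a₁ + a₂) / 2 - Real.pi) : ℝ × ℝ) =
        (2 * Real.pi, 3 * (a₁ + a₂) / 2 + Real.pi - 2 * Real.pi) := by
      ext <;> simp; ring
    rw [hPM, e1, e2]
    exact ⟨r1, r2, r3, r4, Or.inl (by simp only [HasSlope]; ring), r5⟩

/-! ### All signatures -/

theorem decompClasses_eq_union (α₁ α₂ : ℂ) : decompClasses α₁ α₂ =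
    signedClasses α₁ α₂ (-1) (-1) ∪ signedClasses α₁ α₂ 1 1 ∪ signedClasses α₁ α₂ 1 (-1) ∪
      signedClasses α₁ α₂ (-1) 1 := by
  ext c
  constructor
  · rintro ⟨F, hc, hE, p₁, p₂, n1, n2, hF⟩
    have hs : ∀ {σ : SignType}, σ ≠ 0 → σ = -1 ∨ σ = 1 := by decide
    rcases hs n1 with e1 | e1 <;> rcases hs n2 with e2 | e2
    · exact Or.inl (Or.inl (Or.inl ⟨F, hc, hE, p₁, p₂, n1, n2, e1, e2, hF⟩))
    · exact Or.inr ⟨F, hc, hE, p₁, p₂, n1, n2, e1, e2, hF⟩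
    · exact Or.inl (Or.inr ⟨F, hc, hE, p₁, p₂, n1, n2, e1, e2, hF⟩)
    · exact Or.inl (Or.inl (Or.inr ⟨F, hc, hE, p₁, p₂, n1, n2, e1, e2, hF⟩))
  · rintro (((h | h) | h) | h) <;>
    · obtain ⟨F, hc, hE, p₁, p₂, n1, n2, -, -, hF⟩ := h
      exact ⟨F, hc, hE, p₁, p₂, n1, n2, hF⟩

end ComplexHyperbolic

end

theorem mainTheorem5 (a₁ a₂ : ℝ) (h₁ : 0 < a₁) (h₁' : a₁ < 2 * Real.pi / 3)
    (h₂ : 0 < a₂) (h₂' : a₂ < 2 * Real.pi / 3) (α₁ α₂ : ℂ)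
    (hα₁ : α₁ = Complex.exp (a₁ * Complex.I)) (hα₂ : α₂ = Complex.exp (a₂ * Complex.I)) :
    -- the union of the four pieces
    decompSet α₁ α₂ =
      signedSet α₁ α₂ (-1) (-1) ∪ signedSet α₁ α₂ 1 1 ∪
      signedSet α₁ α₂ 1 (-1) ∪ signedSet α₁ α₂ (-1) 1 ∧
    -- both centers negative
    (∀ P Q : ℝ × ℝ,
      (a₁ + a₂ ≤ 2 * Real.pi / 3 ∧
          P = (3 * a₁ + 3 * a₂, 3 * a₁ + 3 * a₂) ∧
          Q = (2 * Real.pi, Real.pi + 3 * (a₁ + a₂) / 2) ∨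
        2 * Real.pi / 3 < a₁ + a₂ ∧
          P = (3 * (a₁ + a₂) - 2 * Real.pi, 3 * (a₁ + a₂) - 2 * Real.pi) ∧
          Q = (3 * (a₁ + a₂) / 2 - Real.pi, 0)) →
      segment ℝ P Q ⊆ triangle ∧
      signedSet α₁ α₂ (-1) (-1) = seg P Q ∧
      ((∃ x, signedSet α₁ α₂ (-1) (-1) = {x}) → signedClasses α₁ α₂ (-1) (-1) = {cls 1}) ∧
      ((¬ ∃ x, signedSet α₁ α₂ (-1) (-1) = {x}) →
        (∃ c ∈ classesOf (IsSpecialElliptic (-1)),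
          lyingOver (signedClasses α₁ α₂ (-1) (-1)) P = {c}) ∧
        (∃ c ∈ classesOf IsElliptoParabolic,
          lyingOver (signedClasses α₁ α₂ (-1) (-1)) Q = {c}))) ∧
    -- both centers positive; `Q` is the common vertex of the two segments
    (∀ P Q S : ℝ × ℝ,
      (a₁ ≤ a₂ ∧ P = (2 * Real.pi - 3 * a₁, 2 * Real.pi - 3 * a₂) ∨
        a₂ ≤ a₁ ∧ P = (2 * Real.pi - 3 * a₂, 2 * Real.pi - 3 * a₁)) →
      (a₁ + a₂ ≤ 2 * Real.pi / 3 ∧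
          Q = (2 * Real.pi, 2 * Real.pi - 3 * (a₁ + a₂)) ∧
          S = (Real.pi + 3 * (a₁ + a₂) / 2, 0) ∨
        2 * Real.pi / 3 < a₁ + a₂ ∧
          Q = (4 * Real.pi - 3 * (a₁ + a₂), 0) ∧
          S = (2 * Real.pi, 3 * (a₁ + a₂) / 2 - Real.pi)) →
      segment ℝ P Q ⊆ triangle ∧ segment ℝ Q S ⊆ triangle ∧
      P ≠ Q ∧ HasSlope (-1) P Q ∧ (HasSlope (1 / 2) Q S ∨ HasSlope 2 Q S) ∧
      signedSet α₁ α₂ 1 1 = seg P Q ∪ seg Q S ∧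
      (∃ c ∈ classesOf IsElliptic, lyingOver (signedClasses α₁ α₂ 1 1) P = {c}) ∧
      ((∃ x, seg Q S = {x}) →
        ∃ c ∈ classesOf IsThreeStepUnipotent,
          lyingOver (signedClasses α₁ α₂ 1 1) Q = {cls 1, c}) ∧
      ((¬ ∃ x, seg Q S = {x}) →
        ∃ c ∈ classesOf (IsSpecialElliptic 1), ∃ d ∈ classesOf IsElliptoParabolic,
        ∃ e ∈ classesOf IsElliptoParabolic,
          rho c = point Q ∧ rho d = point Q ∧ rho e = point S ∧
          lyingOver (signedClasses α₁ α₂ 1 1) Q ∪ lyingOver (signedClasses α₁ α₂ 1 1) S =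
            {c, d, e})) ∧
    -- the first center positive, the second one negative
    (∀ P Q : ℝ × ℝ,
      (a₁ ≤ a₂ ∧ P = (3 * a₂, 3 * a₂ - 3 * a₁) ∧ Q = (3 * (a₁ + a₂) / 2, 0) ∨
        a₂ ≤ a₁ ∧ P = (2 * Real.pi + 3 * a₂ - 3 * a₁, 3 * a₂) ∧
          Q = (2 * Real.pi, 3 * (a₁ + a₂) / 2)) →
      segment ℝ P Q ⊆ triangle ∧
      signedSet α₁ α₂ 1 (-1) = seg P Q ∧
      ((∃ x, signedSet α₁ α₂ 1 (-1) = {x}) ↔ α₁ = α₂) ∧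
      (α₁ = α₂ → ∃ c ∈ classesOf (IsSpecialElliptic 1), signedClasses α₁ α₂ 1 (-1) = {c}) ∧
      (α₁ ≠ α₂ →
        (∃ c ∈ classesOf IsRegularElliptic,
          lyingOver (signedClasses α₁ α₂ 1 (-1)) P = {c}) ∧
        (∃ c ∈ classesOf IsElliptoParabolic,
          lyingOver (signedClasses α₁ α₂ 1 (-1)) Q = {c}))) ∧
    -- the first center negative, the second one positive
    (∀ P Q : ℝ × ℝ,
      (a₁ ≤ a₂ ∧ P = (2 * Real.pi + 3 * a₁ - 3 * a₂, 3 * a₁) ∧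
          Q = (2 * Real.pi, 3 * (a₁ + a₂) / 2) ∨
        a₂ ≤ a₁ ∧ P = (3 * a₁, 3 * a₁ - 3 * a₂) ∧ Q = (3 * (a₁ + a₂) / 2, 0)) →
      segment ℝ P Q ⊆ triangle ∧
      signedSet α₁ α₂ (-1) 1 = seg P Q ∧
      ((∃ x, signedSet α₁ α₂ (-1) 1 = {x}) ↔ α₁ = α₂) ∧
      (α₁ = α₂ → ∃ c ∈ classesOf (IsSpecialElliptic 1), signedClasses α₁ α₂ (-1) 1 = {c}) ∧
      (α₁ ≠ α₂ →
        (∃ c ∈ classesOf IsRegularElliptic,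
          lyingOver (signedClasses α₁ α₂ (-1) 1) P = {c}) ∧
        (∃ c ∈ classesOf IsElliptoParabolic,
          lyingOver (signedClasses α₁ α₂ (-1) 1) Q = {c}))) := by
  obtain rfl : α₁ = cis a₁ := hα₁
  obtain rfl : α₂ = cis a₂ := hα₂
  have ha : Angles a₁ a₂ := ⟨h₁, h₁', h₂, h₂'⟩
  refine ⟨?_, neg_part ha, fun P Q S hP hQS => pos_part ha P Q S hP hQS, mix_part ha, ?_⟩
  · simp only [decompSet, signedSet, decompClasses_eq_union, Set.image_union]
  · intro P Q h
    -- Interchanging the two factors reduces this case to the preceding one with `a₁` and `a₂`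
    -- exchanged, which also exchanges the two alternatives for `P` and `Q`.
    rw [add_comm a₁ a₂] at h
    have hsw := signedClasses_swap (norm_cis a₁) (norm_cis a₂) (-1) 1
    have hset : signedSet (cis a₁) (cis a₂) (-1) 1 = signedSet (cis a₂) (cis a₁) 1 (-1) := by
      rw [signedSet, hsw, signedSet]
    rw [hset, hsw, eq_comm (a := cis a₁), ne_comm (a := cis a₁)]
    exact mix_part ha.swap P Q h.symm
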